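/- **Theorem 1.1 (equivalently Theorem 3.1).** Let $n$ be the space dimension, let $c\in\mathbb{R}$ be a constant, let $T>0$, and let $f,g:\mathbb{R}^n\to\mathbb{R}$ be of class $C^{[n/2]+2}$, where $[\cdot]$ denotes the integer part (no decay or boundedness is assumed). Then there is a function $y:[0,T]\times\mathbb{R}^n\to\mathbb{R}$ of class $C^2$ (up to and including the boundary times $t=0$ and $t=T$, where time derivatives are one-sided) such that $$y_{tt}-c^2\Delta y=0\quad\text{on }[0,T]\times\mathbb{R}^n,\qquad \Delta=\sum_{i=1}^n\frac{\partial^2}{\partial x_i^2},$$ $$y(0,x)=f(x),\qquad y(T,x)=g(x)\qquad\text{for all }x\in\mathbb{R}^n.$$ Consequently the wave equation $y_{tt}-c^2\Delta y=0$ possesses global exact controllability: for every $T>0$ and all $f,g\in C^{[n/2]+2}(\mathbb{R}^n)$ the two-point boundary value problem above has a $C^2$ solution on $[0,T]\times\mathbb{R}^n$. -/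

import Mathlib

open Set
open scoped Laplacian

/-- `y = y(t, x)` is a classical (`C²` up to the boundary times) solution of the wave equation
`y_tt - c² Δ y = 0` on the closed strip `[0, T] × ℝⁿ`. At the end times `t = 0` and `t = T` the time
derivatives are the one-sided ones. -/
structure IsC2WaveSolution (n : ℕ) (c T : ℝ) (y : ℝ → EuclideanSpace ℝ (Fin n) → ℝ) : Prop where
  contDiffOn : ContDiffOn ℝ 2 (fun p : ℝ × EuclideanSpace ℝ (Fin n) => y p.1 p.2)
    (Icc (0 : ℝ) T ×ˢ univ)
  wave_eq : ∀ t ∈ Icc (0 : ℝ) T, ∀ x : EuclideanSpace ℝ (Fin n),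
    iteratedDerivWithin 2 (fun s => y s x) (Icc (0 : ℝ) T) t - c ^ 2 * (Δ (y t)) x = 0

/-- `y` solves the two-point boundary value problem for the wave equation on `[0, T] × ℝⁿ` with
initial state `f` and terminal state `g`. -/
structure IsTwoPointSolution (n : ℕ) (c T : ℝ) (f g : EuclideanSpace ℝ (Fin n) → ℝ)
    (y : ℝ → EuclideanSpace ℝ (Fin n) → ℝ) : Prop where
  isSolution : IsC2WaveSolution n c T y
  initial : ∀ x, y 0 x = f x
  terminal : ∀ x, y T x = g x

/-- Global exact controllability of the wave equation with speed `c` on `ℝⁿ`: for every time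
horizon `T > 0` and all initial and terminal states of class `C^{⌊n/2⌋+2}`, the two-point boundary
value problem has a `C²` solution on `[0, T] × ℝⁿ`. -/
def GloballyExactlyControllable (n : ℕ) (c : ℝ) : Prop :=
  ∀ T : ℝ, 0 < T → ∀ f g : EuclideanSpace ℝ (Fin n) → ℝ,
    ContDiff ℝ ((n / 2 + 2 : ℕ) : WithTop ℕ∞) f → ContDiff ℝ ((n / 2 + 2 : ℕ) : WithTop ℕ∞) g →
      ∃ y : ℝ → EuclideanSpace ℝ (Fin n) → ℝ, IsTwoPointSolution n c T f g y

/-! Scaling time by `|c|` and superposing one solution with a time-reversed one reduces everything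
to null control: for every `f` of class `C^{⌊n/2⌋+2}` there is a wave (`IsWave`, speed one, on all
of space-time) with state `f` at time `0` and state `0` at time `T`. Initial velocity is
unconstrained, which is what makes this possible. The cases `c = 0` and `n = 0` are linear
interpolation in time.

Compactly supported `f` (`exists_wave_of_compact_support`). Put `m = ⌊n/2⌋`. Averages of `f (x + t
v)`, with `v` distributed as the projection of the uniform measure on the unit sphere of odd
dimension-number `2m + 1 ≥ n`, solve the Euler-Poisson-Darboux equation `t φ_tt + 2m φ_t = t Δφ`.
The step `φ ↦ φ + t φ_t / (k - 1)` lowers the parameter `k` by two and costs one derivative, so `m`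
steps give a `C²` wave `u` with `u(0) = f`; this accounts for the regularity `m + 2`. Locally in
`x`, the wave `u` and its derivatives up to order two are `O(t⁻²)`, because only directions `|v| ≲
1/t` still meet the support of `f`. Hence the reflected series `∑ₖ u(2kT + t) - u(2(k+1)T - t)`
converges; it vanishes at `t = T` and telescopes to `f` at `t = 0`.

General `f` cannot be treated by just adding up the controls of the pieces of a partition of unity,
since pieces far away need not have small controls near the origin. Convergence is forced as in the
Mittag-Leffler theorem. For rough `f` (`exists_wave_smooth_remainder`), from the control of each
piece one subtracts a wave that is `C²` close to it on a large ball, still vanishes at time `T` and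
has smooth initial state: its mollification in `x`. The sum then converges and controls `f` up to a
smooth error.

For smooth `f` (`exists_wave_of_smooth`) the required smallness comes from exponentially growing
solutions (`exists_wave_of_unit_cap`). If `f` lives in the unit cube and in `x i ≥ a`, expand it
there in exponentials `exp (η · x)` with `Re η = s eᵢ`; the coefficients are `O(exp (-s a))` with
rapid decay in the frequency. Each exponential extends to the wave `exp (η · x) sinh ((T - t) ρ) /
sinh (T ρ)` with `ρ² = η · η`, and `|Re ρ| ≤ s`, so on the ball of radius `r` the sum is `O(exp (s
(T + 2 r - a)))`, which tends to zero as `s → ∞` if `T + 2 r < a`. Shifting the frequency lattice by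
`π i` keeps `sinh (T ρ)` away from zero up to a polynomial loss. Outside the cube the initial state
is wrong, so the match is exact only on a prescribed ball; the remainder vanishes on that ball and
is passed to the next step, with larger balls and errors `2⁻ʲ`. -/

set_option linter.unusedSectionVars false

/-! ### Local `C²` bounds and series of `C²` functions -/

section LocalC2

variable {V F : Type*} [NormedAddCommGroup V] [NormedSpace ℝ V]
  [NormedAddCommGroup F] [NormedSpace ℝ F]

/-- `f`, its derivative and its second derivative are bounded by `ε` at `p`. -/
def C2BoundAt (f : V → F) (p : V) (ε : ℝ) : Prop :=
  ‖f p‖ ≤ ε ∧ ‖fderiv ℝ f p‖ ≤ ε ∧ ‖fderiv ℝ (fderiv ℝ f) p‖ ≤ ε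

/-- `f`, its derivative and its second derivative are bounded by `ε` on the closed ball of
radius `r` around the origin. -/
def C2NormLE (f : V → F) (r ε : ℝ) : Prop :=
  ∀ p, ‖p‖ ≤ r → C2BoundAt f p ε

theorem C2NormLE.mono {f : V → F} {r r' ε ε' : ℝ} (h : C2NormLE f r ε) (hr : r' ≤ r)
    (hε : ε ≤ ε') : C2NormLE f r' ε' := fun p hp =>
  ⟨((h p (hp.trans hr)).1).trans hε, ((h p (hp.trans hr)).2.1).trans hε,
    ((h p (hp.trans hr)).2.2).trans hε⟩

theorem contDiff_two_iff_fderiv_fderiv {f : V → F} :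
    ContDiff ℝ 2 f ↔ Differentiable ℝ f ∧ Differentiable ℝ (fderiv ℝ f) ∧
      Continuous (fderiv ℝ (fderiv ℝ f)) := by
  have h2 : (2 : WithTop ℕ∞) = 1 + 1 := by norm_num
  rw [h2, contDiff_succ_iff_fderiv, contDiff_one_iff_fderiv]
  simp

theorem exists_c2NormLE [ProperSpace V] {f : V → F} (hf : ContDiff ℝ 2 f) (r : ℝ) :
    ∃ C, 0 ≤ C ∧ C2NormLE f r C := by
  obtain ⟨h1, h2, h3⟩ := contDiff_two_iff_fderiv_fderiv.1 hf
  have hK := isCompact_closedBall (0 : V) r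
  obtain ⟨a, ha⟩ := hK.exists_bound_of_continuousOn h1.continuous.continuousOn
  obtain ⟨b, hb⟩ := hK.exists_bound_of_continuousOn h2.continuous.continuousOn
  obtain ⟨c, hc⟩ := hK.exists_bound_of_continuousOn (E := V →L[ℝ] V →L[ℝ] F) h3.continuousOn
  refine ⟨max 0 (max a (max b c)), le_max_left _ _, fun p hp => ?_⟩
  have hp' : p ∈ Metric.closedBall (0 : V) r := by simpa using hp
  exact ⟨(ha p hp').trans (by simp), (hb p hp').trans (by simp), (hc p hp').trans (by simp)⟩


theorem fderiv_fderiv_add {f g : V → F} (hf : ContDiff ℝ 2 f)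
    (hg : ContDiff ℝ 2 g) (p : V) : fderiv ℝ (fderiv ℝ (fun q => f q + g q)) p =
      fderiv ℝ (fderiv ℝ f) p + fderiv ℝ (fderiv ℝ g) p := by
  obtain ⟨h1, h2, -⟩ := contDiff_two_iff_fderiv_fderiv.1 hf
  obtain ⟨k1, k2, -⟩ := contDiff_two_iff_fderiv_fderiv.1 hg
  have : fderiv ℝ (fun q => f q + g q) = fun q => fderiv ℝ f q + fderiv ℝ g q :=
    funext fun q => fderiv_fun_add (h1 q) (k1 q)
  rw [this, fderiv_fun_add (h2 p) (k2 p)]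

theorem fderiv_fderiv_neg (f : V → F) (p : V) :
    fderiv ℝ (fderiv ℝ (fun q => -f q)) p = -fderiv ℝ (fderiv ℝ f) p := by
  have : fderiv ℝ (fun q => -f q) = fun q => -fderiv ℝ f q := funext fun q => fderiv_fun_neg
  rw [this, fderiv_fun_neg]

theorem fderiv_comp_affine {W : Type*} [NormedAddCommGroup W] [NormedSpace ℝ W] {f : V → F}
    (hf : Differentiable ℝ f) (A : W →L[ℝ] V) (b : V) (p : W) :
    fderiv ℝ (fun q => f (A q + b)) p = (fderiv ℝ f (A p + b)).comp A :=
  ((hf _).hasFDerivAt.comp p (A.hasFDerivAt.add_const b)).fderiv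

theorem fderiv_fderiv_comp_affine {W : Type*} [NormedAddCommGroup W] [NormedSpace ℝ W] {f : V → F}
    (hf : ContDiff ℝ 2 f) (A : W →L[ℝ] V) (b : V) (p : W) :
    fderiv ℝ (fderiv ℝ (fun q => f (A q + b))) p =
      ((ContinuousLinearMap.compL ℝ W V F).flip A).comp
        ((fderiv ℝ (fderiv ℝ f) (A p + b)).comp A) := by
  obtain ⟨h1, h2, -⟩ := contDiff_two_iff_fderiv_fderiv.1 hf
  have : fderiv ℝ (fun q => f (A q + b)) =
      fun q => (ContinuousLinearMap.compL ℝ W V F).flip A (fderiv ℝ f (A q + b)) :=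
    funext fun q => fderiv_comp_affine h1 A b q
  rw [this]
  exact ((ContinuousLinearMap.hasFDerivAt _).comp p
    ((h2 _).hasFDerivAt.comp p (A.hasFDerivAt.add_const b))).fderiv

theorem norm_fderiv_fderiv_comp_affine_le {W : Type*} [NormedAddCommGroup W] [NormedSpace ℝ W]
    {f : V → F} (hf : ContDiff ℝ 2 f) (A : W →L[ℝ] V) (b : V) (p : W) :
    ‖fderiv ℝ (fderiv ℝ (fun q => f (A q + b))) p‖ ≤
      ‖fderiv ℝ (fderiv ℝ f) (A p + b)‖ * ‖A‖ ^ 2 := by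
  rw [fderiv_fderiv_comp_affine hf]
  refine ContinuousLinearMap.opNorm_le_bound _ (by positivity) fun u =>
    ContinuousLinearMap.opNorm_le_bound _ (by positivity) fun v => ?_
  simp only [ContinuousLinearMap.comp_apply, ContinuousLinearMap.flip_apply,
    ContinuousLinearMap.compL_apply]
  calc _ ≤ ‖fderiv ℝ (fderiv ℝ f) (A p + b)‖ * ‖A u‖ * ‖A v‖ :=
        ContinuousLinearMap.le_opNorm₂ _ _ _
    _ ≤ ‖fderiv ℝ (fderiv ℝ f) (A p + b)‖ * (‖A‖ * ‖u‖) * (‖A‖ * ‖v‖) := by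
        gcongr <;> exact A.le_opNorm _
    _ = _ := by ring

theorem C2BoundAt.comp_affine {W : Type*} [NormedAddCommGroup W] [NormedSpace ℝ W]
    {f : V → F} (hf : ContDiff ℝ 2 f) {A : W →L[ℝ] V} {b : V} {p : W} {ε M : ℝ}
    (h : C2BoundAt f (A p + b) ε) (hA : ‖A‖ ≤ M) (hM : 1 ≤ M) :
    C2BoundAt (fun q => f (A q + b)) p (ε * M ^ 2) := by
  have hε : 0 ≤ ε := (norm_nonneg _).trans h.1
  refine ⟨h.1.trans (le_mul_of_one_le_right hε (one_le_pow₀ hM)), ?_, ?_⟩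
  · rw [fderiv_comp_affine (hf.differentiable (by simp))]
    refine (ContinuousLinearMap.opNorm_comp_le _ _).trans ?_
    refine mul_le_mul h.2.1 (hA.trans ?_) (norm_nonneg _) hε
    nlinarith
  · refine (norm_fderiv_fderiv_comp_affine_le hf A b p).trans ?_
    gcongr
    exact h.2.2

theorem C2BoundAt.add {f g : V → F} (hf : ContDiff ℝ 2 f) (hg : ContDiff ℝ 2 g) {p : V}
    {a b : ℝ} (h : C2BoundAt f p a) (k : C2BoundAt g p b) :
    C2BoundAt (fun q => f q + g q) p (a + b) := by
  refine ⟨(norm_add_le _ _).trans (add_le_add h.1 k.1), ?_, ?_⟩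
  · rw [fderiv_fun_add (hf.differentiable (by simp) p) (hg.differentiable (by simp) p)]
    exact (norm_add_le _ _).trans (add_le_add h.2.1 k.2.1)
  · rw [fderiv_fderiv_add hf hg]
    refine (ContinuousLinearMap.opNorm_add_le _ _).trans (add_le_add h.2.2 k.2.2)

theorem C2BoundAt.neg {f : V → F} {p : V} {a : ℝ} (h : C2BoundAt f p a) :
    C2BoundAt (fun q => -f q) p a := by
  refine ⟨by rw [norm_neg]; exact h.1, by rw [fderiv_fun_neg, norm_neg]; exact h.2.1, ?_⟩
  rw [fderiv_fderiv_neg]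
  exact (ContinuousLinearMap.opNorm_neg _).trans_le h.2.2

theorem C2BoundAt.sub {f g : V → F} (hf : ContDiff ℝ 2 f) (hg : ContDiff ℝ 2 g) {p : V}
    {a b : ℝ} (h : C2BoundAt f p a) (k : C2BoundAt g p b) :
    C2BoundAt (fun q => f q - g q) p (a + b) := by
  simpa only [sub_eq_add_neg] using C2BoundAt.add hf hg.neg h k.neg

/-- Only the tail has to be estimated: the finitely many remaining terms are bounded on the ball by
compactness. -/
theorem exists_summable_c2NormLE [ProperSpace V] {f : ℕ → V → F} (hf : ∀ i, ContDiff ℝ 2 (f i))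
    {r : ℝ} {N : ℕ} {b : ℕ → ℝ} (hb : Summable b) (h : ∀ i, N ≤ i → C2NormLE (f i) r (b i)) :
    ∃ b : ℕ → ℝ, Summable b ∧ ∀ i, C2NormLE (f i) r (b i) := by
  choose C hC0 hC using fun i => exists_c2NormLE (hf i) r
  refine ⟨fun i => if N ≤ i then b i else C i, ?_, fun i => ?_⟩
  · rw [← summable_nat_add_iff N] at hb ⊢
    simpa using hb
  · dsimp only
    split_ifs with hi
    exacts [h i hi, hC i]

variable {ι : Type*} [CompleteSpace F]

theorem hasFDerivAt_tsum_of_local_bound {f : ι → V → F} (hf : ∀ i, Differentiable ℝ (f i))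
    (hb : ∀ r : ℝ, ∃ b : ι → ℝ, Summable b ∧
      ∀ i p, ‖p‖ ≤ r → ‖f i p‖ ≤ b i ∧ ‖fderiv ℝ (f i) p‖ ≤ b i) (p : V) :
    HasFDerivAt (fun q => ∑' i, f i q) (∑' i, fderiv ℝ (f i) p) p := by
  obtain ⟨b, hbs, hb⟩ := hb (‖p‖ + 1)
  have hmem : p ∈ Metric.ball (0 : V) (‖p‖ + 1) := by simp
  have hle : ∀ x ∈ Metric.ball (0 : V) (‖p‖ + 1), ‖x‖ ≤ ‖p‖ + 1 := fun x hx => by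
    simpa using (mem_ball_zero_iff.1 hx).le
  exact hasFDerivAt_tsum_of_isPreconnected hbs Metric.isOpen_ball
    (convex_ball _ _).isPreconnected (fun i x _ => (hf i x).hasFDerivAt)
    (fun i x hx => (hb i x (hle x hx)).2) hmem
    (Summable.of_norm_bounded hbs fun i => (hb i p (hle p hmem)).1) hmem

theorem continuous_tsum_of_local_bound {ι V F : Type*} [SeminormedAddCommGroup V]
    [NormedAddCommGroup F] [CompleteSpace F] {f : ι → V → F} (hf : ∀ i, Continuous (f i))
    (hb : ∀ r : ℝ, ∃ b : ι → ℝ, Summable b ∧ ∀ i p, ‖p‖ ≤ r → ‖f i p‖ ≤ b i) :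
    Continuous (fun q => ∑' i, f i q) := by
  rw [continuous_iff_continuousAt]
  intro p
  obtain ⟨b, hbs, hb⟩ := hb (‖p‖ + 1)
  have : ContinuousOn (fun q => ∑' i, f i q) (Metric.ball (0 : V) (‖p‖ + 1)) :=
    continuousOn_tsum (fun i => (hf i).continuousOn) hbs
      fun i x hx => hb i x (mem_ball_zero_iff.1 hx).le
  exact this.continuousAt (Metric.isOpen_ball.mem_nhds (by simp))

/-- A series of `C²` functions whose derivatives up to order two are locally uniformly summable is
`C²` and can be differentiated twice term by term. -/
theorem contDiff_two_tsum {f : ι → V → F} (hf : ∀ i, ContDiff ℝ 2 (f i))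
    (hb : ∀ r : ℝ, ∃ b : ι → ℝ, Summable b ∧ ∀ i, C2NormLE (f i) r (b i)) :
    ContDiff ℝ 2 (fun q => ∑' i, f i q) ∧
    (∀ p, fderiv ℝ (fun q => ∑' i, f i q) p = ∑' i, fderiv ℝ (f i) p) ∧
    ∀ p, fderiv ℝ (fderiv ℝ (fun q => ∑' i, f i q)) p = ∑' i, fderiv ℝ (fderiv ℝ (f i)) p := by
  have hf' := fun i => contDiff_two_iff_fderiv_fderiv.1 (hf i)
  have h1 := hasFDerivAt_tsum_of_local_bound (fun i => (hf' i).1) fun r => by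
    obtain ⟨b, hs, h⟩ := hb r
    exact ⟨b, hs, fun i p hp => ⟨(h i p hp).1, (h i p hp).2.1⟩⟩
  have h2 := hasFDerivAt_tsum_of_local_bound (fun i => (hf' i).2.1) fun r => by
    obtain ⟨b, hs, h⟩ := hb r
    exact ⟨b, hs, fun i p hp => ⟨(h i p hp).2.1, (h i p hp).2.2⟩⟩
  have h3 := continuous_tsum_of_local_bound (F := V →L[ℝ] V →L[ℝ] F) (fun i => (hf' i).2.2) fun r => by
    obtain ⟨b, hs, h⟩ := hb r
    exact ⟨b, hs, fun i p hp => (h i p hp).2.2⟩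
  have e1 : fderiv ℝ (fun q => ∑' i, f i q) = fun p => ∑' i, fderiv ℝ (f i) p :=
    funext fun p => (h1 p).fderiv
  have e2 : fderiv ℝ (fderiv ℝ (fun q => ∑' i, f i q)) =
      fun p => ∑' i, fderiv ℝ (fderiv ℝ (f i)) p := by
    rw [e1]; exact funext fun p => (h2 p).fderiv
  refine ⟨contDiff_two_iff_fderiv_fderiv.2 ⟨fun p => (h1 p).differentiableAt, ?_, ?_⟩,
    fun p => congrFun e1 p, fun p => congrFun e2 p⟩
  · rw [e1]; exact fun p => (h2 p).differentiableAt
  · rw [e2]; exact h3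

theorem C2NormLE.tsum {f : ι → V → F} (hf : ∀ i, ContDiff ℝ 2 (f i))
    (hb : ∀ r : ℝ, ∃ b : ι → ℝ, Summable b ∧ ∀ i, C2NormLE (f i) r (b i))
    {r : ℝ} {b : ι → ℝ} (hbs : Summable b) (h : ∀ i, C2NormLE (f i) r (b i)) :
    C2NormLE (fun q => ∑' i, f i q) r (∑' i, b i) := by
  obtain ⟨-, h1, h2⟩ := contDiff_two_tsum hf hb
  intro p hp
  rw [C2BoundAt, h1, h2]
  exact ⟨tsum_of_norm_bounded hbs.hasSum fun i => (h i p hp).1,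
    tsum_of_norm_bounded hbs.hasSum fun i => (h i p hp).2.1,
    tsum_of_norm_bounded (E := V →L[ℝ] V →L[ℝ] F) hbs.hasSum fun i => (h i p hp).2.2⟩

end LocalC2


/-! ### Classical solutions of the wave equation -/

section Wave

variable {V ι : Type*} [NormedAddCommGroup V] [NormedSpace ℝ V] [Fintype ι]

/-- The principal symbol of the wave operator with time direction `e₀` and space directions `e i`,
as a functional of the second derivative. -/
noncomputable def waveForm (e₀ : V) (e : ι → V) (B : V →L[ℝ] V →L[ℝ] ℝ) : ℝ :=
  B e₀ e₀ - ∑ i, B (e i) (e i)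

theorem waveForm_add (e₀ : V) (e : ι → V) (B C : V →L[ℝ] V →L[ℝ] ℝ) :
    waveForm e₀ e (B + C) = waveForm e₀ e B + waveForm e₀ e C := by
  simp only [waveForm, add_apply, Finset.sum_add_distrib]; ring

theorem waveForm_neg (e₀ : V) (e : ι → V) (B : V →L[ℝ] V →L[ℝ] ℝ) :
    waveForm e₀ e (-B) = -waveForm e₀ e B := by
  simp only [waveForm, neg_apply, Finset.sum_neg_distrib]; ring

theorem HasSum.waveForm {κ : Type*} (e₀ : V) (e : ι → V) {B : κ → V →L[ℝ] V →L[ℝ] ℝ}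
    {C : V →L[ℝ] V →L[ℝ] ℝ} (h : HasSum B C) :
    HasSum (fun k => waveForm e₀ e (B k)) (waveForm e₀ e C) := by
  have key : ∀ u, HasSum (fun k => B k u u) (C u u) := fun u =>
    (ContinuousLinearMap.apply ℝ ℝ u).hasSum ((ContinuousLinearMap.apply ℝ (V →L[ℝ] ℝ) u).hasSum h)
  exact (key e₀).sub (hasSum_sum fun i _ => key (e i))

/-- `C²` solutions of the wave equation with time direction `e₀` and space directions `e i`. -/
structure SolvesWave (e₀ : V) (e : ι → V) (f : V → ℝ) : Prop where
  contDiff : ContDiff ℝ 2 f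
  waveForm_eq : ∀ p, waveForm e₀ e (fderiv ℝ (fderiv ℝ f) p) = 0

variable {e₀ : V} {e : ι → V}

theorem SolvesWave.add {f g : V → ℝ} (hf : SolvesWave e₀ e f) (hg : SolvesWave e₀ e g) :
    SolvesWave e₀ e (fun p => f p + g p) :=
  ⟨hf.1.add hg.1, fun p => by
    rw [fderiv_fderiv_add hf.1 hg.1, waveForm_add, hf.2, hg.2, add_zero]⟩

theorem SolvesWave.neg {f : V → ℝ} (hf : SolvesWave e₀ e f) : SolvesWave e₀ e (fun p => -f p) :=
  ⟨hf.1.neg, fun p => by rw [fderiv_fderiv_neg, waveForm_neg, hf.2, neg_zero]⟩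

theorem SolvesWave.sub {f g : V → ℝ} (hf : SolvesWave e₀ e f) (hg : SolvesWave e₀ e g) :
    SolvesWave e₀ e (fun p => f p - g p) := by
  simpa [sub_eq_add_neg] using hf.add hg.neg

theorem SolvesWave.tsum {κ : Type*} {f : κ → V → ℝ} (hf : ∀ i, SolvesWave e₀ e (f i))
    (hb : ∀ r : ℝ, ∃ b : κ → ℝ, Summable b ∧ ∀ i, C2NormLE (f i) r (b i)) :
    SolvesWave e₀ e (fun q => ∑' i, f i q) := by
  obtain ⟨h0, -, h2⟩ := contDiff_two_tsum (fun i => (hf i).1) hb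
  refine ⟨h0, fun p => ?_⟩
  obtain ⟨b, hbs, h⟩ := hb ‖p‖
  have hs : Summable fun i => fderiv ℝ (fderiv ℝ (f i)) p :=
    Summable.of_norm_bounded (E := V →L[ℝ] V →L[ℝ] ℝ) hbs fun i => (h i p le_rfl).2.2
  rw [h2, ← (hs.hasSum.waveForm e₀ e).tsum_eq]
  simp [(hf _).2]

/-- Both halves of the wave operator pick up the same factor `b ^ 2 = l ^ 2`. The signs of `b` and
`l` are free, so time reversal and the reflection of space are covered along with translations and
dilations. -/
theorem SolvesWave.comp_affine {f : V → ℝ} (hf : SolvesWave e₀ e f) (A : V →L[ℝ] V) (q : V)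
    {b l : ℝ} (h₀ : A e₀ = b • e₀) (h : ∀ i, A (e i) = l • e i) (hbl : b ^ 2 = l ^ 2) :
    SolvesWave e₀ e (fun p => f (A p + q)) := by
  refine ⟨hf.1.comp (A.contDiff.add contDiff_const), fun p => ?_⟩
  have := hf.2 (A p + q)
  rw [waveForm, sub_eq_zero] at this
  rw [fderiv_fderiv_comp_affine hf.1, waveForm]
  simp only [ContinuousLinearMap.comp_apply, ContinuousLinearMap.flip_apply,
    ContinuousLinearMap.compL_apply, h₀, h, map_smul, smul_apply, this,
    smul_eq_mul, ← Finset.mul_sum]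
  linear_combination (∑ i, fderiv ℝ (fderiv ℝ f) (A p + q) (e i) (e i)) * hbl

end Wave

section SpaceTime

variable {n : ℕ}

/-- `C²` solutions of `y_tt = Δ y` on all of space-time. -/
abbrev IsWave (f : ℝ × EuclideanSpace ℝ (Fin n) → ℝ) : Prop :=
  SolvesWave ((1, 0) : ℝ × EuclideanSpace ℝ (Fin n))
    (fun i : Fin n => ((0, EuclideanSpace.single i 1) : ℝ × EuclideanSpace ℝ (Fin n))) f

/-- Waves are preserved under dilations of space-time combined with time shifts and time
reversal. -/
theorem IsWave.comp_dilation {f : ℝ × EuclideanSpace ℝ (Fin n) → ℝ} (hf : IsWave f) (a b l : ℝ)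
    (hbl : b ^ 2 = l ^ 2) : IsWave (fun p => f (a + b * p.1, l • p.2)) := by
  have := SolvesWave.comp_affine hf ((b • ContinuousLinearMap.fst ℝ _ _).prod
    (l • ContinuousLinearMap.snd ℝ _ _)) (a, 0) (b := b) (l := l) (by simp) (by simp) hbl
  simpa [add_comm] using this

end SpaceTime

/-! ### Integrals depending smoothly on a parameter -/

section Parametric

open MeasureTheory

variable {W P F : Type*} [NormedAddCommGroup W] [NormedSpace ℝ W] [ProperSpace W]
  [MeasurableSpace W] [BorelSpace W] [NormedAddCommGroup P] [NormedSpace ℝ P] [ProperSpace P]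
  [NormedAddCommGroup F] [NormedSpace ℝ F]

theorem exists_norm_le_of_continuous {K : W × P → F} (hK : Continuous K) (ρ r : ℝ) :
    ∃ C, ∀ w p, ‖w‖ ≤ ρ → ‖p‖ ≤ r → ‖K (w, p)‖ ≤ C := by
  obtain ⟨C, hC⟩ := ((isCompact_closedBall (0 : W) ρ).prod
    (isCompact_closedBall (0 : P) r)).exists_bound_of_continuousOn hK.continuousOn
  exact ⟨C, fun w p hw hp => hC _ ⟨by simpa using hw, by simpa using hp⟩⟩

variable {ν : Measure W} [IsFiniteMeasure ν] {ρ : ℝ}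

theorem integrable_of_continuous_of_ae_norm_le {K : W → F} (hK : Continuous K)
    (hν : ∀ᵐ w ∂ν, ‖w‖ ≤ ρ) : Integrable K ν := by
  obtain ⟨C, hC⟩ := (isCompact_closedBall (0 : W) ρ).exists_bound_of_continuousOn hK.continuousOn
  refine Integrable.of_bound hK.aestronglyMeasurable C ?_
  filter_upwards [hν] with w hw using hC w (by simpa using hw)

theorem continuous_integral_of_ae_norm_le {K : W × P → F} (hK : Continuous K)
    (hν : ∀ᵐ w ∂ν, ‖w‖ ≤ ρ) : Continuous fun p => ∫ w, K (w, p) ∂ν := by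
  rw [continuous_iff_continuousAt]
  intro p
  obtain ⟨C, hC⟩ := exists_norm_le_of_continuous hK ρ (‖p‖ + 1)
  refine continuousAt_of_dominated (bound := fun _ => C)
    (.of_forall fun q => (hK.comp (by fun_prop)).aestronglyMeasurable) ?_
    (integrable_const _) (.of_forall fun w => (hK.comp (by fun_prop)).continuousAt)
  filter_upwards [Metric.ball_mem_nhds p one_pos] with q hq
  filter_upwards [hν] with w hw
  refine hC w q hw ?_
  have := norm_le_norm_add_norm_sub' q p
  rw [← dist_eq_norm] at this
  linarith [Metric.mem_ball.1 hq]

/-- The partial derivative with respect to the second variable. -/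
noncomputable def fderivRight (K : W × P → F) (x : W × P) : P →L[ℝ] F :=
  (fderiv ℝ K x).comp (ContinuousLinearMap.inr ℝ W P)

theorem hasFDerivAt_fderivRight {K : W × P → F} (hK : Differentiable ℝ K) (w : W) (p : P) :
    HasFDerivAt (fun q => K (w, q)) (fderivRight K (w, p)) p :=
  (hK _).hasFDerivAt.comp p (hasFDerivAt_prodMk_right w p)

theorem contDiff_fderivRight {K : W × P → F} {m k : WithTop ℕ∞} (hK : ContDiff ℝ m K)
    (hk : k + 1 ≤ m) : ContDiff ℝ k (fderivRight K) :=
  (hK.fderiv_right hk).clm_comp contDiff_const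

theorem hasFDerivAt_integral_of_contDiff {K : W × P → F} (hK : ContDiff ℝ 1 K)
    (hν : ∀ᵐ w ∂ν, ‖w‖ ≤ ρ) (p : P) :
    HasFDerivAt (fun q => ∫ w, K (w, q) ∂ν) (∫ w, fderivRight K (w, p) ∂ν) p := by
  have hK' : Continuous (fderivRight K) := (contDiff_fderivRight (k := 0) hK (by simp)).continuous
  obtain ⟨C, hC⟩ := exists_norm_le_of_continuous hK' ρ (‖p‖ + 1)
  refine hasFDerivAt_integral_of_dominated_of_fderiv_le (bound := fun _ => C)
    (Metric.ball_mem_nhds p one_pos)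
    (.of_forall fun q => (hK.continuous.comp (by fun_prop)).aestronglyMeasurable)
    (integrable_of_continuous_of_ae_norm_le (hK.continuous.comp (by fun_prop)) hν)
    (hK'.comp (by fun_prop)).aestronglyMeasurable ?_ (integrable_const _)
    (.of_forall fun w q _ => hasFDerivAt_fderivRight (hK.differentiable (by simp)) w q)
  filter_upwards [hν] with w hw q hq
  refine hC w q hw ?_
  have := norm_le_norm_add_norm_sub' q p
  rw [← dist_eq_norm] at this
  linarith [Metric.mem_ball.1 hq]

theorem fderiv_integral_of_contDiff {K : W × P → F} (hK : ContDiff ℝ 1 K)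
    (hν : ∀ᵐ w ∂ν, ‖w‖ ≤ ρ) :
    fderiv ℝ (fun q => ∫ w, K (w, q) ∂ν) = fun p => ∫ w, fderivRight K (w, p) ∂ν :=
  funext fun p => (hasFDerivAt_integral_of_contDiff hK hν p).fderiv

theorem fderiv_integral_apply {K : W × P → F} (hK : ContDiff ℝ 1 K)
    (hν : ∀ᵐ w ∂ν, ‖w‖ ≤ ρ) (p : P) :
    fderiv ℝ (fun q => ∫ w, K (w, q) ∂ν) p = ∫ w, fderiv ℝ (fun q => K (w, q)) p ∂ν := by
  rw [fderiv_integral_of_contDiff hK hν]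
  exact integral_congr_ae (.of_forall fun w =>
    ((hasFDerivAt_fderivRight (hK.differentiable (by simp)) w p).fderiv).symm)

theorem integrable_fderiv {K : W × P → F} (hK : ContDiff ℝ 1 K)
    (hν : ∀ᵐ w ∂ν, ‖w‖ ≤ ρ) (p : P) :
    Integrable (fun w => fderiv ℝ (fun q => K (w, q)) p) ν := by
  have : (fun w => fderiv ℝ (fun q => K (w, q)) p) = fun w => fderivRight K (w, p) :=
    funext fun w => (hasFDerivAt_fderivRight (hK.differentiable (by simp)) w p).fderiv
  rw [this]
  exact integrable_of_continuous_of_ae_norm_le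
    (((contDiff_fderivRight (k := 0) hK (by simp)).continuous).comp (by fun_prop)) hν

theorem fderiv_integral_apply_apply {K : W × P → F} (hK : ContDiff ℝ 1 K)
    (hν : ∀ᵐ w ∂ν, ‖w‖ ≤ ρ) (p u : P) :
    fderiv ℝ (fun q => ∫ w, K (w, q) ∂ν) p u = ∫ w, fderiv ℝ (fun q => K (w, q)) p u ∂ν := by
  rw [fderiv_integral_apply hK hν, ContinuousLinearMap.integral_apply (integrable_fderiv hK hν p)]

theorem fderivRight_eq_fderiv {K : W × P → F} (hK : Differentiable ℝ K) (w : W) :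
    (fun q => fderivRight K (w, q)) = fderiv ℝ (fun q => K (w, q)) :=
  funext fun q => ((hasFDerivAt_fderivRight hK w q).fderiv).symm

theorem integrable_fderiv_fderiv_apply {K : W × P → F} (hK : ContDiff ℝ 2 K)
    (hν : ∀ᵐ w ∂ν, ‖w‖ ≤ ρ) (p u : P) :
    Integrable (fun w => fderiv ℝ (fderiv ℝ (fun q => K (w, q))) p u) ν := by
  have h1 : ContDiff ℝ 1 K := hK.of_le (by norm_num)
  have h2 : ContDiff ℝ 1 (fderivRight K) := contDiff_fderivRight hK (by norm_num)
  have := (integrable_fderiv h2 hν p).apply_continuousLinearMap u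
  simpa only [fderivRight_eq_fderiv (h1.differentiable (by simp))] using this

theorem fderiv_fderiv_integral_apply_apply {K : W × P → F} (hK : ContDiff ℝ 2 K)
    (hν : ∀ᵐ w ∂ν, ‖w‖ ≤ ρ) (p u v : P) :
    fderiv ℝ (fderiv ℝ (fun q => ∫ w, K (w, q) ∂ν)) p u v =
      ∫ w, fderiv ℝ (fderiv ℝ (fun q => K (w, q))) p u v ∂ν := by
  have h1 : ContDiff ℝ 1 K := hK.of_le (by norm_num)
  have h2 : ContDiff ℝ 1 (fderivRight K) := contDiff_fderivRight hK (by norm_num)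
  rw [fderiv_integral_of_contDiff h1 hν, fderiv_integral_apply_apply h2 hν]
  simp only [fderivRight_eq_fderiv (h1.differentiable (by simp))]
  rw [ContinuousLinearMap.integral_apply (integrable_fderiv_fderiv_apply hK hν p u)]

theorem norm_fderiv_integral_le {K : W × P → F} (hK : ContDiff ℝ 1 K)
    (hν : ∀ᵐ w ∂ν, ‖w‖ ≤ ρ) {p : P} {S : Set W} (hS : MeasurableSet S) {C : ℝ}
    (h : ∀ᵐ w ∂ν, (w ∈ S → ‖fderiv ℝ (fun q => K (w, q)) p‖ ≤ C) ∧
      (w ∉ S → ‖fderiv ℝ (fun q => K (w, q)) p‖ ≤ 0)) :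
    ‖fderiv ℝ (fun q => ∫ w, K (w, q) ∂ν) p‖ ≤ ν.real S * C := by
  rw [fderiv_integral_apply hK hν]
  refine (norm_integral_le_of_norm_le ((integrable_const C).indicator hS) ?_).trans_eq
    (integral_indicator_const C hS)
  filter_upwards [h] with w hw
  by_cases hwS : w ∈ S
  · simpa [hwS] using hw.1 hwS
  · simpa [hwS] using hw.2 hwS

/-- Parameters outside `S` contribute nothing, so the bound gains the factor `ν.real S`. With `S` a
shrinking ball of directions this factor is the source of the decay in time. -/
theorem c2BoundAt_integral {K : W × P → F} (hK : ContDiff ℝ 2 K)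
    (hν : ∀ᵐ w ∂ν, ‖w‖ ≤ ρ) {p : P} {S : Set W} (hS : MeasurableSet S) {C : ℝ}
    (h : ∀ᵐ w ∂ν, (w ∈ S → C2BoundAt (fun q => K (w, q)) p C) ∧
      (w ∉ S → C2BoundAt (fun q => K (w, q)) p 0)) :
    C2BoundAt (fun q => ∫ w, K (w, q) ∂ν) p (ν.real S * C) := by
  have h1 : ContDiff ℝ 1 K := hK.of_le (by norm_num)
  have h2 : ContDiff ℝ 1 (fderivRight K) := contDiff_fderivRight hK (by norm_num)
  refine ⟨?_, norm_fderiv_integral_le h1 hν hS (h.mono fun w hw =>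
    ⟨fun k => (hw.1 k).2.1, fun k => (hw.2 k).2.1⟩), ?_⟩
  · refine (norm_integral_le_of_norm_le ((integrable_const C).indicator hS) ?_).trans_eq
      (integral_indicator_const C hS)
    filter_upwards [h] with w hw
    by_cases hwS : w ∈ S
    · simpa [hwS] using (hw.1 hwS).1
    · simpa [hwS] using (hw.2 hwS).1
  · rw [fderiv_integral_of_contDiff h1 hν]
    refine norm_fderiv_integral_le h2 hν hS (h.mono fun w hw => ?_)
    rw [fderivRight_eq_fderiv (h1.differentiable (by simp))]
    exact ⟨fun k => (hw.1 k).2.2, fun k => (hw.2 k).2.2⟩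

end Parametric

/-! ### Parameter integrals of class `C^k`. -/

section

open MeasureTheory

variable {W P : Type} [NormedAddCommGroup W] [NormedSpace ℝ W] [ProperSpace W]
  [MeasurableSpace W] [BorelSpace W] [NormedAddCommGroup P] [NormedSpace ℝ P] [ProperSpace P]
  {ν : Measure W} [IsFiniteMeasure ν] {ρ : ℝ}

/-- Induction on `k` over all target spaces at once, because the derivative takes values in `P →L[ℝ]
F`. Putting `P` and `F` in `Type` keeps that space in the range of the induction hypothesis. -/
theorem contDiff_integral_of_ae_norm_le (hν : ∀ᵐ w ∂ν, ‖w‖ ≤ ρ) (k : ℕ) :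
    ∀ {F : Type} [NormedAddCommGroup F] [NormedSpace ℝ F] {K : W × P → F},
      ContDiff ℝ k K → ContDiff ℝ k fun p => ∫ w, K (w, p) ∂ν := by
  induction k with
  | zero =>
    intro F _ _ K hK
    simp only [Nat.cast_zero, contDiff_zero] at hK ⊢
    exact continuous_integral_of_ae_norm_le hK hν
  | succ k ih =>
    intro F _ _ K hK
    have h1 : ContDiff ℝ 1 K := hK.of_le (by push_cast; simp)
    push_cast
    rw [contDiff_succ_iff_fderiv]
    refine ⟨fun p => (hasFDerivAt_integral_of_contDiff h1 hν p).differentiableAt, by simp, ?_⟩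
    rw [fderiv_integral_of_contDiff h1 hν]
    exact ih (contDiff_fderivRight hK (by push_cast; simp))

end

/-! ### The rotation invariant measure on the sphere -/

section Sphere

open MeasureTheory ProbabilityTheory

variable {N : ℕ}

/-- The rotation invariant probability measure on the unit sphere, as a measure on the ambient
Euclidean space. -/
noncomputable def sphereMeasure (N : ℕ) : Measure (EuclideanSpace ℝ (Fin N)) :=
  (ProbabilityTheory.cond volume (Metric.ball (0 : EuclideanSpace ℝ (Fin N)) 1)).map
    fun w => ‖w‖⁻¹ • w

theorem measurable_normalize :
    Measurable fun w : EuclideanSpace ℝ (Fin N) => ‖w‖⁻¹ • w :=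
  measurable_norm.inv.smul measurable_id

instance isProbabilityMeasure_sphereMeasure : IsProbabilityMeasure (sphereMeasure N) := by
  have : IsProbabilityMeasure
      (ProbabilityTheory.cond volume (Metric.ball (0 : EuclideanSpace ℝ (Fin N)) 1)) :=
    cond_isProbabilityMeasure_of_finite (Metric.measure_ball_pos _ _ one_pos).ne'
      measure_ball_lt_top.ne
  exact Measure.isProbabilityMeasure_map measurable_normalize.aemeasurable

theorem ae_norm_eq_one_sphereMeasure (hN : N ≠ 0) : ∀ᵐ w ∂sphereMeasure N, ‖w‖ = 1 := by
  have : Nonempty (Fin N) := Fin.pos_iff_nonempty.1 (Nat.pos_of_ne_zero hN)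
  rw [sphereMeasure, ae_map_iff measurable_normalize.aemeasurable
    (measurableSet_eq_fun measurable_norm measurable_const)]
  have h0 : ∀ᵐ w ∂(volume : Measure (EuclideanSpace ℝ (Fin N))), w ≠ 0 :=
    Measure.ae_ne volume 0
  filter_upwards [cond_absolutelyContinuous.ae_le h0] with w hw
  rw [norm_smul, norm_inv, norm_norm, inv_mul_cancel₀ (norm_ne_zero_iff.2 hw)]

theorem measurePreserving_sphereMeasure
    (R : EuclideanSpace ℝ (Fin N) ≃ₗᵢ[ℝ] EuclideanSpace ℝ (Fin N)) :
    MeasurePreserving R (sphereMeasure N) (sphereMeasure N) := by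
  refine ⟨R.continuous.measurable, ?_⟩
  have hb : R ⁻¹' Metric.ball 0 1 = Metric.ball 0 1 := by
    ext w; simp
  have hc : (ProbabilityTheory.cond volume (Metric.ball (0 : EuclideanSpace ℝ (Fin N)) 1)).map R =
      ProbabilityTheory.cond volume (Metric.ball (0 : EuclideanSpace ℝ (Fin N)) 1) := by
    rw [ProbabilityTheory.cond, Measure.map_smul]
    congr 1
    have := (R.measurePreserving.restrict_preimage (s := Metric.ball 0 1)
      Metric.isOpen_ball.measurableSet).map_eq
    rwa [hb] at this
  rw [sphereMeasure, Measure.map_map R.continuous.measurable measurable_normalize]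
  conv_rhs => rw [← hc, Measure.map_map measurable_normalize R.continuous.measurable]
  congr 1
  funext w
  simp

/-- The generator of the rotations in the plane of the `i`-th and the `j`-th coordinate. -/
noncomputable def rotGen (i j : Fin N) :
    EuclideanSpace ℝ (Fin N) →L[ℝ] EuclideanSpace ℝ (Fin N) :=
  (EuclideanSpace.proj i).smulRight (EuclideanSpace.single j 1) -
    (EuclideanSpace.proj j).smulRight (EuclideanSpace.single i 1)

theorem rotGen_apply (i j : Fin N) (w : EuclideanSpace ℝ (Fin N)) :
    rotGen i j w = w i • EuclideanSpace.single j 1 - w j • EuclideanSpace.single i 1 := by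
  simp [rotGen]

/-- The rotation by the angle `θ` in the plane of the `i`-th and the `j`-th coordinate. -/
noncomputable def rot (i j : Fin N) (θ : ℝ) (w : EuclideanSpace ℝ (Fin N)) :
    EuclideanSpace ℝ (Fin N) :=
  w + (Real.cos θ - 1) • (w i • EuclideanSpace.single i 1 + w j • EuclideanSpace.single j 1) +
    Real.sin θ • (w i • EuclideanSpace.single j 1 - w j • EuclideanSpace.single i 1)

theorem norm_rot {i j : Fin N} (hij : i ≠ j) (θ : ℝ) (w : EuclideanSpace ℝ (Fin N)) :
    ‖rot i j θ w‖ = ‖w‖ := by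
  have h : ‖rot i j θ w‖ ^ 2 = ‖w‖ ^ 2 := by
    rw [← real_inner_self_eq_norm_sq, ← real_inner_self_eq_norm_sq, rot]
    simp only [inner_add_left, inner_add_right, inner_sub_left, inner_sub_right, inner_smul_left,
      inner_smul_right, EuclideanSpace.inner_single_left, EuclideanSpace.inner_single_right]
    simp [hij, hij.symm]
    linear_combination (w i ^ 2 + w j ^ 2) * Real.sin_sq_add_cos_sq θ
  exact (pow_left_inj₀ (norm_nonneg _) (norm_nonneg _) two_ne_zero).1 h

/-- The rotation by the angle `θ` in a coordinate plane, as a linear isometry. -/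
noncomputable def rotEquiv {i j : Fin N} (hij : i ≠ j) (θ : ℝ) :
    EuclideanSpace ℝ (Fin N) ≃ₗᵢ[ℝ] EuclideanSpace ℝ (Fin N) :=
  LinearIsometry.toLinearIsometryEquiv
    { toFun := rot i j θ
      map_add' := fun v w => by simp only [rot, PiLp.add_apply]; module
      map_smul' := fun c w => by simp only [rot, PiLp.smul_apply, smul_eq_mul, RingHom.id_apply]; module
      norm_map' := norm_rot hij θ } rfl

/-- By rotation invariance the integral of `H (rot i j θ w)` does not depend on `θ`; its derivative
at `θ = 0` is the left-hand side. -/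
theorem integral_fderiv_rotGen {H : EuclideanSpace ℝ (Fin N) → ℝ} (hH : ContDiff ℝ 1 H)
    (i j : Fin N) : ∫ w, fderiv ℝ H w (rotGen i j w) ∂sphereMeasure N = 0 := by
  rcases eq_or_ne i j with rfl | hij
  · simp [rotGen]
  have hN : N ≠ 0 := fun h => by subst h; exact i.elim0
  have hν : ∀ᵐ w ∂sphereMeasure N, ‖w‖ ≤ 1 :=
    (ae_norm_eq_one_sphereMeasure hN).mono fun w hw => hw.le
  set K : EuclideanSpace ℝ (Fin N) × ℝ → ℝ := fun x => H (rot i j x.2 x.1) with hK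
  have hKd : ContDiff ℝ 1 K := by
    refine hH.comp ?_
    unfold rot
    have hc : ∀ k, ContDiff ℝ 1 fun x : EuclideanSpace ℝ (Fin N) × ℝ => x.1 k := fun k =>
      (EuclideanSpace.proj (𝕜 := ℝ) k).contDiff.comp contDiff_fst
    have h1 := hc i
    have h2 := hc j
    have h3 : ContDiff ℝ 1 fun x : EuclideanSpace ℝ (Fin N) × ℝ => Real.cos x.2 :=
      Real.contDiff_cos.comp contDiff_snd
    have h4 : ContDiff ℝ 1 fun x : EuclideanSpace ℝ (Fin N) × ℝ => Real.sin x.2 :=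
      Real.contDiff_sin.comp contDiff_snd
    fun_prop
  have hconst : (fun θ => ∫ w, K (w, θ) ∂sphereMeasure N) = fun _ =>
      ∫ w, H w ∂sphereMeasure N := by
    funext θ
    exact (measurePreserving_sphereMeasure (rotEquiv hij θ)).integral_comp
      (rotEquiv hij θ).toHomeomorph.measurableEmbedding H
  have h := hasFDerivAt_integral_of_contDiff hKd hν (0 : ℝ)
  rw [hconst] at h
  have h0 := h.unique (hasFDerivAt_const _ _)
  have hint : Integrable (fun w => fderivRight K (w, 0)) (sphereMeasure N) :=
    integrable_of_continuous_of_ae_norm_le (((contDiff_fderivRight (k := 0) hKd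
      (by simp)).continuous).comp (by fun_prop)) hν
  have h1 := congrArg (fun L : ℝ →L[ℝ] ℝ => L 1) h0
  simp only [ContinuousLinearMap.integral_apply hint, zero_apply] at h1
  rw [← h1]
  refine integral_congr_ae (.of_forall fun w => ?_)
  have hd := (hasFDerivAt_fderivRight (hKd.differentiable (by simp)) w (0 : ℝ)).hasDerivAt
  have hrot : HasDerivAt (fun θ => rot i j θ w) (rotGen i j w) 0 := by
    unfold rot
    have e1 := (((Real.hasDerivAt_cos 0).sub_const 1).smul_const
      (w i • EuclideanSpace.single i (1 : ℝ) + w j • EuclideanSpace.single j 1)).const_add w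
    have e2 := (Real.hasDerivAt_sin 0).smul_const
      (w i • EuclideanSpace.single j (1 : ℝ) - w j • EuclideanSpace.single i 1)
    refine (e1.add e2).congr_deriv ?_
    simp only [Real.sin_zero, neg_zero, zero_smul, Real.cos_zero, one_smul, zero_add, rotGen_apply]
  have hr0 : rot i j 0 w = w := by simp [rot]
  have hd2 : HasDerivAt (fun θ => K (w, θ)) (fderiv ℝ H w (rotGen i j w)) 0 := by
    refine HasFDerivAt.comp_hasDerivAt (l := H) (0 : ℝ) ?_ hrot
    simpa only [hr0] using ((hH.differentiable (by simp)) w).hasFDerivAt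
  exact hd2.unique hd

/-- With `B` and `L` the second and first derivative of a function at `w`, the summand is the square
of a rotation field applied to that function. The identity says that these squares add up to the
Laplace-Beltrami operator `Δ - ∂ᵣ² - (N - 1) ∂ᵣ` of the unit sphere, twice because each coordinate
plane occurs as `(i, j)` and as `(j, i)`. -/
theorem sum_rotGen_quadratic (B : EuclideanSpace ℝ (Fin N) →L[ℝ] EuclideanSpace ℝ (Fin N) →L[ℝ] ℝ)
    (L : EuclideanSpace ℝ (Fin N) →L[ℝ] ℝ) (w : EuclideanSpace ℝ (Fin N)) (hw : ‖w‖ = 1) :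
    ∑ i, ∑ j, (B (rotGen i j w) (rotGen i j w) + L (rotGen i j (rotGen i j w))) =
      2 * (∑ i, B (EuclideanSpace.single i 1) (EuclideanSpace.single i 1) - B w w -
        (N - 1) * L w) := by
  have hw' : w = ∑ i, w i • EuclideanSpace.single i (1 : ℝ) := by
    ext k; simp [Finset.sum_apply, Pi.single_apply]
  have hL : L w = ∑ i, w i * L (EuclideanSpace.single i 1) := by
    conv_lhs => rw [hw']
    simp
  have hB : B w w = ∑ i, ∑ j, w i * w j *
      B (EuclideanSpace.single i 1) (EuclideanSpace.single j 1) := by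
    conv_lhs => rw [hw']
    simp only [map_sum, map_smul, sum_apply, smul_apply, smul_eq_mul, Finset.mul_sum]
    rw [Finset.sum_comm]
    refine Finset.sum_congr rfl fun i _ => Finset.sum_congr rfl fun j _ => by ring
  have hn : ∑ i, w i ^ 2 = 1 := by
    have := EuclideanSpace.norm_sq_eq w
    rw [hw] at this
    simpa using this.symm
  set a : Fin N → ℝ := fun i => w i
  set b : Fin N → Fin N → ℝ := fun i j =>
    B (EuclideanSpace.single i 1) (EuclideanSpace.single j 1) with hb
  set l : Fin N → ℝ := fun i => L (EuclideanSpace.single i 1) with hl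
  have e1 : ∀ i j, B (rotGen i j w) (rotGen i j w) + L (rotGen i j (rotGen i j w)) =
      a i ^ 2 * b j j + a j ^ 2 * b i i - a i * a j * b i j - a i * a j * b j i +
      (if i = j then a i * l i else 0) + (if i = j then a j * l i else 0)
       - a j * l j - a i * l i := by
    intro i j
    have h1 : (rotGen i j w) i = (if i = j then a i else 0) - a j := by
      simp [rotGen_apply, a]
    have h2 : (rotGen i j w) j = a i - (if i = j then a j else 0) := by
      simp [rotGen_apply, a, eq_comm]
    rw [rotGen_apply i j (rotGen i j w), h1, h2, rotGen_apply]
    simp only [map_sub, map_smul, sub_apply, smul_apply, smul_eq_mul]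
    simp only [a, hb, hl]
    split_ifs with h
    · subst h; ring
    · ring
  have s1 : ∑ i, ∑ j, a i ^ 2 * b j j = ∑ i, b i i := by
    rw [← Finset.sum_mul_sum, hn, one_mul]
  have s2 : ∑ i, ∑ j, a j ^ 2 * b i i = ∑ i, b i i := by
    rw [Finset.sum_comm, s1]
  have s3 : ∑ i, ∑ j, a i * a j * b j i = ∑ i, ∑ j, a i * a j * b i j := by
    rw [Finset.sum_comm]
    exact Finset.sum_congr rfl fun i _ => Finset.sum_congr rfl fun j _ => by ring
  have hB' : B w w = ∑ i, ∑ j, a i * a j * b i j := hB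
  have hL' : L w = ∑ i, a i * l i := hL
  simp only [e1, Finset.sum_add_distrib, Finset.sum_sub_distrib, s1, s2, s3, hB', hL']
  simp only [Finset.sum_ite_eq, Finset.mem_univ, if_true, Finset.sum_const, Finset.card_univ,
    Fintype.card_fin, nsmul_eq_mul, ← Finset.mul_sum]
  ring

/-- A Laplace-Beltrami term has mean zero on the sphere: it is half a sum of derivatives along
rotation fields, each of mean zero by `integral_fderiv_rotGen`. -/
theorem integral_laplacian_sphereMeasure {F : EuclideanSpace ℝ (Fin N) → ℝ} (hF : ContDiff ℝ 2 F)
    (hN : N ≠ 0) :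
    ∫ w, (∑ i, fderiv ℝ (fderiv ℝ F) w (EuclideanSpace.single i 1) (EuclideanSpace.single i 1) -
      fderiv ℝ (fderiv ℝ F) w w w - (N - 1) * fderiv ℝ F w w) ∂sphereMeasure N = 0 := by
  have hν := ae_norm_eq_one_sphereMeasure hN
  obtain ⟨hF1, hF2, hF3⟩ := contDiff_two_iff_fderiv_fderiv.1 hF
  have hF2' : ContDiff ℝ 1 (fderiv ℝ F) := hF.fderiv_right (by norm_num)
  have hcont : ∀ i j : Fin N, Continuous fun w => fderiv ℝ (fderiv ℝ F) w (rotGen i j w)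
      (rotGen i j w) + fderiv ℝ F w (rotGen i j (rotGen i j w)) := fun i j => by
    have := hF2.continuous
    fun_prop
  have h : ∀ i j : Fin N, ∫ w, (fderiv ℝ (fderiv ℝ F) w (rotGen i j w) (rotGen i j w) +
      fderiv ℝ F w (rotGen i j (rotGen i j w))) ∂sphereMeasure N = 0 := fun i j => by
    rw [← integral_fderiv_rotGen (H := fun w => fderiv ℝ F w (rotGen i j w))
      (hF2'.clm_apply (rotGen i j).contDiff) i j]
    refine integral_congr_ae (.of_forall fun w => ?_)
    have := ((hF2 w).hasFDerivAt.clm_apply (rotGen i j).hasFDerivAt).fderiv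
    simp only [this]
    simp [add_comm]
  have hsum : ∫ w, ∑ i, ∑ j, (fderiv ℝ (fderiv ℝ F) w (rotGen i j w) (rotGen i j w) +
      fderiv ℝ F w (rotGen i j (rotGen i j w))) ∂sphereMeasure N = 0 := by
    rw [integral_finsetSum]
    · refine Finset.sum_eq_zero fun i _ => ?_
      rw [integral_finsetSum]
      · exact Finset.sum_eq_zero fun j _ => h i j
      · exact fun j _ => integrable_of_continuous_of_ae_norm_le (hcont i j)
          (hν.mono fun w hw => hw.le)
    · exact fun i _ => integrable_of_continuous_of_ae_norm_le
        (continuous_finsetSum _ fun j _ => hcont i j) (hν.mono fun w hw => hw.le)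
  rw [integral_congr_ae (hν.mono fun w hw => sum_rotGen_quadratic (fderiv ℝ (fderiv ℝ F) w)
    (fderiv ℝ F w) w hw), integral_const_mul] at hsum
  simpa using hsum

/-- The cone over this set inside the unit ball lies in a box with two sides `2 s` and `N - 2` sides
`2`. -/
theorem exists_sphereMeasure_le (hN : 1 < N) : ∃ C : ℝ, ∀ i j : Fin N, i ≠ j → ∀ s : ℝ, 0 ≤ s →
    (sphereMeasure N).real {w | |w i| ≤ s ∧ |w j| ≤ s} ≤ C * s ^ 2 := by
  set v := (volume (Metric.ball (0 : EuclideanSpace ℝ (Fin N)) 1)).toReal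
  refine ⟨v⁻¹ * (4 * 2 ^ (N - 2)), fun i j hij s hs => ?_⟩
  have hm : ∀ k : Fin N, Measurable fun w : EuclideanSpace ℝ (Fin N) => |w k| := fun k => by
    fun_prop
  have hS : MeasurableSet {w : EuclideanSpace ℝ (Fin N) | |w i| ≤ s ∧ |w j| ≤ s} :=
    (measurableSet_le (hm i) measurable_const).inter (measurableSet_le (hm j) measurable_const)
  set c : Fin N → ℝ := fun k => if k = i ∨ k = j then s else 1 with hc
  set Q : Set (EuclideanSpace ℝ (Fin N)) := {w | ∀ k, |w k| ≤ c k} with hQ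
  have hsub : Metric.ball 0 1 ∩ (fun w => ‖w‖⁻¹ • w) ⁻¹'
      {w : EuclideanSpace ℝ (Fin N) | |w i| ≤ s ∧ |w j| ≤ s} ⊆ Q := by
    rintro w ⟨hw, hi, hj⟩ k
    have hw1 : ‖w‖ < 1 := by simpa using hw
    have hk : ∀ k, |(‖w‖⁻¹ • w) k| ≤ s → |w k| ≤ s := fun k h => by
      rcases eq_or_ne w 0 with rfl | h0
      · simpa using hs
      have hp : 0 < ‖w‖ := norm_pos_iff.2 h0
      simp only [PiLp.smul_apply, smul_eq_mul, abs_mul, abs_inv, abs_norm] at h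
      rw [inv_mul_le_iff₀ hp] at h
      nlinarith
    simp only [hc]
    split_ifs with h
    · rcases h with rfl | rfl
      · exact hk _ hi
      · exact hk _ hj
    · have := PiLp.norm_apply_le w k
      rw [Real.norm_eq_abs] at this
      linarith
  have hQv : volume Q = volume (Set.Icc (fun k => -c k) c) := by
    have hQ' : Q = WithLp.ofLp ⁻¹' (Set.Icc (fun k => -c k) c) := by
      ext w
      simp [hQ, abs_le, Pi.le_def, forall_and]
    rw [hQ', (PiLp.volume_preserving_ofLp (Fin N)).measure_preimage
      measurableSet_Icc.nullMeasurableSet]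
  have hvol : (volume Q).toReal = ∏ k, (2 * c k) := by
    rw [hQv, Real.volume_Icc_pi_toReal]
    · exact Finset.prod_congr rfl fun k _ => by ring
    · intro k
      simp only [hc]
      split_ifs <;> linarith
  have hprod : ∏ k, (2 * c k) = 4 * 2 ^ (N - 2) * s ^ 2 := by
    rw [Finset.prod_mul_distrib, Finset.prod_ite]
    have hcard : (Finset.univ.filter fun k : Fin N => k = i ∨ k = j) = {i, j} := by
      ext k; simp
    simp only [hcard, Finset.prod_const, Finset.card_univ, Fintype.card_fin, one_pow, mul_one,
      Finset.card_pair hij]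
    obtain ⟨M, rfl⟩ : ∃ M, N = M + 2 := ⟨N - 2, by omega⟩
    simp only [Nat.add_sub_cancel, pow_add]
    ring
  have hfin : volume Q ≠ ⊤ := hQv ▸ isCompact_Icc.measure_lt_top.ne
  rw [sphereMeasure, Measure.real, Measure.map_apply measurable_normalize hS,
    cond_apply Metric.isOpen_ball.measurableSet, ENNReal.toReal_mul, ENNReal.toReal_inv, mul_assoc,
    ← hprod, ← hvol]
  exact mul_le_mul_of_nonneg_left (ENNReal.toReal_mono hfin (measure_mono hsub)) (by positivity)

/-- A probability measure on the unit ball of `ℝⁿ` whose averages `∫ f (x + t v) dν(v)` satisfy the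
Euler-Poisson-Darboux equation with parameter `k`, and which does not charge small balls too
much. -/
structure IsDarbouxMeasure {n : ℕ} (k : ℝ) (ν : Measure (EuclideanSpace ℝ (Fin n))) : Prop where
  isProbabilityMeasure : IsProbabilityMeasure ν
  ae_norm_le : ∀ᵐ v ∂ν, ‖v‖ ≤ 1
  integral_eq_zero : ∀ F : EuclideanSpace ℝ (Fin n) → ℝ, ContDiff ℝ 2 F →
    ∫ v, (∑ i, fderiv ℝ (fderiv ℝ F) v (EuclideanSpace.single i 1) (EuclideanSpace.single i 1) -
      fderiv ℝ (fderiv ℝ F) v v v - k * fderiv ℝ F v v) ∂ν = 0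
  exists_closedBall_le : ∃ C : ℝ, ∀ s : ℝ, 0 ≤ s → ν.real (Metric.closedBall 0 s) ≤ C * s ^ 2

/-- The projection to the first `n` coordinates. -/
noncomputable def projCoords {n N : ℕ} (h : n ≤ N) :
    EuclideanSpace ℝ (Fin N) →L[ℝ] EuclideanSpace ℝ (Fin n) :=
  ∑ i : Fin n, (EuclideanSpace.proj (Fin.castLE h i)).smulRight (EuclideanSpace.single i 1)

theorem projCoords_apply {n N : ℕ} (h : n ≤ N) (w : EuclideanSpace ℝ (Fin N)) (i : Fin n) :
    projCoords h w i = w (Fin.castLE h i) := by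
  simp [projCoords, sum_apply, Pi.single_apply]

theorem projCoords_single_castLE {n N : ℕ} (h : n ≤ N) (i : Fin n) :
    projCoords h (EuclideanSpace.single (Fin.castLE h i) 1) = EuclideanSpace.single i 1 := by
  ext k
  simp [projCoords_apply]

theorem projCoords_single_of_notMem {n N : ℕ} (h : n ≤ N) {j : Fin N}
    (hj : j ∉ Set.range (Fin.castLE h)) : projCoords h (EuclideanSpace.single j 1) = 0 := by
  ext k
  rw [projCoords_apply]
  simp only [PiLp.zero_apply, PiLp.single_apply]
  exact if_neg fun e => hj ⟨k, e⟩

theorem norm_projCoords_le {n N : ℕ} (h : n ≤ N) (w : EuclideanSpace ℝ (Fin N)) :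
    ‖projCoords h w‖ ≤ ‖w‖ := by
  rw [EuclideanSpace.norm_eq, EuclideanSpace.norm_eq]
  refine Real.sqrt_le_sqrt ?_
  simp only [projCoords_apply]
  refine (Finset.sum_map Finset.univ (Fin.castLEEmb h) (fun j => ‖w j‖ ^ 2)).symm.le.trans ?_
  exact Finset.sum_le_univ_sum_of_nonneg fun j => by positivity

/-- Method of descent: the measure is the projection to `ℝⁿ` of the uniform measure on the sphere in
`ℝᴺ`, and `integral_laplacian_sphereMeasure` is applied to functions of the first `n` coordinates,
giving the parameter `N - 1`. -/
theorem exists_isDarbouxMeasure {n : ℕ} (hn : 1 ≤ n) :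
    ∃ ν : Measure (EuclideanSpace ℝ (Fin n)), IsDarbouxMeasure (2 * (n / 2 : ℕ) : ℝ) ν := by
  -- The least odd number that is at least `n`. Oddness makes the parameter `N - 1` even, so that
  -- steps of two lead to `0`, the wave equation.
  set N := 2 * (n / 2) + 1 with hN
  have h : n ≤ N := by omega
  have hN0 : N ≠ 0 := by omega
  set π := projCoords h
  have hπ : Measurable π := π.continuous.measurable
  have hae := ae_norm_eq_one_sphereMeasure hN0
  refine ⟨(sphereMeasure N).map π, ⟨Measure.isProbabilityMeasure_map hπ.aemeasurable, ?_, ?_, ?_⟩⟩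
  · rw [ae_map_iff hπ.aemeasurable (measurableSet_le measurable_norm measurable_const)]
    exact hae.mono fun w hw => (norm_projCoords_le h w).trans hw.le
  · intro F hF
    obtain ⟨hF1, hF2, hF3⟩ := contDiff_two_iff_fderiv_fderiv.1 hF
    have h1 := fun w => fderiv_comp_affine hF1 π 0 w
    have h2 := fun w => fderiv_fderiv_comp_affine hF π 0 w
    have := integral_laplacian_sphereMeasure (F := fun w => F (π w + 0))
      (hF.comp (π.contDiff.add contDiff_const)) hN0
    simp only [h1, h2, ContinuousLinearMap.comp_apply, ContinuousLinearMap.flip_apply,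
      ContinuousLinearMap.compL_apply] at this
    rw [integral_map hπ.aemeasurable]
    · rw [← this]
      refine integral_congr_ae (.of_forall fun w => ?_)
      simp only [add_zero]
      congr 2
      · refine Fintype.sum_of_injective (Fin.castLE h) (Fin.castLE_injective h) _ _ ?_ ?_
        · intro j hj
          simp only [π, projCoords_single_of_notMem h hj, map_zero]
        · intro i
          simp only [π, projCoords_single_castLE]
      · simp [hN]
    · refine Continuous.aestronglyMeasurable ?_
      have e1 := hF1.continuous
      have e2 := hF2.continuous
      fun_prop
  -- For `n = 1` the measure lives on `‖v‖ = 1`, so balls of radius `s < 1` are null and `C = 1`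
  -- works. For `n ≥ 2`, a small projection forces two coordinates to be small.
  · rcases eq_or_lt_of_le hn with hn1 | hn1
    · refine ⟨1, fun s hs => ?_⟩
      have : IsProbabilityMeasure ((sphereMeasure N).map π) :=
        Measure.isProbabilityMeasure_map hπ.aemeasurable
      rcases lt_or_ge s 1 with h1 | h1
      · have h0 : ((sphereMeasure N).map π) (Metric.closedBall 0 s) = 0 := by
          rw [Measure.map_apply hπ Metric.isClosed_closedBall.measurableSet]
          refine measure_mono_null (t := {w | ¬ ‖w‖ = 1}) ?_ hae
          intro w hw hw1
          have hn2 : n / 2 = 0 := by omega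
          have hw2 : ‖π w‖ ≤ s := by simpa using hw
          have hw3 : ‖π w‖ = ‖w‖ := by
            rw [EuclideanSpace.norm_eq, EuclideanSpace.norm_eq]
            congr 1
            simp only [π, projCoords_apply]
            refine Fintype.sum_of_injective (Fin.castLE h) (Fin.castLE_injective h) _ _ ?_
              fun i => rfl
            intro j hj
            exact absurd ⟨⟨j, by omega⟩, by ext; simp⟩ hj
          linarith [hw1]
        rw [Measure.real, h0]
        simpa using sq_nonneg s
      · refine measureReal_le_one.trans ?_
        nlinarith
    · obtain ⟨C, hC⟩ := exists_sphereMeasure_le (N := N) (by omega)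
      refine ⟨C, fun s hs => ?_⟩
      refine le_trans ?_ (hC (Fin.castLE h ⟨0, by omega⟩) (Fin.castLE h ⟨1, by omega⟩) (by simp) s hs)
      rw [map_measureReal_apply hπ Metric.isClosed_closedBall.measurableSet]
      refine measureReal_mono fun w hw => ?_
      have hw2 : ‖π w‖ ≤ s := by simpa using hw
      have hk : ∀ i, |w (Fin.castLE h i)| ≤ s := fun i => by
        have := PiLp.norm_apply_le (π w) i
        rw [projCoords_apply, Real.norm_eq_abs] at this
        exact this.trans hw2
      exact ⟨hk _, hk _⟩

end Sphere

/-! ### The Euler-Poisson-Darboux equation -/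

section EPD

variable {V ι : Type*} [NormedAddCommGroup V] [NormedSpace ℝ V] [Fintype ι]

/-- The Euler-Poisson-Darboux equation `t φ_tt + k φ_t = t Δ φ` with time function `τ`, time
direction `e₀` and space directions `e i`. -/
def SolvesEPD (τ : V →L[ℝ] ℝ) (e₀ : V) (e : ι → V) (k : ℝ) (f : V → ℝ) : Prop :=
  ∀ p, τ p * fderiv ℝ (fderiv ℝ f) p e₀ e₀ + k * fderiv ℝ f p e₀ =
    τ p * ∑ i, fderiv ℝ (fderiv ℝ f) p (e i) (e i)

variable {τ : V →L[ℝ] ℝ} {e₀ : V} {e : ι → V}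

/-- The set `τ ≠ 0` is dense. This recovers identities at time zero, where the Euler-Poisson-Darboux
equation degenerates. -/
theorem eq_zero_of_clm_mul_eq_zero (h₀ : τ e₀ = 1) {h : V → ℝ} (hc : Continuous h)
    (hz : ∀ p, τ p ≠ 0 → h p = 0) (p : V) : h p = 0 := by
  by_cases hp : τ p = 0
  · have hlim : Filter.Tendsto (fun s : ℝ => h (p + s • e₀)) (nhdsWithin 0 {0}ᶜ)
        (nhds (h p)) := by
      have : Continuous fun s : ℝ => h (p + s • e₀) := by fun_prop
      simpa using (this.tendsto 0).mono_left nhdsWithin_le_nhds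
    refine tendsto_nhds_unique (hlim.congr' ?_) tendsto_const_nhds
    filter_upwards [self_mem_nhdsWithin] with s hs
    refine hz _ ?_
    simpa [hp, h₀] using hs
  · exact hz p hp

theorem SolvesEPD.solvesWave (h₀ : τ e₀ = 1) {f : V → ℝ} (hf : ContDiff ℝ 2 f)
    (h : SolvesEPD τ e₀ e 0 f) : SolvesWave e₀ e f := by
  obtain ⟨-, -, h3⟩ := contDiff_two_iff_fderiv_fderiv.1 hf
  refine ⟨hf, eq_zero_of_clm_mul_eq_zero (τ := τ) h₀ ?_ fun p hp => ?_⟩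
  · unfold waveForm
    fun_prop
  · have := h p
    rw [zero_mul, add_zero] at this
    rw [waveForm, mul_left_cancel₀ hp this, sub_self]

theorem fderiv_fderiv_symm {f : V → ℝ} (hf : ContDiff ℝ 2 f) (p u v : V) :
    fderiv ℝ (fderiv ℝ f) p u v = fderiv ℝ (fderiv ℝ f) p v u :=
  (hf.contDiffAt.isSymmSndFDerivAt (by simp)) u v

theorem fderiv_clm_apply_const {F : Type*} [NormedAddCommGroup F] [NormedSpace ℝ F]
    {f : V → V →L[ℝ] F} (hf : Differentiable ℝ f) (p u v : V) :
    fderiv ℝ (fun q => f q v) p u = fderiv ℝ f p u v := by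
  rw [((hf p).hasFDerivAt.clm_apply (hasFDerivAt_const v p)).fderiv]
  simp

/-- The one symmetry of third derivatives that is needed to exchange the time derivative with the
Laplacian. -/
theorem fderiv_third_symm {f : V → ℝ} (hf : ContDiff ℝ 3 f) (p u v : V) :
    fderiv ℝ (fun q => fderiv ℝ (fderiv ℝ f) q u v) p u =
      fderiv ℝ (fun q => fderiv ℝ (fderiv ℝ f) q u u) p v := by
  have hf2 : ContDiff ℝ 2 f := hf.of_le (by norm_num)
  have hf' : ContDiff ℝ 2 (fderiv ℝ f) := hf.fderiv_right (by norm_num)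
  set g : V → ℝ := fun q => fderiv ℝ f q u with hg
  have hg2 : ContDiff ℝ 2 g := hf'.clm_apply contDiff_const
  have hgd : ∀ q v, fderiv ℝ g q v = fderiv ℝ (fderiv ℝ f) q v u := fun q v =>
    fderiv_clm_apply_const (hf'.differentiable (by simp)) q v u
  have hg' : Differentiable ℝ (fderiv ℝ g) :=
    (hg2.fderiv_right (m := 1) (by norm_num)).differentiable (by simp)
  simp only [fun q => fderiv_fderiv_symm hf2 q u v]
  simp only [← hgd]
  rw [fderiv_clm_apply_const hg', fderiv_clm_apply_const hg', fderiv_fderiv_symm hg2]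

theorem fderiv_add_const_mul_clm_mul (τ : V →L[ℝ] ℝ) (c : ℝ) {a b : V → ℝ} {p : V}
    (ha : DifferentiableAt ℝ a p) (hb : DifferentiableAt ℝ b p) (u : V) :
    fderiv ℝ (fun q => a q + c * (τ q * b q)) p u =
      fderiv ℝ a p u + c * (τ u * b p + τ p * fderiv ℝ b p u) := by
  have h : HasFDerivAt (fun q => a q + c * (τ q * b q))
      (fderiv ℝ a p + c • (τ p • fderiv ℝ b p + b p • τ)) p :=
    ha.hasFDerivAt.add ((τ.hasFDerivAt.mul hb.hasFDerivAt).const_mul c)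
  rw [h.fderiv]
  simp only [add_apply, smul_apply, smul_eq_mul]
  ring

/-- For `g = f + c t f_t` with `c = 1 / (k - 1)`, the equation for `f` collapses `g_t` to `c (k f_t
+ t f_tt) = c t Δf`. Hence `t g_tt + (k - 2) g_t = c t ((k - 1) Δf + t Δf_t) = t Δg`. -/
theorem SolvesEPD.ladder (h₀ : τ e₀ = 1) (he : ∀ i, τ (e i) = 0) {k : ℝ} (hk : k - 1 ≠ 0)
    {f g : V → ℝ} (hf : ContDiff ℝ 3 f) (h : SolvesEPD τ e₀ e k f)
    (hg : ∀ p, g p = f p + (k - 1)⁻¹ * (τ p * fderiv ℝ f p e₀)) :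
    SolvesEPD τ e₀ e (k - 2) g := by
  have hf2 : ContDiff ℝ 2 f := hf.of_le (by norm_num)
  have hf' : ContDiff ℝ 2 (fderiv ℝ f) := hf.fderiv_right (by norm_num)
  have hf'' : ContDiff ℝ 1 (fderiv ℝ (fderiv ℝ f)) := hf'.fderiv_right (by norm_num)
  have hfd := hf'.differentiable (by simp)
  set c := (k - 1)⁻¹ with hc
  have hck : c * (k - 1) = 1 := inv_mul_cancel₀ hk
  have hg0 : g = fun p => f p + c * (τ p * fderiv ℝ f p e₀) := funext hg
  have hgD : Differentiable ℝ (fderiv ℝ g) := by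
    have : ContDiff ℝ 2 g := by rw [hg0]; fun_prop
    exact (this.fderiv_right (m := 1) (by norm_num)).differentiable (by simp)
  have hg1 : ∀ p u, fderiv ℝ g p u = fderiv ℝ f p u +
      c * (τ u * fderiv ℝ f p e₀ + τ p * fderiv ℝ (fderiv ℝ f) p u e₀) := fun p u => by
    rw [hg0, fderiv_add_const_mul_clm_mul τ c (hf2.differentiable (by simp) p) (by fun_prop),
      fderiv_clm_apply_const hfd]
  have hL : Differentiable ℝ fun p => ∑ i, fderiv ℝ (fderiv ℝ f) p (e i) (e i) := by
    have := hf''.differentiable (by simp)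
    fun_prop
  have hg1e : (fun p => fderiv ℝ g p e₀) =
      fun p => c * (τ p * ∑ i, fderiv ℝ (fderiv ℝ f) p (e i) (e i)) := by
    funext p
    rw [hg1, h₀, ← h p]
    linear_combination (-fderiv ℝ f p e₀) * hck
  have hg2e : ∀ p, fderiv ℝ (fderiv ℝ g) p e₀ e₀ =
      c * (∑ i, fderiv ℝ (fderiv ℝ f) p (e i) (e i) +
        τ p * fderiv ℝ (fun q => ∑ i, fderiv ℝ (fderiv ℝ f) q (e i) (e i)) p e₀) := fun p => by
    have := fderiv_add_const_mul_clm_mul τ c (differentiableAt_const (0 : ℝ)) (hL p) e₀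
    simp only [zero_add, fderiv_const_apply, zero_apply, h₀, one_mul] at this
    rw [← fderiv_clm_apply_const hgD, hg1e, this]
  have hg2i : ∀ p i, fderiv ℝ (fderiv ℝ g) p (e i) (e i) =
      fderiv ℝ (fderiv ℝ f) p (e i) (e i) +
        c * (τ p * fderiv ℝ (fun q => fderiv ℝ (fderiv ℝ f) q (e i) (e i)) p e₀) := fun p i => by
    rw [← fderiv_clm_apply_const hgD]
    have e1 : (fun q => fderiv ℝ g q (e i)) = fun q => fderiv ℝ f q (e i) +
        c * (τ q * fderiv ℝ (fderiv ℝ f) q (e i) e₀) := by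
      funext q; rw [hg1, he]; ring
    have d1 : DifferentiableAt ℝ (fun q => fderiv ℝ (fderiv ℝ f) q (e i) e₀) p := by
      have := hf''.differentiable (by simp)
      fun_prop
    have d2 : DifferentiableAt ℝ (fun q => fderiv ℝ f q (e i)) p := by fun_prop
    rw [e1, fderiv_add_const_mul_clm_mul τ c d2 d1, he, fderiv_clm_apply_const hfd,
      fderiv_third_symm hf]
    ring
  intro p
  have hLd : fderiv ℝ (fun q => ∑ i, fderiv ℝ (fderiv ℝ f) q (e i) (e i)) p e₀ =
      ∑ i, fderiv ℝ (fun q => fderiv ℝ (fderiv ℝ f) q (e i) (e i)) p e₀ := by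
    rw [fderiv_fun_sum, sum_apply]
    intro i _
    have := hf''.differentiable (by simp)
    fun_prop
  rw [hg2e, congrFun hg1e p, hLd]
  simp only [hg2i, Finset.sum_add_distrib, ← Finset.mul_sum]
  linear_combination (τ p * ∑ i, fderiv ℝ (fderiv ℝ f) p (e i) (e i)) * hck

end EPD

/-! ### Averages over spheres -/

section SphericalAverage

open MeasureTheory

variable {n : ℕ}

/-- The map `(t, x) ↦ (x + t v, t v)`. -/
noncomputable def shear (v : EuclideanSpace ℝ (Fin n)) :
    ℝ × EuclideanSpace ℝ (Fin n) →L[ℝ] EuclideanSpace ℝ (Fin n) × EuclideanSpace ℝ (Fin n) :=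
  (ContinuousLinearMap.snd ℝ _ _ + (ContinuousLinearMap.fst ℝ _ _).smulRight v).prod
    ((ContinuousLinearMap.fst ℝ _ _).smulRight v)

theorem shear_apply (v : EuclideanSpace ℝ (Fin n)) (p : ℝ × EuclideanSpace ℝ (Fin n)) :
    shear v p = (p.2 + p.1 • v, p.1 • v) := rfl

theorem norm_shear_le {v : EuclideanSpace ℝ (Fin n)} (hv : ‖v‖ ≤ 1) : ‖shear v‖ ≤ 2 := by
  refine ContinuousLinearMap.opNorm_le_bound _ (by norm_num) fun p => ?_
  have h1 : ‖p.1 • v‖ ≤ ‖p‖ := by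
    rw [norm_smul]
    nlinarith [norm_fst_le p, norm_nonneg p.1, norm_nonneg v]
  rw [shear_apply]
  refine max_le ((norm_add_le _ _).trans ?_) ?_
  · linarith [norm_snd_le p]
  · exact h1.trans (by linarith [norm_nonneg p])

/-- The function on phase space underlying `sphAvg`, as a function of the direction and of the
point of space-time. -/
noncomputable def shearComp (G : EuclideanSpace ℝ (Fin n) × EuclideanSpace ℝ (Fin n) → ℝ) :
    EuclideanSpace ℝ (Fin n) × (ℝ × EuclideanSpace ℝ (Fin n)) → ℝ :=
  fun x => G (shear x.1 x.2)

theorem contDiff_shearComp {k : WithTop ℕ∞}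
    {G : EuclideanSpace ℝ (Fin n) × EuclideanSpace ℝ (Fin n) → ℝ} (hG : ContDiff ℝ k G) :
    ContDiff ℝ k (shearComp G) := by
  unfold shearComp
  simp only [shear_apply]
  fun_prop

/-- The averages of `G (x + t v, t v)` over the directions `v`. -/
noncomputable def sphAvg (ν : Measure (EuclideanSpace ℝ (Fin n)))
    (G : EuclideanSpace ℝ (Fin n) × EuclideanSpace ℝ (Fin n) → ℝ)
    (p : ℝ × EuclideanSpace ℝ (Fin n)) : ℝ :=
  ∫ v, shearComp G (v, p) ∂ν

variable {k : ℝ} {ν : Measure (EuclideanSpace ℝ (Fin n))}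

theorem contDiff_sphAvg (hν : IsDarbouxMeasure k ν) {j : ℕ}
    {G : EuclideanSpace ℝ (Fin n) × EuclideanSpace ℝ (Fin n) → ℝ} (hG : ContDiff ℝ j G) :
    ContDiff ℝ j (sphAvg ν G) := by
  have := hν.isProbabilityMeasure
  exact contDiff_integral_of_ae_norm_le hν.ae_norm_le j (contDiff_shearComp hG)

theorem fderiv_shearComp {G : EuclideanSpace ℝ (Fin n) × EuclideanSpace ℝ (Fin n) → ℝ}
    (hG : Differentiable ℝ G) (v : EuclideanSpace ℝ (Fin n)) (p : ℝ × EuclideanSpace ℝ (Fin n)) :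
    fderiv ℝ (fun q => shearComp G (v, q)) p = (fderiv ℝ G (shear v p)).comp (shear v) := by
  simpa [shearComp] using fderiv_comp_affine hG (shear v) 0 p

/-- The solution operator of the passage from the Euler-Poisson-Darboux equation with parameter `k`
to the one with parameter `k - 2`, on phase space. -/
noncomputable def ladder (k : ℝ)
    (G : EuclideanSpace ℝ (Fin n) × EuclideanSpace ℝ (Fin n) → ℝ) :
    EuclideanSpace ℝ (Fin n) × EuclideanSpace ℝ (Fin n) → ℝ :=
  fun x => G x + (k - 1)⁻¹ * fderiv ℝ G x (x.2, x.2)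

theorem contDiff_ladder {j : WithTop ℕ∞}
    {G : EuclideanSpace ℝ (Fin n) × EuclideanSpace ℝ (Fin n) → ℝ} (hG : ContDiff ℝ (j + 1) G) :
    ContDiff ℝ j (ladder k G) := by
  have h1 : ContDiff ℝ j (fderiv ℝ G) := hG.fderiv_right le_rfl
  have h2 : ContDiff ℝ j G := hG.of_le (by simp)
  unfold ladder
  exact h2.add (contDiff_const.mul (h1.clm_apply (contDiff_snd.prodMk contDiff_snd)))

/-- Along `t ↦ (x + t v, t v)` the operator `t ∂_t` is the derivative in the direction `(t v, t v)`,
twice the second component. Keeping `t v` as a separate variable thus turns the ladder step into a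
differential operator on the integrand, which is local and leaves the values at `(x, 0)` unchanged.
-/
theorem sphAvg_ladder {l : ℝ} (hν : IsDarbouxMeasure k ν)
    {G : EuclideanSpace ℝ (Fin n) × EuclideanSpace ℝ (Fin n) → ℝ} (hG : ContDiff ℝ 1 G)
    (p : ℝ × EuclideanSpace ℝ (Fin n)) :
    sphAvg ν (ladder l G) p =
      sphAvg ν G p + (l - 1)⁻¹ * (p.1 * fderiv ℝ (sphAvg ν G) p (1, 0)) := by
  have := hν.isProbabilityMeasure
  have hK := contDiff_shearComp hG
  have e : fderiv ℝ (sphAvg ν G) p (1, 0) =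
      ∫ v, fderiv ℝ (fun q => shearComp G (v, q)) p (1, 0) ∂ν :=
    fderiv_integral_apply_apply hK hν.ae_norm_le p (1, 0)
  have hi := (integrable_fderiv hK hν.ae_norm_le p).apply_continuousLinearMap (1, 0)
  have hi0 : Integrable (fun v => shearComp G (v, p)) ν :=
    integrable_of_continuous_of_ae_norm_le (hK.continuous.comp (by fun_prop)) hν.ae_norm_le
  rw [e, ← integral_const_mul, ← integral_const_mul, sphAvg, sphAvg, ← integral_add hi0
    ((hi.const_mul _).const_mul _)]
  refine integral_congr_ae (.of_forall fun v => ?_)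
  simp only [fderiv_shearComp (hG.differentiable (by simp))]
  simp only [shearComp, ladder, ContinuousLinearMap.comp_apply, shear_apply]
  have : ((p.1 • v, p.1 • v) : EuclideanSpace ℝ (Fin n) × EuclideanSpace ℝ (Fin n)) =
    p.1 • (v, v) := rfl
  rw [this, map_smul]
  simp

/-- For `t ≠ 0` this is the defining identity of a Darboux measure for the function `v ↦ f (x + t
v)`; `t = 0` follows by density. -/
theorem solvesEPD_sphAvg (hν : IsDarbouxMeasure k ν) {f : EuclideanSpace ℝ (Fin n) → ℝ}
    (hf : ContDiff ℝ 2 f) :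
    SolvesEPD (ContinuousLinearMap.fst ℝ ℝ (EuclideanSpace ℝ (Fin n))) (1, 0)
      (fun i => (0, EuclideanSpace.single i 1)) k (sphAvg ν fun x => f x.1) := by
  have := hν.isProbabilityMeasure
  have hG : ContDiff ℝ 2 fun x : EuclideanSpace ℝ (Fin n) × EuclideanSpace ℝ (Fin n) => f x.1 :=
    hf.comp contDiff_fst
  have hK := contDiff_shearComp hG
  have hK1 : ContDiff ℝ 1 (shearComp fun x : EuclideanSpace ℝ (Fin n) × _ => f x.1) :=
    hK.of_le (by norm_num)
  have hC2 : ContDiff ℝ 2 (sphAvg ν fun x => f x.1) := contDiff_sphAvg (j := 2) hν hG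
  obtain ⟨c1, c2, c3⟩ := contDiff_two_iff_fderiv_fderiv.1 hC2
  have hKv : ∀ v (q : ℝ × EuclideanSpace ℝ (Fin n)),
      shearComp (fun x : EuclideanSpace ℝ (Fin n) × _ => f x.1) (v, q) = f (q.2 + q.1 • v) :=
    fun v q => rfl
  set A : EuclideanSpace ℝ (Fin n) → ℝ × EuclideanSpace ℝ (Fin n) →L[ℝ] EuclideanSpace ℝ (Fin n) :=
    fun v => ContinuousLinearMap.snd ℝ _ _ + (ContinuousLinearMap.fst ℝ _ _).smulRight v with hA
  have hAv : ∀ v q, A v q = q.2 + q.1 • v := fun v q => rfl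
  have d1 : ∀ v p u, fderiv ℝ (fun q => shearComp
      (fun x : EuclideanSpace ℝ (Fin n) × _ => f x.1) (v, q)) p u =
      fderiv ℝ f (p.2 + p.1 • v) (A v u) := fun v p u => by
    have := congrArg (fun T => T u)
      (fderiv_comp_affine (hf.differentiable (by simp)) (A v) 0 p)
    simpa [hAv, hKv] using this
  have d2 : ∀ v p u w, fderiv ℝ (fderiv ℝ (fun q => shearComp
      (fun x : EuclideanSpace ℝ (Fin n) × _ => f x.1) (v, q))) p u w =
      fderiv ℝ (fderiv ℝ f) (p.2 + p.1 • v) (A v u) (A v w) := fun v p u w => by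
    have := congrArg (fun T => T u w) (fderiv_fderiv_comp_affine hf (A v) 0 p)
    simpa [hAv, hKv] using this
  have key : ∀ p : ℝ × EuclideanSpace ℝ (Fin n), p.1 ≠ 0 →
      p.1 * fderiv ℝ (fderiv ℝ (sphAvg ν fun x => f x.1)) p (1, 0) (1, 0) +
        k * fderiv ℝ (sphAvg ν fun x => f x.1) p (1, 0) - p.1 *
        ∑ i, fderiv ℝ (fderiv ℝ (sphAvg ν fun x => f x.1)) p (0, EuclideanSpace.single i 1)
          (0, EuclideanSpace.single i 1) = 0 := fun p hp => by
    have e2 : ∀ u w, fderiv ℝ (fderiv ℝ (sphAvg ν fun x => f x.1)) p u w =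
        ∫ v, fderiv ℝ (fderiv ℝ f) (p.2 + p.1 • v) (A v u) (A v w) ∂ν := fun u w => by
      rw [← integral_congr_ae (.of_forall fun v => d2 v p u w)]
      exact fderiv_fderiv_integral_apply_apply hK hν.ae_norm_le p u w
    have e1 : ∀ u, fderiv ℝ (sphAvg ν fun x => f x.1) p u =
        ∫ v, fderiv ℝ f (p.2 + p.1 • v) (A v u) ∂ν := fun u => by
      rw [← integral_congr_ae (.of_forall fun v => d1 v p u)]
      exact fderiv_integral_apply_apply hK1 hν.ae_norm_le p u
    set S : EuclideanSpace ℝ (Fin n) →L[ℝ] EuclideanSpace ℝ (Fin n) :=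
      p.1 • ContinuousLinearMap.id ℝ _ with hS
    have hSv : ∀ v, S v + p.2 = p.2 + p.1 • v := fun v => by simp [hS, add_comm]
    have s1 : ∀ v u, fderiv ℝ (fun v => f (S v + p.2)) v u =
        p.1 * fderiv ℝ f (p.2 + p.1 • v) u := fun v u => by
      rw [fderiv_comp_affine (hf.differentiable (by simp)), hSv]
      simp [hS]
    have s2 : ∀ v u w, fderiv ℝ (fderiv ℝ (fun v => f (S v + p.2))) v u w =
        p.1 * (p.1 * fderiv ℝ (fderiv ℝ f) (p.2 + p.1 • v) u w) := fun v u w => by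
      rw [fderiv_fderiv_comp_affine hf, hSv]
      simp [hS]
    have hint := hν.integral_eq_zero (fun v => f (S v + p.2))
      (hf.comp (S.contDiff.add contDiff_const))
    have hfc1 := (hf.fderiv_right (m := 1) (by norm_num)).continuous
    have hfc2 := ((hf.fderiv_right (m := 1) (by norm_num)).fderiv_right (m := 0)
      (by norm_num)).continuous
    have hI : ∀ {h : EuclideanSpace ℝ (Fin n) → ℝ}, Continuous h → Integrable h ν := fun hh =>
      integrable_of_continuous_of_ae_norm_le hh hν.ae_norm_le
    simp only [e1, e2, hAv, one_smul, zero_smul, add_zero, zero_add]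
    rw [← integral_const_mul, ← integral_const_mul, ← integral_finsetSum _ (fun i _ =>
      hI (by fun_prop)), ← integral_const_mul, ← integral_add (hI (by fun_prop)) (hI (by fun_prop)),
      ← integral_sub (hI (by fun_prop)) (hI (by fun_prop))]
    -- The Darboux identity is `-t` times the equation to be shown.
    refine (mul_eq_zero.1 ?_).resolve_left (neg_ne_zero.2 hp)
    rw [← integral_const_mul, ← hint]
    refine integral_congr_ae (.of_forall fun v => ?_)
    simp only [s1, s2, ← Finset.mul_sum]
    ring
  intro p
  have := eq_zero_of_clm_mul_eq_zero
    (τ := ContinuousLinearMap.fst ℝ ℝ (EuclideanSpace ℝ (Fin n))) (e₀ := (1, 0)) rfl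
    (h := fun p : ℝ × EuclideanSpace ℝ (Fin n) =>
      p.1 * fderiv ℝ (fderiv ℝ (sphAvg ν fun x => f x.1)) p (1, 0) (1, 0) +
        k * fderiv ℝ (sphAvg ν fun x => f x.1) p (1, 0) - p.1 *
        ∑ i, fderiv ℝ (fderiv ℝ (sphAvg ν fun x => f x.1)) p (0, EuclideanSpace.single i 1)
          (0, EuclideanSpace.single i 1)) (by
      have := c2.continuous
      fun_prop) key p
  exact sub_eq_zero.1 this

end SphericalAverage

/-! ### Waves with compactly supported initial state -/

section CompactSupport

open MeasureTheory

variable {n : ℕ} {k : ℝ} {ν : Measure (EuclideanSpace ℝ (Fin n))}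

/-- The function on phase space whose averages solve the Euler-Poisson-Darboux equation with
parameter `2 * m - 2 * i` and initial state `f`. -/
noncomputable def phaseFun (f : EuclideanSpace ℝ (Fin n) → ℝ) (m : ℕ) :
    ℕ → EuclideanSpace ℝ (Fin n) × EuclideanSpace ℝ (Fin n) → ℝ
  | 0 => fun x => f x.1
  | i + 1 => ladder (2 * m - 2 * i) (phaseFun f m i)

theorem contDiff_phaseFun {f : EuclideanSpace ℝ (Fin n) → ℝ} (m i : ℕ) :
    ∀ j : ℕ, ContDiff ℝ (i + j : ℕ) f → ContDiff ℝ j (phaseFun f m i) := by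
  induction i with
  | zero => exact fun j hf => (hf.of_le (by simp)).comp contDiff_fst
  | succ i ih =>
    intro j hf
    refine contDiff_ladder ?_
    exact_mod_cast ih (j + 1) (hf.of_le (by norm_cast; omega))

theorem solvesEPD_sphAvg_phaseFun {m : ℕ} (hν : IsDarbouxMeasure (2 * m) ν)
    {f : EuclideanSpace ℝ (Fin n) → ℝ} (hf : ContDiff ℝ (m + 2 : ℕ) f) (i : ℕ) (hi : i ≤ m) :
    SolvesEPD (ContinuousLinearMap.fst ℝ ℝ (EuclideanSpace ℝ (Fin n))) (1, 0)
      (fun i => (0, EuclideanSpace.single i 1)) (2 * m - 2 * i) (sphAvg ν (phaseFun f m i)) := by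
  induction i with
  | zero => simpa [phaseFun] using solvesEPD_sphAvg hν (hf.of_le (by norm_cast; omega))
  | succ i ih =>
    have h3 : ContDiff ℝ (3 : ℕ) (phaseFun f m i) :=
      contDiff_phaseFun m i 3 (hf.of_le (by norm_cast; omega))
    have him : (i : ℝ) + 1 ≤ m := by exact_mod_cast hi
    have := SolvesEPD.ladder (τ := ContinuousLinearMap.fst ℝ ℝ (EuclideanSpace ℝ (Fin n))) rfl
      (fun _ => rfl) (k := 2 * m - 2 * i) (by intro h; linarith)
      (contDiff_sphAvg hν h3) (ih (by omega))
      (fun p => sphAvg_ladder (l := 2 * m - 2 * i) hν (h3.of_le (by norm_cast)) p)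
    have hcast : (2 * m - 2 * (i + 1 : ℕ) : ℝ) = 2 * m - 2 * i - 2 := by push_cast; ring
    rw [hcast]
    exact this

theorem phaseFun_apply_zero (f : EuclideanSpace ℝ (Fin n) → ℝ) (m i : ℕ)
    (x : EuclideanSpace ℝ (Fin n)) : phaseFun f m i (x, 0) = f x := by
  induction i with
  | zero => rfl
  | succ i ih =>
    have : ((0, 0) : EuclideanSpace ℝ (Fin n) × EuclideanSpace ℝ (Fin n)) = 0 := rfl
    simp [phaseFun, ladder, ih, this]

theorem phaseFun_eq_zero {f : EuclideanSpace ℝ (Fin n) → ℝ} {ρ : ℝ}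
    (hf : ∀ x, ρ < ‖x‖ → f x = 0) (m i : ℕ)
    (x : EuclideanSpace ℝ (Fin n) × EuclideanSpace ℝ (Fin n)) (hx : ρ < ‖x.1‖) :
    phaseFun f m i x = 0 := by
  induction i generalizing x with
  | zero => exact hf _ hx
  | succ i ih =>
    have hev : phaseFun f m i =ᶠ[nhds x] fun _ => 0 := by
      have ho : IsOpen {x : EuclideanSpace ℝ (Fin n) × EuclideanSpace ℝ (Fin n) | ρ < ‖x.1‖} :=
        isOpen_lt continuous_const (by fun_prop)
      filter_upwards [ho.mem_nhds hx] with z hz using ih z hz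
    simp [phaseFun, ladder, ih x hx, hev.fderiv_eq]

/-- A direction `v` contributes at `(t, x)` only if `‖x + t v‖ ≤ ρ`. With `‖x‖ ≤ r` this forces `‖t
v‖ ≤ r + ρ`, which confines `v` to a ball of radius `(r + ρ) / |t|` and the argument of `G` to a
compact set independent of `t`. -/
theorem exists_c2BoundAt_sphAvg (hν : IsDarbouxMeasure k ν)
    {G : EuclideanSpace ℝ (Fin n) × EuclideanSpace ℝ (Fin n) → ℝ} (hG : ContDiff ℝ 2 G) {ρ r : ℝ}
    (hr : 0 ≤ r) (h0 : ∀ x, ρ < ‖x.1‖ → G x = 0) :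
    ∃ C, 0 ≤ C ∧ ∀ p : ℝ × EuclideanSpace ℝ (Fin n), ‖p.2‖ ≤ r → p.1 ≠ 0 →
      C2BoundAt (sphAvg ν G) p (ν.real (Metric.closedBall 0 ((r + ρ) / |p.1|)) * C) := by
  have := hν.isProbabilityMeasure
  obtain ⟨C, hC0, hC⟩ := exists_c2NormLE hG (r + ρ)
  refine ⟨C * 2 ^ 2, by positivity, fun p hp ht => ?_⟩
  refine c2BoundAt_integral (contDiff_shearComp hG) hν.ae_norm_le
    Metric.isClosed_closedBall.measurableSet ?_
  filter_upwards [hν.ae_norm_le] with v hv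
  have ht' : 0 < |p.1| := abs_pos.2 ht
  have hcomp : (fun q => shearComp G (v, q)) = fun q => G (shear v q + 0) := by
    simp [shearComp]
  rw [hcomp]
  have hcase : ‖p.2 + p.1 • v‖ ≤ ρ → ‖p.1 • v‖ ≤ r + ρ := fun h => by
    have := norm_sub_le (p.2 + p.1 • v) p.2
    rw [add_sub_cancel_left] at this
    linarith
  by_cases hz : ‖p.2 + p.1 • v‖ ≤ ρ
  · have hw := hcase hz
    have hmem : v ∈ Metric.closedBall (0 : EuclideanSpace ℝ (Fin n)) ((r + ρ) / |p.1|) := by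
      rw [mem_closedBall_zero_iff, le_div_iff₀ ht']
      rwa [norm_smul, Real.norm_eq_abs, mul_comm] at hw
    refine ⟨fun _ => ?_, fun h => absurd hmem h⟩
    refine C2BoundAt.comp_affine hG ?_ (norm_shear_le hv) (by norm_num)
    refine hC _ ?_
    rw [add_zero, shear_apply]
    exact max_le (hz.trans (by linarith)) hw
  · have hb0 : C2BoundAt G (shear v p + 0) 0 := by
      rw [add_zero]
      have ho : IsOpen {x : EuclideanSpace ℝ (Fin n) × EuclideanSpace ℝ (Fin n) | ρ < ‖x.1‖} :=
        isOpen_lt continuous_const (by fun_prop)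
      have hev : G =ᶠ[nhds (shear v p)] fun _ => 0 := by
        filter_upwards [ho.mem_nhds (show ρ < ‖(shear v p).1‖ by
          rw [shear_apply]; exact not_le.1 hz)] with z hz using h0 z hz
      refine ⟨by simp [hev.eq_of_nhds], by simp [hev.fderiv_eq], ?_⟩
      rw [(Filter.EventuallyEq.fderiv hev).fderiv_eq, fderiv_fun_const]
      simp only [Pi.zero_def, fderiv_fun_const, Pi.zero_apply]
      exact (ContinuousLinearMap.opNorm_zero).le
    have hb := C2BoundAt.comp_affine hG hb0 (norm_shear_le hv) (by norm_num)
    rw [zero_mul] at hb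
    exact ⟨fun _ => ⟨hb.1.trans (by positivity), hb.2.1.trans (by positivity),
      hb.2.2.trans (by positivity)⟩, fun _ => hb⟩

/-- The wave with compactly supported initial state `f` that is at rest initially, with its decay
in time. -/
theorem exists_decaying_wave (hn : 1 ≤ n) {f : EuclideanSpace ℝ (Fin n) → ℝ}
    (hf : ContDiff ℝ (n / 2 + 2 : ℕ) f) {ρ : ℝ} (hρ : 0 ≤ ρ) (h0 : ∀ x, ρ < ‖x‖ → f x = 0) :
    ∃ u : ℝ × EuclideanSpace ℝ (Fin n) → ℝ, IsWave u ∧ (∀ x, u (0, x) = f x) ∧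
      ∀ r, 0 ≤ r → ∃ C, 0 ≤ C ∧ ∀ p, ‖p.2‖ ≤ r → p.1 ≠ 0 → C2BoundAt u p (C / p.1 ^ 2) := by
  obtain ⟨ν, hν⟩ := exists_isDarbouxMeasure hn
  have := hν.isProbabilityMeasure
  set m := n / 2
  have h2 : ContDiff ℝ (2 : ℕ) (phaseFun f m m) := contDiff_phaseFun m m 2 hf
  refine ⟨sphAvg ν (phaseFun f m m), ?_, fun x => ?_, fun r hr => ?_⟩
  · have h := solvesEPD_sphAvg_phaseFun hν hf m le_rfl
    rw [sub_self] at h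
    exact SolvesEPD.solvesWave (τ := ContinuousLinearMap.fst ℝ ℝ (EuclideanSpace ℝ (Fin n))) rfl
      (contDiff_sphAvg hν h2) h
  · simp [sphAvg, shearComp, shear_apply, phaseFun_apply_zero]
  · obtain ⟨C, hC0, hC⟩ := exists_c2BoundAt_sphAvg hν h2 hr (phaseFun_eq_zero h0 m m)
    obtain ⟨B, hB⟩ := hν.exists_closedBall_le
    have hB0 : 0 ≤ B := by simpa using measureReal_nonneg.trans (hB 1 zero_le_one)
    refine ⟨B * (r + ρ) ^ 2 * C, by positivity, fun p hp ht => ?_⟩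
    have hle : ν.real (Metric.closedBall 0 ((r + ρ) / |p.1|)) * C ≤
        B * (r + ρ) ^ 2 * C / p.1 ^ 2 := by
      refine (mul_le_mul_of_nonneg_right (hB _ (by positivity)) hC0).trans_eq ?_
      rw [div_pow, sq_abs]; ring
    have := hC p hp ht
    exact ⟨this.1.trans hle, this.2.1.trans hle, this.2.2.trans hle⟩

theorem norm_dilation_le {b : ℝ} (hb : |b| ≤ 1) :
    ‖(b • ContinuousLinearMap.fst ℝ ℝ (EuclideanSpace ℝ (Fin n))).prod
      (ContinuousLinearMap.snd ℝ ℝ (EuclideanSpace ℝ (Fin n)))‖ ≤ 1 := by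
  refine ContinuousLinearMap.opNorm_le_bound _ zero_le_one fun p => ?_
  rw [one_mul]
  refine max_le ?_ (norm_snd_le p)
  have := norm_fst_le p
  calc ‖b • p.1‖ = |b| * ‖p.1‖ := norm_smul b p.1
    _ ≤ ‖p‖ := by nlinarith [norm_nonneg p.1]

theorem C2BoundAt.comp_time {u : ℝ × EuclideanSpace ℝ (Fin n) → ℝ} (hu : ContDiff ℝ 2 u)
    {a b ε : ℝ} (hb : |b| ≤ 1) {p : ℝ × EuclideanSpace ℝ (Fin n)}
    (h : C2BoundAt u (a + b * p.1, p.2) ε) :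
    C2BoundAt (fun q : ℝ × EuclideanSpace ℝ (Fin n) => u (a + b * q.1, q.2)) p ε := by
  have := C2BoundAt.comp_affine (A := (b • ContinuousLinearMap.fst ℝ ℝ (EuclideanSpace ℝ (Fin n))).prod
      (ContinuousLinearMap.snd ℝ ℝ (EuclideanSpace ℝ (Fin n)))) (b := (a, 0)) (p := p) (ε := ε) hu
      (by simpa [add_comm] using h) (norm_dilation_le hb) le_rfl
  simpa [add_comm] using this

/-- Exact controllability for compactly supported initial states and zero terminal state. -/
theorem exists_wave_of_compact_support (hn : 1 ≤ n) {f : EuclideanSpace ℝ (Fin n) → ℝ}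
    (hf : ContDiff ℝ (n / 2 + 2 : ℕ) f) {ρ : ℝ} (h0 : ∀ x, ρ < ‖x‖ → f x = 0)
    {T : ℝ} (hT : 0 < T) :
    ∃ y : ℝ × EuclideanSpace ℝ (Fin n) → ℝ, IsWave y ∧ (∀ x, y (0, x) = f x) ∧
      ∀ x, y (T, x) = 0 := by
  obtain ⟨u, hu, hu0, hdecay⟩ := exists_decaying_wave hn hf (le_max_right ρ 0)
    fun x hx => h0 x ((le_max_left _ _).trans_lt hx)
  -- Each term is odd under reflection of time at `T`, hence vanishes there; at time `0` the series
  -- telescopes to `u (0, x)`, since `u (2 N T, x)` tends to zero.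
  set z : ℕ → ℝ × EuclideanSpace ℝ (Fin n) → ℝ := fun k p =>
    u (2 * k * T + 1 * p.1, p.2) - u (2 * (k + 1) * T + -1 * p.1, p.2) with hz
  have hw : ∀ (a b : ℝ), b ^ 2 = 1 →
      IsWave (fun p : ℝ × EuclideanSpace ℝ (Fin n) => u (a + b * p.1, p.2)) := fun a b hb => by
    simpa using IsWave.comp_dilation hu a b 1 (by simpa using hb)
  have hzw : ∀ k, IsWave (z k) := fun k => (hw _ _ (by norm_num)).sub (hw _ _ (by norm_num))
  have hb : ∀ r : ℝ, ∃ b : ℕ → ℝ, Summable b ∧ ∀ k, C2NormLE (z k) r (b k) := fun r => by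
    obtain ⟨C, hC0, hC⟩ := hdecay |r| (abs_nonneg r)
    -- For `k ≥ N` one has `|t| ≤ |r| ≤ k T`, so both time arguments are at least `k T` and the
    -- decay of `u` gives `C / (k T) ^ 2`.
    obtain ⟨N, hN⟩ := exists_nat_gt (max 1 (|r| / T))
    have hN1 : (1 : ℝ) < N := (le_max_left _ _).trans_lt hN
    have hN2 : |r| < N * T := (div_lt_iff₀ hT).1 ((le_max_right _ _).trans_lt hN)
    refine exists_summable_c2NormLE (fun k => (hzw k).1) (N := N)
      (b := fun k => C / T ^ 2 * (1 / (k : ℝ) ^ 2) + C / T ^ 2 * (1 / (k : ℝ) ^ 2)) ?_ ?_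
    · have := (Real.summable_one_div_nat_pow (p := 2)).2 one_lt_two
      exact (this.mul_left _).add (this.mul_left _)
    · intro k hk p hp
      have hkN : (N : ℝ) ≤ k := by exact_mod_cast hk
      have hk0 : (0 : ℝ) < k := by linarith
      have hp1 : |p.1| ≤ |r| := (norm_fst_le p).trans (hp.trans (le_abs_self r))
      have hp2 : ‖p.2‖ ≤ |r| := (norm_snd_le p).trans (hp.trans (le_abs_self r))
      have hrk : |r| ≤ k * T := by nlinarith
      obtain ⟨q1, q2⟩ := abs_le.1 hp1
      have hmain : ∀ s, k * T ≤ s → C2BoundAt u (s, p.2) (C / T ^ 2 * (1 / (k : ℝ) ^ 2)) := by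
        intro s hs
        have hs0 : 0 < s := (mul_pos hk0 hT).trans_le hs
        have hle : C / s ^ 2 ≤ C / T ^ 2 * (1 / (k : ℝ) ^ 2) := by
          rw [div_mul_div_comm, mul_one, ← mul_pow]
          exact div_le_div_of_nonneg_left hC0 (by positivity)
            (pow_le_pow_left₀ (by positivity) (by linarith) 2)
        have := hC (s, p.2) hp2 hs0.ne'
        exact ⟨this.1.trans hle, this.2.1.trans hle, this.2.2.trans hle⟩
      refine C2BoundAt.sub (hw _ _ (by norm_num)).1 (hw _ _ (by norm_num)).1
        (C2BoundAt.comp_time hu.1 (by norm_num) (hmain _ ?_))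
        (C2BoundAt.comp_time hu.1 (by norm_num) (hmain _ ?_))
      · linarith
      · linarith
  refine ⟨fun q => ∑' k, z k q, SolvesWave.tsum hzw hb, fun x => ?_, fun x => ?_⟩
  · have hsum : Summable fun k => z k (0, x) := by
      obtain ⟨b, hbs, hbb⟩ := hb ‖((0, x) : ℝ × EuclideanSpace ℝ (Fin n))‖
      exact Summable.of_norm_bounded hbs fun k => (hbb k _ le_rfl).1
    obtain ⟨C, hC0, hC⟩ := hdecay ‖x‖ (norm_nonneg x)
    have hlim : Filter.Tendsto (fun N : ℕ => u (2 * N * T, x)) Filter.atTop (nhds 0) := by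
      refine squeeze_zero_norm' (a := fun N : ℕ => C / (2 * N * T) ^ 2) ?_ ?_
      · filter_upwards [Filter.eventually_gt_atTop 0] with N hN
        have hN' : (0 : ℝ) < N := by exact_mod_cast hN
        exact (hC (2 * N * T, x) le_rfl (by positivity)).1
      · have h1 : Filter.Tendsto (fun N : ℕ => (2 * N * T : ℝ)) Filter.atTop Filter.atTop :=
          (tendsto_natCast_atTop_atTop.const_mul_atTop two_pos).atTop_mul_const hT
        exact Filter.Tendsto.const_div_atTop (Filter.tendsto_pow_atTop two_ne_zero |>.comp h1) C
    have htel : ∀ N : ℕ, ∑ k ∈ Finset.range N, z k (0, x) = u (0, x) - u (2 * N * T, x) := by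
      intro N
      have := Finset.sum_range_sub' (fun k : ℕ => u (2 * k * T, x)) N
      simpa [hz] using this
    have h1 := hsum.hasSum.tendsto_sum_nat
    simp only [htel] at h1
    have h2 := tendsto_nhds_unique h1 (tendsto_const_nhds.sub hlim)
    exact h2.trans (by rw [sub_zero, hu0])
  · have : ∀ k, z k (T, x) = 0 := fun k => by
      simp only [hz]
      rw [sub_eq_zero]
      congr 2; ring
    simp [this]

end CompactSupport

/-! ### Regularization in space -/

section Mollify

open MeasureTheory

variable {V : Type*} [NormedAddCommGroup V] [NormedSpace ℝ V] [ProperSpace V]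

theorem exists_delta_of_continuous {V F : Type*} [NormedAddCommGroup V] [ProperSpace V]
    [PseudoMetricSpace F] {g : V → F}
    (hg : Continuous g) (r : ℝ) {ε : ℝ} (hε : 0 < ε) :
    ∃ δ > 0, ∀ p ∈ Metric.closedBall (0 : V) r, ∀ q ∈ Metric.closedBall (0 : V) r,
      dist p q < δ → dist (g p) (g q) < ε :=
  Metric.uniformContinuousOn_iff.1 ((isCompact_closedBall (0 : V) r).uniformContinuousOn_of_continuous
    hg.continuousOn) ε hε

/-- Uniform continuity of `f` and its two derivatives on the ball of radius `r + 1`, which contains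
the translates because `δ ≤ 1`. -/
theorem exists_delta_c2BoundAt_sub {f : V → ℝ} (hf : ContDiff ℝ 2 f) (r : ℝ) {ε : ℝ}
    (hε : 0 < ε) : ∃ δ, 0 < δ ∧ δ ≤ 1 ∧ ∀ p w : V, ‖p‖ ≤ r → ‖w‖ ≤ δ →
      C2BoundAt (fun q => f q - f (q - w)) p ε := by
  obtain ⟨h1, h2, h3⟩ := contDiff_two_iff_fderiv_fderiv.1 hf
  obtain ⟨a, ha, ha'⟩ := exists_delta_of_continuous h1.continuous (r + 1) hε
  obtain ⟨b, hb, hb'⟩ := exists_delta_of_continuous h2.continuous (r + 1) hε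
  obtain ⟨c, hc, hc'⟩ := exists_delta_of_continuous (F := V →L[ℝ] V →L[ℝ] ℝ) h3 (r + 1) hε
  refine ⟨min 1 (min a (min b c) / 2), by positivity, min_le_left _ _, fun p w hp hw => ?_⟩
  have hw1 : ‖w‖ ≤ 1 := hw.trans (min_le_left _ _)
  have hw2 : ‖w‖ < min a (min b c) := by
    have : 0 < min a (min b c) := by positivity
    linarith [hw.trans (min_le_right _ _)]
  have hm1 : p ∈ Metric.closedBall (0 : V) (r + 1) := by
    rw [mem_closedBall_zero_iff]; linarith
  have hm2 : p - w ∈ Metric.closedBall (0 : V) (r + 1) := by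
    rw [mem_closedBall_zero_iff]; linarith [norm_sub_le p w]
  have hd : dist p (p - w) = ‖w‖ := by simp
  have hsh : (fun q => f (q - w)) = fun q => f (ContinuousLinearMap.id ℝ V q + -w) := by
    simp [sub_eq_add_neg]
  have e1 : ∀ q, fderiv ℝ (fun q => f (q - w)) q = fderiv ℝ f (q - w) := fun q => by
    rw [hsh, fderiv_comp_affine h1]; simp [sub_eq_add_neg]
  have hd1 : Differentiable ℝ fun q => f (q - w) := by fun_prop
  have hd2 : Differentiable ℝ fun q => fderiv ℝ f (q - w) := by fun_prop
  have e2 : fderiv ℝ (fderiv ℝ fun q => f (q - w)) p = fderiv ℝ (fderiv ℝ f) (p - w) := by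
    have : fderiv ℝ (fun q => f (q - w)) = fun q =>
        fderiv ℝ f (ContinuousLinearMap.id ℝ V q + -w) := by
      funext q; rw [e1]; simp [sub_eq_add_neg]
    rw [this, fderiv_comp_affine h2]; simp [sub_eq_add_neg]
  have e3 : fderiv ℝ (fun q => f q - f (q - w)) =
      fun q => fderiv ℝ f q - fderiv ℝ (fun q => f (q - w)) q :=
    funext fun q => fderiv_fun_sub (h1 q) (hd1 q)
  refine ⟨?_, ?_, ?_⟩
  · have := ha' p hm1 _ hm2 (by rw [hd]; exact hw2.trans_le (min_le_left _ _))
    rw [dist_eq_norm] at this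
    exact this.le
  · have := hb' p hm1 _ hm2 (by
      rw [hd]; exact hw2.trans_le ((min_le_right _ _).trans (min_le_left _ _)))
    rw [dist_eq_norm] at this
    simp only [e3, e1]
    exact this.le
  · have := hc' p hm1 _ hm2 (by
      rw [hd]; exact hw2.trans_le ((min_le_right _ _).trans (min_le_right _ _)))
    rw [dist_eq_norm (E := V →L[ℝ] V →L[ℝ] ℝ)] at this
    rw [e3, fderiv_fun_sub (g := fderiv ℝ fun q => f (q - w)) (h2 p)
      (by rw [funext e1]; exact hd2 p), e2]
    exact this.le

theorem SolvesWave.integral {W ι : Type*} [NormedAddCommGroup W] [NormedSpace ℝ W] [ProperSpace W]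
    [MeasurableSpace W] [BorelSpace W] [Fintype ι] {e₀ : V} {e : ι → V} {ν : Measure W}
    [IsFiniteMeasure ν] {ρ : ℝ} (hν : ∀ᵐ w ∂ν, ‖w‖ ≤ ρ) {K : W × V → ℝ} (hK : ContDiff ℝ 2 K)
    (hc : ContDiff ℝ 2 fun p => ∫ w, K (w, p) ∂ν)
    (hw : ∀ w, SolvesWave e₀ e fun p => K (w, p)) :
    SolvesWave e₀ e fun p => ∫ w, K (w, p) ∂ν := by
  refine ⟨hc, fun p => ?_⟩
  have hi : ∀ u v, Integrable (fun w => fderiv ℝ (fderiv ℝ fun q => K (w, q)) p u v) ν :=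
    fun u v => (integrable_fderiv_fderiv_apply hK hν p u).apply_continuousLinearMap v
  simp only [waveForm, fderiv_fderiv_integral_apply_apply hK hν]
  rw [← integral_finsetSum _ fun i _ => hi _ _, ← integral_sub (hi _ _)
    (integrable_finsetSum _ fun i _ => hi _ _)]
  exact integral_eq_zero_of_ae (.of_forall fun w => (hw w).2 p)

end Mollify

/-! ### Reduction to smooth initial states. -/

section Smoothing

open MeasureTheory

variable {n : ℕ}

/-- A wave can be approximated in `C²` on compact sets by waves with smooth initial state. -/
theorem IsWave.exists_smooth_approx {y : ℝ × EuclideanSpace ℝ (Fin n) → ℝ} (hy : IsWave y)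
    {T : ℝ} (hT : ∀ x, y (T, x) = 0) (r : ℝ) {ε : ℝ} (hε : 0 < ε) :
    ∃ z : ℝ × EuclideanSpace ℝ (Fin n) → ℝ, IsWave z ∧ (∀ x, z (T, x) = 0) ∧
      ContDiff ℝ (⊤ : ℕ∞) (fun x => z (0, x)) ∧
      (∀ x, (∀ x', ‖x' - x‖ ≤ 1 → y (0, x') = 0) → z (0, x) = 0) ∧
      C2NormLE (fun p => y p - z p) r ε := by
  obtain ⟨δ, hδ, hδ1, hsub⟩ := exists_delta_c2BoundAt_sub hy.1 r hε
  set φ : ContDiffBump (0 : EuclideanSpace ℝ (Fin n)) := ⟨δ / 2, δ, by positivity, by linarith⟩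
  set ν : Measure (EuclideanSpace ℝ (Fin n)) :=
    volume.withDensity fun w => ENNReal.ofReal (φ.normed volume w) with hν
  have hmeas : Measurable fun w => ENNReal.ofReal (φ.normed volume w) :=
    φ.continuous_normed.measurable.ennreal_ofReal
  have hint : ∀ h : EuclideanSpace ℝ (Fin n) → ℝ,
      ∫ w, h w ∂ν = ∫ w, φ.normed volume w * h w := fun h => by
    rw [hν, integral_withDensity_eq_integral_toReal_smul hmeas
      (.of_forall fun w => ENNReal.ofReal_lt_top)]
    simp [ENNReal.toReal_ofReal (φ.nonneg_normed _)]
  have hprob : IsProbabilityMeasure ν := by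
    refine ⟨?_⟩
    rw [hν, withDensity_apply _ MeasurableSet.univ, Measure.restrict_univ,
      ← ofReal_integral_eq_lintegral_ofReal φ.integrable_normed
        (.of_forall fun w => φ.nonneg_normed w), φ.integral_normed, ENNReal.ofReal_one]
  have hsupp : ∀ᵐ w ∂ν, ‖w‖ ≤ δ := by
    rw [hν, ae_withDensity_iff hmeas]
    refine .of_forall fun w hw => ?_
    have : w ∈ Function.support (φ.normed volume) := fun h0 => hw (by simp [h0])
    rw [φ.support_normed_eq] at this
    exact (mem_ball_zero_iff.1 this).le
  -- Mollification in space only: spatial translates of `y` are waves and vanish at time `T`, so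
  -- their averages do too. Smoothness is gained for the state at time `0`, by convolution with a
  -- bump function.
  set K : EuclideanSpace ℝ (Fin n) × (ℝ × EuclideanSpace ℝ (Fin n)) → ℝ :=
    fun x => y (x.2 - (0, x.1)) with hKdef
  have hK : ContDiff ℝ 2 K := hy.1.comp (by fun_prop)
  have hKw : ∀ w, IsWave fun p => K (w, p) := fun w => by
    have := SolvesWave.comp_affine hy (ContinuousLinearMap.id ℝ _) (-(0, w)) (b := 1) (l := 1)
      (by simp) (by simp) rfl
    simpa [hKdef, sub_eq_add_neg] using this
  have hdist : C2NormLE (fun p => y p - ∫ w, K (w, p) ∂ν) r ε := by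
    have hI : ∀ p, Integrable (fun w => K (w, p)) ν := fun p =>
      integrable_of_continuous_of_ae_norm_le (hK.continuous.comp (by fun_prop)) hsupp
    have e : (fun p => y p - ∫ w, K (w, p) ∂ν) = fun p => ∫ w, (y p - K (w, p)) ∂ν := by
      funext p
      rw [integral_sub (integrable_const _) (hI p)]
      simp
    intro p hp
    have := c2BoundAt_integral (K := fun x : EuclideanSpace ℝ (Fin n) × _ => y x.2 - K x)
      ((hy.1.comp contDiff_snd).sub hK) hsupp (p := p) MeasurableSet.univ (C := ε) (by
        filter_upwards [hsupp] with w hw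
        refine ⟨fun _ => hsub p (0, w) hp ?_, fun h => absurd (mem_univ w) h⟩
        simpa using hw)
    rw [e]
    simpa using this
  refine ⟨fun p => ∫ w, K (w, p) ∂ν, SolvesWave.integral hsupp hK
    (contDiff_integral_of_ae_norm_le hsupp 2 hK) hKw, fun x => ?_, ?_, fun x hx => ?_, hdist⟩
  · simp [hKdef, hT]
  · have : (fun x => ∫ w, K (w, (0, x)) ∂ν) = MeasureTheory.convolution (φ.normed volume)
        (fun x => y (0, x)) (ContinuousLinearMap.mul ℝ ℝ) volume := by
      funext x
      rw [hint]
      simp [convolution, hKdef]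
    rw [this]
    exact φ.hasCompactSupport_normed.contDiff_convolution_left _ φ.contDiff_normed
      (hy.1.continuous.comp (by fun_prop)).locallyIntegrable
  · refine integral_eq_zero_of_ae ?_
    filter_upwards [hsupp] with w hw
    simp only [hKdef, Prod.mk_sub_mk, sub_zero, Pi.zero_apply]
    exact hx _ (by simpa using hw.trans hδ1)

theorem exists_smooth_cutoff {r : ℝ} (hr : 0 ≤ r) : ∃ χ : EuclideanSpace ℝ (Fin n) → ℝ,
    ContDiff ℝ (⊤ : ℕ∞) χ ∧ (∀ x, ‖x‖ ≤ r → χ x = 1) ∧ ∀ x, r + 1 < ‖x‖ → χ x = 0 := by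
  let φ : ContDiffBump (0 : EuclideanSpace ℝ (Fin n)) :=
    ⟨r + 1 / 2, r + 1, by positivity, by linarith⟩
  refine ⟨φ, φ.contDiff, fun x hx => φ.one_of_mem_closedBall ?_, fun x hx => φ.zero_of_le_dist ?_⟩
  · rw [mem_closedBall_zero_iff]; exact hx.trans (by linarith [show φ.rIn = r + 1 / 2 from rfl])
  · rw [dist_zero_right]; exact hx.le

/-- Every initial state can be controlled to zero up to a smooth remainder. -/
theorem exists_wave_smooth_remainder (hn : 1 ≤ n) {f : EuclideanSpace ℝ (Fin n) → ℝ}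
    (hf : ContDiff ℝ (n / 2 + 2 : ℕ) f) {T : ℝ} (hT : 0 < T) :
    ∃ y : ℝ × EuclideanSpace ℝ (Fin n) → ℝ, IsWave y ∧ (∀ x, y (T, x) = 0) ∧
      ContDiff ℝ (⊤ : ℕ∞) (fun x => f x - y (0, x)) := by
  choose ψ hψ hψ1 hψ0 using fun j : ℕ => exists_smooth_cutoff (n := n) (r := j) (by positivity)
  -- A partition of unity into shells: `χ j` lives in `j ≤ ‖x‖ ≤ j + 2`, except that `χ 0` is a full
  -- cutoff, and the partial sums telescope to `ψ (N + 1)`.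
  set χ : ℕ → EuclideanSpace ℝ (Fin n) → ℝ :=
    fun j x => ψ (j + 1) x - if j = 0 then 0 else ψ j x with hχ
  have hχs : ∀ j : ℕ, ContDiff ℝ (⊤ : ℕ∞) (χ j) := fun j => by
    simp only [hχ]
    split_ifs
    exacts [(hψ _).sub contDiff_const, (hψ _).sub (hψ _)]
  have hχ0 : ∀ (j : ℕ) x, (j : ℝ) + 2 < ‖x‖ → χ j x = 0 := fun j x hx => by
    have h1 : ψ (j + 1) x = 0 := hψ0 _ _ (by push_cast; linarith)
    have h2 : ψ j x = 0 := hψ0 _ _ (by linarith)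
    simp [hχ, h1, h2]
  have hχ1 : ∀ (j : ℕ) x, j ≠ 0 → ‖x‖ ≤ j → χ j x = 0 := fun j x hj hx => by
    have h1 : ψ (j + 1) x = 1 := hψ1 _ _ (by push_cast; linarith)
    simp [hχ, h1, hψ1 j x hx, hj]
  have hsum : ∀ N x, ∑ j ∈ Finset.range (N + 1), χ j x = ψ (N + 1) x := fun N x => by
    induction N with
    | zero => simp [hχ]
    | succ N ih => rw [Finset.sum_range_succ, ih]; simp [hχ]
  choose y hy hy0 hyT using fun j => exists_wave_of_compact_support hn
    (f := fun x => χ j x * f x) ((contDiff_infty.1 (hχs j) _).mul hf) (ρ := j + 2)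
    (fun x hx => by simp [hχ0 j x hx]) hT
  choose z hz hzT hzs hz0 hzd using fun j => (hy j).exists_smooth_approx (hyT j) (j : ℝ)
    (ε := (1 / 2) ^ j) (by positivity)
  have hw : ∀ j, IsWave fun p => y j p - z j p := fun j => (hy j).sub (hz j)
  have hb : ∀ r : ℝ, ∃ b : ℕ → ℝ, Summable b ∧ ∀ j, C2NormLE (fun p => y j p - z j p) r (b j) :=
    fun r => by
      obtain ⟨N, hN⟩ := exists_nat_ge r
      exact exists_summable_c2NormLE (fun j => (hw j).1) (N := N) summable_geometric_two
        fun j hj => (hzd j).mono (hN.trans (by exact_mod_cast hj)) le_rfl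
  refine ⟨fun p => ∑' j, (y j p - z j p), SolvesWave.tsum hw hb, fun x => by simp [hyT, hzT], ?_⟩
  rw [contDiff_iff_contDiffAt]
  intro x₀
  -- The margin covers the unit ball around `x₀` and the reach `1` of the mollification. For `j > N`
  -- both `y j` and `z j` therefore vanish near `x₀` at time `0`; in the remaining finite sum the `y
  -- j` add up to `f` and only the smooth `z j` are left.
  obtain ⟨N, hN⟩ := exists_nat_ge (‖x₀‖ + 3)
  have hloc : (fun x => f x - ∑' j, (y j (0, x) - z j (0, x))) =ᶠ[nhds x₀]
      fun x => ∑ j ∈ Finset.range (N + 1), z j (0, x) := by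
    filter_upwards [Metric.ball_mem_nhds x₀ one_pos] with x hx
    have hxN : ‖x‖ + 2 ≤ N := by
      have := norm_le_norm_add_norm_sub' x x₀
      rw [← dist_eq_norm] at this
      linarith [Metric.mem_ball.1 hx]
    have hvan : ∀ j ∉ Finset.range (N + 1), y j (0, x) - z j (0, x) = 0 := fun j hj => by
      have hjN : N < j := by simpa using hj
      have hjN' : (N : ℝ) ≤ j := by exact_mod_cast hjN.le
      rw [hz0 j x, hy0, hχ1 j x (by omega) (by linarith)]
      · simp
      · intro x' hx'
        have := norm_le_norm_add_norm_sub' x' x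
        rw [hy0, hχ1 j x' (by omega) (by linarith), zero_mul]
    rw [tsum_eq_sum hvan, Finset.sum_sub_distrib]
    simp only [hy0, ← Finset.sum_mul, hsum]
    rw [hψ1 (N + 1) x (by push_cast; linarith)]
    ring
  exact (ContDiff.sum fun j _ => hzs j).contDiffAt.congr_of_eventuallyEq hloc

end Smoothing

/-! ### Fourier series of functions supported in the unit cube -/

section FourierCube

open MeasureTheory UnitAddTorus

variable {n : ℕ}

/-- The representative of a point of the torus in the cube `(-1/2, 1/2]ⁿ`. -/
noncomputable def torusRep (z : UnitAddTorus (Fin n)) : EuclideanSpace ℝ (Fin n) :=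
  WithLp.toLp 2 fun i => (AddCircle.equivIoc (1 : ℝ) (-1 / 2) (z i) : ℝ)

theorem abs_torusRep (z : UnitAddTorus (Fin n)) (i : Fin n) : |torusRep z i| = ‖z i‖ := by
  have h := (AddCircle.equivIoc (1 : ℝ) (-1 / 2) (z i)).2
  have h' : |torusRep z i| ≤ |(1 : ℝ)| / 2 := by
    rw [abs_one, abs_le]
    constructor <;> simp only [torusRep] <;> linarith [h.1, h.2]
  rw [← (AddCircle.norm_coe_eq_abs_iff _ one_ne_zero).2 h']
  simp only [torusRep, AddCircle.coe_equivIoc]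

theorem torusRep_coe {x : Fin n → ℝ} (hx : ∀ i, x i ∈ Ioc (-1 / 2 : ℝ) (-1 / 2 + 1)) :
    torusRep (fun i => (x i : UnitAddCircle)) = WithLp.toLp 2 x := by
  simp [torusRep, AddCircle.equivIoc_coe_of_mem (hx _)]

/-- The representative in the cube jumps only where some coordinate is `±1/2`, and `G` vanishes near
these points. -/
theorem continuous_comp_torusRep {F : Type*} [NormedAddCommGroup F]
    {G : EuclideanSpace ℝ (Fin n) → F} (hG : Continuous G) {δ : ℝ} (hδ : 0 < δ)
    (hsupp : ∀ x, (∃ i, 1 / 2 - δ < |x i|) → G x = 0) : Continuous fun z => G (torusRep z) := by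
  rw [continuous_iff_continuousAt]
  intro z
  by_cases hz : ∀ i, z i ≠ ((-1 / 2 : ℝ) : UnitAddCircle)
  · refine hG.continuousAt.comp ?_
    refine (PiLp.continuous_toLp 2 _).continuousAt.comp (continuousAt_pi.2 fun i => ?_)
    exact continuous_subtype_val.continuousAt.comp
      (ContinuousAt.comp (f := fun w : UnitAddTorus (Fin n) => w i) (x := z)
        (AddCircle.continuousAt_equivIoc 1 _ (hz i)) (continuous_apply i).continuousAt)
  · push Not at hz
    obtain ⟨i, hi⟩ := hz
    have hopen : ∀ᶠ w : UnitAddTorus (Fin n) in nhds z, 1 / 2 - δ < ‖w i‖ := by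
      refine ((continuous_apply i).norm.tendsto z).eventually_const_lt ?_
      have : ‖((-1 / 2 : ℝ) : UnitAddCircle)‖ = |(-1 / 2 : ℝ)| :=
        (AddCircle.norm_coe_eq_abs_iff _ one_ne_zero).2 (by norm_num [abs_le])
      rw [hi, this]
      norm_num [abs_of_neg, hδ]
    refine (continuousAt_const (y := (0 : F))).congr ?_
    filter_upwards [hopen] with w hw
    exact (hsupp _ ⟨i, by rwa [abs_torusRep]⟩).symm

theorem mFourier_coe (k : Fin n → ℤ) (x : Fin n → ℝ) :
    mFourier k (fun i => (x i : UnitAddCircle)) =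
      Complex.exp (∑ i, 2 * Real.pi * Complex.I * k i * x i) := by
  rw [mFourier, ContinuousMap.coe_mk, Complex.exp_sum]
  refine Finset.prod_congr rfl fun i _ => ?_
  rw [fourier_coe_apply]
  simp

/-- The periodic extension of `G` is a continuous function on the torus; its Fourier coefficients
are integrals over all of space because `G` is supported in the cube. -/
theorem hasSum_fourier_series_cube {G : EuclideanSpace ℝ (Fin n) → ℂ} (hG : Continuous G) {δ : ℝ}
    (hδ : 0 < δ) (hsupp : ∀ x, (∃ i, 1 / 2 - δ < |x i|) → G x = 0)
    (hsum : Summable fun k : Fin n → ℤ =>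
      ∫ y, Complex.exp (-∑ i, 2 * Real.pi * Complex.I * k i * y i) * G y)
    {x : EuclideanSpace ℝ (Fin n)} (hx : ∀ i, |x i| < 1 / 2) :
    HasSum (fun k : Fin n → ℤ =>
      (∫ y, Complex.exp (-∑ i, 2 * Real.pi * Complex.I * k i * y i) * G y) *
        Complex.exp (∑ i, 2 * Real.pi * Complex.I * k i * x i)) (G x) := by
  set F : C(UnitAddTorus (Fin n), ℂ) := ⟨_, continuous_comp_torusRep hG hδ hsupp⟩
  have hx' : ∀ i, x i ∈ Ioc (-1 / 2 : ℝ) (-1 / 2 + 1) := fun i => by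
    have := abs_lt.1 (hx i)
    exact ⟨by linarith, by linarith⟩
  have hcoef : ∀ k : Fin n → ℤ, mFourierCoeff F k =
      ∫ y, Complex.exp (-∑ i, 2 * Real.pi * Complex.I * k i * y i) * G y := fun k => by
    have hmeas : MeasurableSet {x : Fin n → ℝ | ∀ i, x i ∈ Ioc (-1 / 2 : ℝ) (-1 / 2 + 1)} :=
      MeasurableSet.univ_pi' fun i => measurableSet_Ioc
    rw [mFourierCoeff_eq_integral F k fun _ => -1 / 2,
      ← (PiLp.volume_preserving_toLp (Fin n)).integral_comp
        (MeasurableEquiv.toLp 2 (Fin n → ℝ)).measurableEmbedding,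
      ← integral_indicator hmeas]
    congr 1
    funext y
    by_cases hy : y ∈ {x : Fin n → ℝ | ∀ i, x i ∈ Ioc (-1 / 2 : ℝ) (-1 / 2 + 1)}
    · rw [indicator_of_mem hy, mFourier_coe]
      have : F (fun i => (y i : UnitAddCircle)) = G (WithLp.toLp 2 y) := by
        rw [← torusRep_coe hy]; rfl
      rw [this, smul_eq_mul]
      simp
    · rw [indicator_of_notMem hy, hsupp, mul_zero]
      simp only [mem_ofPred_eq, not_forall] at hy
      obtain ⟨i, hi⟩ := hy
      refine ⟨i, ?_⟩
      by_contra! hle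
      have := abs_le.1 hle
      exact hi ⟨by simp at this; linarith, by simp at this; linarith⟩
  have h := hasSum_mFourier_series_apply_of_summable (f := F) (by rwa [show mFourierCoeff F = _ from funext hcoef])
    (fun i => (x i : UnitAddCircle))
  have hFx : F (fun i => (x i : UnitAddCircle)) = G x := by
    change G (torusRep _) = _
    rw [torusRep_coe hx']
  simpa only [hcoef, hFx, mFourier_coe, smul_eq_mul] using h

end FourierCube

/-! ### Summability over the integer lattice -/

theorem summable_prod_pi {n : ℕ} {α : Type*} [DecidableEq α] {u : α → ℝ} (hu : Summable u)
    (h0 : ∀ a, 0 ≤ u a) : Summable fun k : Fin n → α => ∏ i, u (k i) := by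
  refine summable_of_sum_le (c := (∑' a, u a) ^ n) (fun k => Finset.prod_nonneg fun i _ => h0 _)
    fun s => ?_
  set t : Fin n → Finset α := fun i => s.image fun k => k i
  calc ∑ k ∈ s, ∏ i, u (k i) ≤ ∑ k ∈ Fintype.piFinset t, ∏ i, u (k i) :=
        Finset.sum_le_sum_of_subset_of_nonneg
          (fun k hk => Fintype.mem_piFinset.2 fun i => Finset.mem_image_of_mem _ hk)
          fun k _ _ => Finset.prod_nonneg fun i _ => h0 _
    _ = ∏ i, ∑ a ∈ t i, u a := (Finset.prod_univ_sum t fun _ => u).symm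
    _ ≤ ∏ _i : Fin n, ∑' a, u a := Finset.prod_le_prod
        (fun i _ => Finset.sum_nonneg fun a _ => h0 a)
        fun i _ => hu.sum_le_tsum _ fun a _ => h0 a
    _ = _ := by simp

theorem summable_inv_one_add_abs_sq : Summable fun m : ℤ => ((1 + |(m : ℝ)|) ^ 2)⁻¹ := by
  have h : Summable fun m : ℕ => ((1 + (m : ℝ)) ^ 2)⁻¹ := by
    have := (summable_nat_add_iff 1).2 (Real.summable_nat_pow_inv.2 one_lt_two)
    simpa [add_comm] using this
  refine Summable.of_nat_of_neg ?_ ?_ <;> simpa using h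

/-! ### Exponentials of complex linear forms -/

section ExpMode

variable {V : Type*} [NormedAddCommGroup V] [NormedSpace ℝ V]

theorem hasFDerivAt_const_mul_cexp (c : ℂ) (Λ : V →L[ℝ] ℂ) (p : V) :
    HasFDerivAt (fun q => c * Complex.exp (Λ q)) ((c * Complex.exp (Λ p)) • Λ) p := by
  have := (Λ.hasFDerivAt (x := p)).cexp.const_mul c
  rwa [smul_smul] at this

theorem contDiff_re_const_mul_cexp (c : ℂ) (Λ : V →L[ℝ] ℂ) {k : WithTop ℕ∞} :
    ContDiff ℝ k fun q => (c * Complex.exp (Λ q)).re :=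
  Complex.reCLM.contDiff.comp (contDiff_const.mul Λ.contDiff.cexp)

theorem fderiv_re_const_mul_cexp (c : ℂ) (Λ : V →L[ℝ] ℂ) (p : V) :
    fderiv ℝ (fun q => (c * Complex.exp (Λ q)).re) p =
      Complex.reCLM.comp ((c * Complex.exp (Λ p)) • Λ) :=
  (Complex.reCLM.hasFDerivAt.comp p (hasFDerivAt_const_mul_cexp c Λ p)).fderiv

theorem fderiv_fderiv_re_const_mul_cexp_apply (c : ℂ) (Λ : V →L[ℝ] ℂ) (p u v : V) :
    fderiv ℝ (fderiv ℝ fun q => (c * Complex.exp (Λ q)).re) p u v =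
      (c * Complex.exp (Λ p) * Λ u * Λ v).re := by
  obtain ⟨Φ, hΦ⟩ : ∃ Φ : ℂ →L[ℝ] V →L[ℝ] ℝ, ∀ z w, Φ z w = (z * Λ w).re :=
    ⟨(ContinuousLinearMap.compL ℝ V ℂ ℝ Complex.reCLM).comp
      (((ContinuousLinearMap.compL ℝ V ℂ ℂ).flip Λ).comp (ContinuousLinearMap.mul ℝ ℂ)),
      fun z w => rfl⟩
  have h1 : fderiv ℝ (fun q => (c * Complex.exp (Λ q)).re) =
      fun q => Φ (c * Complex.exp (Λ q)) := by
    funext q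
    rw [fderiv_re_const_mul_cexp]
    ext w
    rw [hΦ]
    rfl
  have h2 : HasFDerivAt (fun q => Φ (c * Complex.exp (Λ q)))
      (Φ.comp ((c * Complex.exp (Λ p)) • Λ)) p :=
    Φ.hasFDerivAt.comp p (hasFDerivAt_const_mul_cexp c Λ p)
  rw [h1, h2.fderiv]
  exact hΦ _ _

theorem c2BoundAt_re_const_mul_cexp {c : ℂ} {Λ : V →L[ℝ] ℂ} {p : V} {K M : ℝ}
    (hK : ‖c * Complex.exp (Λ p)‖ ≤ K) (hΛ : ‖Λ‖ ≤ M) (hM : 1 ≤ M) :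
    C2BoundAt (fun q => (c * Complex.exp (Λ q)).re) p (K * M ^ 2) := by
  have hK0 : 0 ≤ K := (norm_nonneg _).trans hK
  refine ⟨?_, ?_, ?_⟩
  · exact (Complex.abs_re_le_norm _).trans
      (hK.trans (le_mul_of_one_le_right hK0 (one_le_pow₀ hM)))
  · refine ContinuousLinearMap.opNorm_le_bound _ (by positivity) fun u => ?_
    rw [fderiv_re_const_mul_cexp]
    refine (Complex.abs_re_le_norm _).trans ?_
    change ‖c * Complex.exp (Λ p) * Λ u‖ ≤ _
    rw [norm_mul, mul_assoc]
    gcongr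
    refine (Λ.le_opNorm u).trans ?_
    gcongr
    exact hΛ.trans (le_self_pow₀ hM (by simp))
  · refine ContinuousLinearMap.opNorm_le_bound _ (by positivity) fun u =>
      ContinuousLinearMap.opNorm_le_bound _ (by positivity) fun v => ?_
    rw [fderiv_fderiv_re_const_mul_cexp_apply]
    refine (Complex.abs_re_le_norm _).trans ?_
    rw [norm_mul, norm_mul]
    calc _ ≤ K * (M * ‖u‖) * (M * ‖v‖) := by
          gcongr
          · exact (Λ.le_opNorm u).trans (by gcongr)
          · exact (Λ.le_opNorm v).trans (by gcongr)
      _ = _ := by ring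

theorem solvesWave_re_const_mul_cexp {ι : Type*} [Fintype ι] {e₀ : V} {e : ι → V} (c : ℂ)
    {Λ : V →L[ℝ] ℂ} (h : Λ e₀ ^ 2 = ∑ i, Λ (e i) ^ 2) :
    SolvesWave e₀ e fun q => (c * Complex.exp (Λ q)).re := by
  refine ⟨contDiff_re_const_mul_cexp c Λ, fun p => ?_⟩
  simp only [waveForm, fderiv_fderiv_re_const_mul_cexp_apply, mul_assoc, ← pow_two]
  rw [← Complex.re_sum, ← Complex.sub_re, ← Finset.mul_sum, ← Finset.mul_sum, h, sub_self,
    Complex.zero_re]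

end ExpMode

/-! ### Smoothness of series of exponentials. -/

section ExpSeries

variable {V : Type} [NormedAddCommGroup V] [NormedSpace ℝ V] {κ : Type*}

theorem hasFDerivAt_cexp_smul {F : Type*} [NormedAddCommGroup F] [NormedSpace ℂ F]
    (Λ : V →L[ℝ] ℂ) (c : F) (p : V) :
    HasFDerivAt (fun q => Complex.exp (Λ q) • c) (Complex.exp (Λ p) • Λ.smulRight c) p := by
  have := (Λ.hasFDerivAt (x := p)).cexp.smul_const c
  convert this using 1
  ext w
  simp [smul_smul]

/-- Differentiation replaces the coefficient `c k` by `(Λ k).smulRight (c k)`, at the price of one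
factor `1 + ‖Λ k‖`. Since the hypothesis holds for all powers `m`, it survives, and the induction
runs over all coefficient spaces. -/
theorem contDiff_nat_tsum_cexp_smul (q : ℕ) : ∀ {F : Type} [NormedAddCommGroup F]
    [NormedSpace ℂ F] [CompleteSpace F] {Λ : κ → V →L[ℝ] ℂ} {c : κ → F},
    (∀ (m : ℕ) (r : ℝ), ∃ b : κ → ℝ, Summable b ∧ ∀ k p, ‖p‖ ≤ r →
      ‖Complex.exp (Λ k p)‖ * ‖c k‖ * (1 + ‖Λ k‖) ^ m ≤ b k) →
    ContDiff ℝ q fun p => ∑' k, Complex.exp (Λ k p) • c k := by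
  induction q with
  | zero =>
    intro F _ _ _ Λ c h
    refine contDiff_zero.2 (continuous_tsum_of_local_bound (fun k => by fun_prop) fun r => ?_)
    obtain ⟨b, hb, hb'⟩ := h 0 r
    exact ⟨b, hb, fun k p hp => by simpa [norm_smul] using hb' k p hp⟩
  | succ q ih =>
    intro F _ _ _ Λ c h
    have hd : ∀ k p, fderiv ℝ (fun q => Complex.exp (Λ k q) • c k) p =
        Complex.exp (Λ k p) • (Λ k).smulRight (c k) :=
      fun k p => (hasFDerivAt_cexp_smul (Λ k) (c k) p).fderiv
    have hn : ∀ k, ‖(Λ k).smulRight (c k)‖ ≤ ‖c k‖ * (1 + ‖Λ k‖) := fun k => by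
      refine ContinuousLinearMap.opNorm_le_bound _ (by positivity) fun u => ?_
      rw [ContinuousLinearMap.smulRight_apply, norm_smul]
      nlinarith [mul_le_mul_of_nonneg_left ((Λ k).le_opNorm u) (norm_nonneg (c k)),
        mul_nonneg (norm_nonneg (c k)) (norm_nonneg u)]
    have h1 := hasFDerivAt_tsum_of_local_bound
      (fun k p => (hasFDerivAt_cexp_smul (Λ k) (c k) p).differentiableAt) fun r => by
        obtain ⟨b, hb, hb'⟩ := h 1 r
        refine ⟨b, hb, fun k p hp => ⟨(le_of_eq ?_).trans ((le_mul_of_one_le_right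
          (by positivity) ?_).trans (hb' k p hp)), ?_⟩⟩
        · exact norm_smul _ _
        · simp
        · rw [hd, norm_smul]
          refine le_trans ?_ (hb' k p hp)
          rw [pow_one, mul_assoc]
          gcongr
          exact hn k
    push_cast
    rw [contDiff_succ_iff_fderiv]
    refine ⟨fun p => (h1 p).differentiableAt, by simp, ?_⟩
    have h2 : fderiv ℝ (fun p => ∑' k, Complex.exp (Λ k p) • c k) =
        fun p => ∑' k, Complex.exp (Λ k p) • (Λ k).smulRight (c k) := by
      funext p
      rw [(h1 p).fderiv]
      simp only [hd]
    rw [h2]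
    refine ih fun m r => ?_
    obtain ⟨b, hb, hb'⟩ := h (m + 1) r
    refine ⟨b, hb, fun k p hp => le_trans ?_ (hb' k p hp)⟩
    rw [pow_succ', ← mul_assoc, mul_assoc _ ‖c k‖]
    gcongr
    exact hn k

/-- A rapidly convergent series of complex exponentials is smooth. -/
theorem contDiff_tsum_cexp_smul {F : Type} [NormedAddCommGroup F]
    [NormedSpace ℂ F] [CompleteSpace F] {Λ : κ → V →L[ℝ] ℂ} {c : κ → F}
    (h : ∀ (m : ℕ) (r : ℝ), ∃ b : κ → ℝ, Summable b ∧ ∀ k p, ‖p‖ ≤ r →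
      ‖Complex.exp (Λ k p)‖ * ‖c k‖ * (1 + ‖Λ k‖) ^ m ≤ b k) :
    ContDiff ℝ (⊤ : ℕ∞) fun p => ∑' k, Complex.exp (Λ k p) • c k :=
  contDiff_infty.2 fun q => contDiff_nat_tsum_cexp_smul q h

end ExpSeries

/-! ### Laplace transforms of smooth functions -/

section Laplace

open MeasureTheory

variable {n : ℕ}

/-- The complex linear form with coefficients `η`. -/
noncomputable def spaceForm (η : Fin n → ℂ) : EuclideanSpace ℝ (Fin n) →L[ℝ] ℂ :=
  ∑ j, (EuclideanSpace.proj j).smulRight (η j)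

theorem spaceForm_apply (η : Fin n → ℂ) (x : EuclideanSpace ℝ (Fin n)) :
    spaceForm η x = ∑ j, η j * x j := by
  simp [spaceForm, sum_apply, mul_comm]

theorem spaceForm_single (η : Fin n → ℂ) (j : Fin n) :
    spaceForm η (EuclideanSpace.single j 1) = η j := by
  simp [spaceForm_apply, PiLp.single_apply, apply_ite Complex.ofReal]

theorem norm_spaceForm_le (η : Fin n → ℂ) : ‖spaceForm η‖ ≤ ∑ j, ‖η j‖ := by
  refine ContinuousLinearMap.opNorm_le_bound _ (Finset.sum_nonneg fun j _ => norm_nonneg _)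
    fun x => ?_
  rw [spaceForm_apply, Finset.sum_mul]
  refine (norm_sum_le _ _).trans (Finset.sum_le_sum fun j _ => ?_)
  rw [norm_mul]
  gcongr
  rw [Complex.norm_real]
  exact PiLp.norm_apply_le x j

/-- The two-sided Laplace transform of `f`. -/
noncomputable def laplaceTransform (f : EuclideanSpace ℝ (Fin n) → ℝ) (η : Fin n → ℂ) : ℂ :=
  ∫ x, Complex.exp (-spaceForm η x) * (f x : ℂ)

theorem mul_laplaceTransform {f : EuclideanSpace ℝ (Fin n) → ℝ} (hf : ContDiff ℝ 1 f)
    (hc : HasCompactSupport f) (η : Fin n → ℂ) (j : Fin n) :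
    η j * laplaceTransform f η =
      laplaceTransform (fun x => fderiv ℝ f x (EuclideanSpace.single j 1)) η := by
  have hd : ∀ x, HasFDerivAt (fun x => Complex.exp (-spaceForm η x))
      (Complex.exp (-spaceForm η x) • -spaceForm η) x := fun x =>
    ((spaceForm η).hasFDerivAt.neg).cexp
  have hfd : ∀ x, HasFDerivAt (fun x => (f x : ℂ)) (Complex.ofRealCLM.comp (fderiv ℝ f x)) x :=
    fun x => Complex.ofRealCLM.hasFDerivAt.comp x (hf.differentiable one_ne_zero x).hasFDerivAt
  have hcont : Continuous fun x => Complex.exp (-spaceForm η x) := by fun_prop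
  have hcf : Continuous fun x => (f x : ℂ) := Complex.continuous_ofReal.comp hf.continuous
  have hcf' : Continuous fun x => ((fderiv ℝ f x (EuclideanSpace.single j 1) : ℝ) : ℂ) :=
    Complex.continuous_ofReal.comp ((hf.continuous_fderiv one_ne_zero).clm_apply continuous_const)
  have hs : HasCompactSupport fun x => (f x : ℂ) := hc.comp_left Complex.ofReal_zero
  have hs' : HasCompactSupport fun x => ((fderiv ℝ f x (EuclideanSpace.single j 1) : ℝ) : ℂ) :=
    (hc.fderiv_apply (𝕜 := ℝ) _).comp_left Complex.ofReal_zero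
  have key := integral_bilinear_hasFDerivAt_right_eq_neg_left_of_integrable (μ := volume)
    (B := ContinuousLinearMap.mul ℝ ℂ) (v := EuclideanSpace.single j 1)
    (f := fun x => Complex.exp (-spaceForm η x)) (g := fun x => (f x : ℂ))
    (f' := fun x => Complex.exp (-spaceForm η x) • -spaceForm η)
    (g' := fun x => Complex.ofRealCLM.comp (fderiv ℝ f x))
    ?_ ?_ ?_ (fun x _ => hd x) (fun x _ => hfd x)
  · simp only [ContinuousLinearMap.mul_apply', ContinuousLinearMap.comp_apply,
      Complex.ofRealCLM_apply, smul_apply, neg_apply, spaceForm_single, smul_eq_mul] at key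
    rw [laplaceTransform, laplaceTransform, key, ← integral_neg, ← integral_const_mul]
    congr 1
    funext x
    ring
  · simp only [ContinuousLinearMap.mul_apply', smul_apply, neg_apply, spaceForm_single,
      smul_eq_mul]
    exact ((hcont.mul continuous_const).mul hcf).integrable_of_hasCompactSupport hs.mul_left
  · simp only [ContinuousLinearMap.mul_apply', ContinuousLinearMap.comp_apply,
      Complex.ofRealCLM_apply]
    exact (hcont.mul hcf').integrable_of_hasCompactSupport hs'.mul_left
  · simp only [ContinuousLinearMap.mul_apply']
    exact (hcont.mul hcf).integrable_of_hasCompactSupport hs.mul_left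

/-- The Paley-Wiener gain: only the support of `f` enters the exponent. A support in `x i ≥ a`
yields the factor `exp (-s a)` for frequencies with real part `s` in direction `i`. -/
theorem norm_laplaceTransform_le {f : EuclideanSpace ℝ (Fin n) → ℝ} (hf : Continuous f)
    (hc : HasCompactSupport f) {η : Fin n → ℂ} {a : ℝ}
    (ha : ∀ x ∈ tsupport f, a ≤ (spaceForm η x).re) :
    ‖laplaceTransform f η‖ ≤ (∫ x, |f x|) * Real.exp (-a) := by
  rw [← integral_mul_const]
  refine norm_integral_le_of_norm_le
    ((hf.abs.integrable_of_hasCompactSupport hc.norm).mul_const _) (.of_forall fun x => ?_)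
  rw [norm_mul, Complex.norm_exp, Complex.norm_real, Real.norm_eq_abs, mul_comm]
  by_cases hx : x ∈ tsupport f
  · gcongr
    simpa using ha x hx
  · simp [image_eq_zero_of_notMem_tsupport hx]

/-- Rapid decay of the Laplace transform of a smooth function with compact support. -/
theorem exists_laplaceTransform_bound (q : ℕ) {f : EuclideanSpace ℝ (Fin n) → ℝ}
    (hf : ContDiff ℝ (⊤ : ℕ∞) f) (hc : HasCompactSupport f) :
    ∃ C, 0 ≤ C ∧ ∀ (η : Fin n → ℂ) (a : ℝ), (∀ x ∈ tsupport f, a ≤ (spaceForm η x).re) →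
      (1 + ∑ j, ‖η j‖) ^ q * ‖laplaceTransform f η‖ ≤ C * Real.exp (-a) := by
  induction q generalizing f with
  | zero =>
    refine ⟨∫ x, |f x|, integral_nonneg fun x => abs_nonneg _, fun η a ha => ?_⟩
    simpa using norm_laplaceTransform_le hf.continuous hc ha
  | succ q ih =>
    obtain ⟨C, hC0, hC⟩ := ih hf hc
    choose D hD0 hD using fun j : Fin n =>
      ih (f := fun x => fderiv ℝ f x (EuclideanSpace.single j 1))
        ((hf.fderiv_right (m := (⊤ : ℕ∞)) (by simp)).clm_apply contDiff_const)
        (hc.fderiv_apply (𝕜 := ℝ) _)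
    refine ⟨C + ∑ j, D j, add_nonneg hC0 (Finset.sum_nonneg fun j _ => hD0 j), fun η a ha => ?_⟩
    have hsub : ∀ j, tsupport (fun x => fderiv ℝ f x (EuclideanSpace.single j 1)) ⊆ tsupport f :=
      fun j => tsupport_fderiv_apply_subset ℝ _
    have h : ∀ j, (1 + ∑ j, ‖η j‖) ^ q * (‖η j‖ * ‖laplaceTransform f η‖) ≤
        D j * Real.exp (-a) := fun j => by
      rw [← norm_mul, mul_laplaceTransform (hf.of_le (by simp)) hc]
      exact hD j η a fun x hx => ha x (hsub j hx)
    calc (1 + ∑ j, ‖η j‖) ^ (q + 1) * ‖laplaceTransform f η‖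
        = (1 + ∑ j, ‖η j‖) ^ q * ‖laplaceTransform f η‖ +
          ∑ j, (1 + ∑ j, ‖η j‖) ^ q * (‖η j‖ * ‖laplaceTransform f η‖) := by
          rw [← Finset.mul_sum, ← Finset.sum_mul]; ring
      _ ≤ C * Real.exp (-a) + ∑ j, D j * Real.exp (-a) :=
          add_le_add (hC η a ha) (Finset.sum_le_sum fun j _ => h j)
      _ = _ := by rw [← Finset.sum_mul]; ring

end Laplace

/-! ### Square roots of dispersion relations -/

section ComplexRoot

theorem abs_sinh_ge (x : ℝ) : |x| ≤ |Real.sinh x| := by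
  rw [Real.abs_sinh]
  exact Real.self_le_sinh_iff.2 (abs_nonneg x)

theorem abs_re_le_norm_sinh (z : ℂ) : |z.re| ≤ ‖Complex.sinh z‖ := by
  refine (abs_sinh_ge _).trans ?_
  have h := abs_norm_sub_norm_le (Complex.exp z) (Complex.exp (-z))
  rw [Complex.norm_exp, Complex.norm_exp, Complex.neg_re] at h
  rw [Complex.sinh, Real.sinh_eq, norm_div, Complex.norm_ofNat, abs_div, abs_two]
  gcongr

/-- Here `Re ρ * Im ρ = s θ`. If `|Re ρ| > s`, then `|Im ρ| ≤ |θ|`, which makes the real part of `ρ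
^ 2` too large. Consequently the growth rate in time of an exponential wave is at most its growth
rate `s` in space. -/
theorem abs_re_le_of_sq {ρ : ℂ} {s θ : ℝ} (hs : 0 ≤ s) (hre : (ρ ^ 2).re ≤ s ^ 2 - θ ^ 2)
    (him : (ρ ^ 2).im = 2 * s * θ) : |ρ.re| ≤ s := by
  rw [pow_two, Complex.mul_re] at hre
  rw [pow_two, Complex.mul_im] at him
  by_contra! h
  have h1 : s ^ 2 < ρ.re ^ 2 := by rw [← sq_abs ρ.re]; gcongr
  have h2 : ρ.im ^ 2 ≤ θ ^ 2 := by
    by_contra! h3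
    have : (s * θ) ^ 2 < (ρ.re * ρ.im) ^ 2 := by
      rw [mul_pow, mul_pow]
      exact mul_lt_mul'' h1 h3 (by positivity) (by positivity)
    rw [show s * θ = ρ.re * ρ.im by linarith] at this
    exact lt_irrefl _ this
  nlinarith

/-- Keeps `ρ` off the imaginary axis, where the zeros of `sinh (T ρ)` lie. -/
theorem mul_abs_le_of_sq_im {ρ : ℂ} {s θ : ℝ} (hs : 0 ≤ s) (him : (ρ ^ 2).im = 2 * s * θ) :
    s * |θ| ≤ ‖ρ‖ * |ρ.re| := by
  rw [pow_two, Complex.mul_im] at him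
  rw [← abs_of_nonneg hs, ← abs_mul, show s * θ = ρ.im * ρ.re by linarith, abs_mul]
  gcongr
  exact Complex.abs_im_le_norm ρ

end ComplexRoot

/-! ### Waves with exponential initial states -/

section ExpWave

variable {n : ℕ}

/-- The frequencies of the lattice `2πi ℤⁿ`, shifted by `s + πi` in direction `i`. -/
noncomputable def shiftedFreq (i : Fin n) (s : ℝ) (k : Fin n → ℤ) (j : Fin n) : ℂ :=
  2 * Real.pi * Complex.I * k j + if j = i then s + Real.pi * Complex.I else 0

theorem shiftedFreq_re (i : Fin n) (s : ℝ) (k : Fin n → ℤ) (j : Fin n) :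
    (shiftedFreq i s k j).re = if j = i then s else 0 := by
  simp only [shiftedFreq]
  split_ifs <;> simp

theorem shiftedFreq_im (i : Fin n) (s : ℝ) (k : Fin n → ℤ) (j : Fin n) :
    (shiftedFreq i s k j).im = 2 * Real.pi * k j + if j = i then Real.pi else 0 := by
  simp only [shiftedFreq]
  split_ifs <;> simp

theorem spaceForm_shiftedFreq_re (i : Fin n) (s : ℝ) (k : Fin n → ℤ)
    (x : EuclideanSpace ℝ (Fin n)) : (spaceForm (shiftedFreq i s k) x).re = s * x i := by
  simp [spaceForm_apply, Complex.re_sum, shiftedFreq_re, ite_mul]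

theorem abs_le_norm_shiftedFreq (i : Fin n) (s : ℝ) (k : Fin n → ℤ) (j : Fin n) :
    |(k j : ℝ)| ≤ ‖shiftedFreq i s k j‖ := by
  refine le_trans ?_ (Complex.abs_im_le_norm _)
  rw [shiftedFreq_im]
  have hint : |(k j : ℝ)| ≤ |2 * (k j : ℝ) + 1| := by
    have : |k j| ≤ |2 * k j + 1| := by
      rcases abs_cases (k j) with h | h <;> rcases abs_cases (2 * k j + 1) with h' | h' <;> omega
    exact_mod_cast this
  have hpi : 1 ≤ Real.pi := by linarith [Real.pi_gt_three]
  split_ifs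
  · rw [show 2 * Real.pi * k j + Real.pi = Real.pi * (2 * k j + 1) by ring, abs_mul,
      abs_of_pos Real.pi_pos]
    nlinarith [abs_nonneg (2 * (k j : ℝ) + 1)]
  · rw [add_zero, abs_mul, abs_of_pos (mul_pos two_pos Real.pi_pos)]
    nlinarith [abs_nonneg (k j : ℝ)]

theorem sum_sq_shiftedFreq_im (i : Fin n) (s : ℝ) (k : Fin n → ℤ) :
    (∑ j, shiftedFreq i s k j ^ 2).im = 2 * s * (2 * Real.pi * k i + Real.pi) := by
  simp only [Complex.im_sum, pow_two, Complex.mul_im, shiftedFreq_re, shiftedFreq_im]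
  simp [ite_mul, mul_ite, Finset.sum_add_distrib]
  ring

theorem sum_sq_shiftedFreq_re (i : Fin n) (s : ℝ) (k : Fin n → ℤ) :
    (∑ j, shiftedFreq i s k j ^ 2).re ≤ s ^ 2 - (2 * Real.pi * k i + Real.pi) ^ 2 := by
  simp only [Complex.re_sum, pow_two, Complex.mul_re, shiftedFreq_re, shiftedFreq_im,
    Finset.sum_sub_distrib]
  have h := Finset.single_le_sum (s := Finset.univ) (f := fun j =>
    (2 * Real.pi * k j + if j = i then Real.pi else 0) *
      (2 * Real.pi * k j + if j = i then Real.pi else 0)) (fun j _ => mul_self_nonneg _)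
      (Finset.mem_univ i)
  simp only [if_true] at h
  have h2 : ∑ j : Fin n, (if j = i then s else 0) * (if j = i then s else 0) = s * s := by
    simp
  linarith

theorem norm_sum_sq_le (η : Fin n → ℂ) : ‖∑ j, η j ^ 2‖ ≤ (∑ j, ‖η j‖) ^ 2 := by
  refine (norm_sum_le _ _).trans ?_
  simp only [norm_pow]
  exact Finset.sum_sq_le_sq_sum_of_nonneg fun j _ => norm_nonneg _

/-- The complex linear form on space-time with time frequency `ρ` and space frequencies `η`. -/
noncomputable def spaceTimeForm (ρ : ℂ) (η : Fin n → ℂ) :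
    ℝ × EuclideanSpace ℝ (Fin n) →L[ℝ] ℂ :=
  (ContinuousLinearMap.fst ℝ _ _).smulRight ρ +
    (spaceForm η).comp (ContinuousLinearMap.snd ℝ _ _)

theorem spaceTimeForm_apply (ρ : ℂ) (η : Fin n → ℂ) (p : ℝ × EuclideanSpace ℝ (Fin n)) :
    spaceTimeForm ρ η p = p.1 * ρ + spaceForm η p.2 := by
  simp [spaceTimeForm]

theorem norm_spaceTimeForm_le (ρ : ℂ) (η : Fin n → ℂ) :
    ‖spaceTimeForm ρ η‖ ≤ ‖ρ‖ + ∑ j, ‖η j‖ := by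
  have h0 : 0 ≤ ∑ j, ‖η j‖ := Finset.sum_nonneg fun j _ => norm_nonneg _
  refine ContinuousLinearMap.opNorm_le_bound _ (by positivity) fun p => ?_
  rw [spaceTimeForm_apply, add_mul]
  refine (norm_add_le _ _).trans (add_le_add ?_ ?_)
  · rw [norm_mul, Complex.norm_real, mul_comm]
    gcongr
    exact norm_fst_le p
  · refine ((spaceForm η).le_opNorm _).trans ?_
    gcongr
    exacts [norm_spaceForm_le η, norm_snd_le p]

theorem isWave_spaceTimeForm (c : ℂ) {ρ : ℂ} {η : Fin n → ℂ} (h : ρ ^ 2 = ∑ j, η j ^ 2) :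
    IsWave fun p => (c * Complex.exp (spaceTimeForm ρ η p)).re :=
  solvesWave_re_const_mul_cexp c (by simp [spaceTimeForm_apply, spaceForm_single, h])

/-- The wave with exponential initial state and vanishing state at time `T`. -/
theorem exists_wave_cexp (i : Fin n) {s T : ℝ} (hs : 1 ≤ s) (hT : 0 < T) (k : Fin n → ℤ) (c : ℂ) :
    ∃ w : ℝ × EuclideanSpace ℝ (Fin n) → ℝ, IsWave w ∧ (∀ x, w (T, x) = 0) ∧
      (∀ x, w (0, x) = (c * Complex.exp (spaceForm (shiftedFreq i s k) x)).re) ∧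
      ∀ r, C2NormLE w r (‖c‖ * (1 + ∑ j, ‖shiftedFreq i s k j‖) ^ 3 *
        (4 / T * Real.exp (s * (T + 2 * r)))) := by
  set η := shiftedFreq i s k with hη
  set N := 1 + ∑ j, ‖η j‖ with hN
  set θ := 2 * Real.pi * k i + Real.pi with hθ
  have hsum0 : 0 ≤ ∑ j, ‖η j‖ := Finset.sum_nonneg fun j _ => norm_nonneg _
  have hN1 : 1 ≤ N := by linarith
  obtain ⟨ρ, hρ⟩ := IsAlgClosed.exists_pow_nat_eq (∑ j, η j ^ 2) (n := 2) two_pos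
  have him : (ρ ^ 2).im = 2 * s * θ := by rw [hρ, hη, sum_sq_shiftedFreq_im]
  have hρre : |ρ.re| ≤ s := abs_re_le_of_sq (θ := θ) (by linarith)
    (by rw [hρ]; exact sum_sq_shiftedFreq_re i s k) him
  have hρN : ‖ρ‖ ≤ N := by
    refine le_trans ?_ (show ∑ j, ‖η j‖ ≤ N by linarith)
    refine (sq_le_sq₀ (norm_nonneg _) hsum0).1 ?_
    rw [← norm_pow, hρ]
    exact norm_sum_sq_le η
  have hθ1 : 1 ≤ |θ| := by
    have h1 : (1 : ℝ) ≤ |2 * (k i : ℝ) + 1| := by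
      have : 1 ≤ |2 * k i + 1| := Int.one_le_abs (by omega)
      exact_mod_cast this
    rw [hθ, show 2 * Real.pi * k i + Real.pi = Real.pi * (2 * k i + 1) by ring, abs_mul,
      abs_of_pos Real.pi_pos]
    nlinarith [Real.pi_gt_three]
  -- The shift by `π i` makes `θ` an odd multiple of `π`, so `s |θ| ≥ 1`. The small divisor `sinh (T
  -- ρ)` is then at least `T / N` in modulus.
  have hinv : 1 ≤ N * |ρ.re| := by
    have := mul_abs_le_of_sq_im (by linarith : 0 ≤ s) him
    nlinarith [mul_le_mul_of_nonneg_right hρN (abs_nonneg ρ.re)]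
  have hsinh : T / N ≤ ‖Complex.sinh (T * ρ)‖ := by
    refine le_trans ?_ (abs_re_le_norm_sinh _)
    rw [Complex.re_ofReal_mul, abs_mul, abs_of_pos hT, div_le_iff₀ (by linarith)]
    nlinarith
  have hsinh0 : Complex.sinh (T * ρ) ≠ 0 := fun h => by
    rw [h, norm_zero] at hsinh
    exact absurd hsinh (not_le.2 (by positivity))
  have hexp : ∀ t : ℝ, ‖Complex.exp (t * ρ)‖ ≤ Real.exp (s * |t|) := fun t => by
    rw [Complex.norm_exp, Complex.re_ofReal_mul]
    refine Real.exp_le_exp.2 ((le_abs_self _).trans ?_)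
    rw [abs_mul, mul_comm]
    gcongr
  have hcoef : ∀ t : ℝ, |t| = T → ‖c * (Complex.exp (t * ρ) / (2 * Complex.sinh (T * ρ)))‖ ≤
      ‖c‖ * (Real.exp (s * T) * (N / (2 * T))) := fun t ht => by
    rw [norm_mul, norm_div, norm_mul, Complex.norm_ofNat, div_eq_mul_inv]
    gcongr
    · exact ht ▸ hexp t
    · rw [← inv_div]
      gcongr
      rw [mul_div_assoc]
      gcongr
  have hbound : ∀ (ρ' d : ℂ) (r : ℝ), ‖ρ'‖ ≤ N → |ρ'.re| ≤ s →
      ‖d‖ ≤ ‖c‖ * (Real.exp (s * T) * (N / (2 * T))) →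
      C2NormLE (fun p => (d * Complex.exp (spaceTimeForm ρ' η p)).re) r
        (‖c‖ * (Real.exp (s * T) * (N / (2 * T))) * Real.exp (2 * s * r) * (2 * N) ^ 2) := by
    intro ρ' d r h1 h2 h3 p hp
    refine c2BoundAt_re_const_mul_cexp ?_ ?_ (by linarith)
    · rw [norm_mul]
      gcongr
      rw [Complex.norm_exp, spaceTimeForm_apply, Complex.add_re, Complex.re_ofReal_mul, hη,
        spaceForm_shiftedFreq_re]
      gcongr
      have e1 : |p.1| ≤ r := (norm_fst_le p).trans hp
      have e2 : |p.2 i| ≤ r := (PiLp.norm_apply_le p.2 i).trans ((norm_snd_le p).trans hp)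
      have e3 : p.1 * ρ'.re ≤ r * s := by
        refine (le_abs_self _).trans ?_
        rw [abs_mul]
        gcongr
        exact (abs_nonneg _).trans e1
      have e4 : s * p.2 i ≤ s * r := by
        gcongr
        exact (le_abs_self _).trans e2
      linarith
    · exact (norm_spaceTimeForm_le ρ' η).trans (by linarith)
  -- The wave is `c exp (η · x) sinh ((T - t) ρ) / sinh (T ρ)`, split into its two exponentials. In
  -- the bound, one factor `N` comes from the divisor and `(2 N) ^ 2` from two derivatives.
  set A := c * (Complex.exp (T * ρ) / (2 * Complex.sinh (T * ρ)))
  set B := c * (Complex.exp ((-T : ℝ) * ρ) / (2 * Complex.sinh (T * ρ)))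
  have hwA : IsWave fun p => (A * Complex.exp (spaceTimeForm (-ρ) η p)).re :=
    isWave_spaceTimeForm A (by rw [neg_sq, hρ])
  have hwB : IsWave fun p => (B * Complex.exp (spaceTimeForm ρ η p)).re :=
    isWave_spaceTimeForm B hρ
  refine ⟨_, hwA.sub hwB, fun x => ?_, fun x => ?_, fun r => ?_⟩
  · rw [← Complex.sub_re]
    simp only [A, B, spaceTimeForm_apply, Complex.exp_add]
    rw [Complex.ofReal_neg, mul_neg, neg_mul]
    ring_nf
    simp
  · rw [← Complex.sub_re]
    congr 1
    simp only [A, B, spaceTimeForm_apply, Complex.exp_add, Complex.ofReal_zero, zero_mul,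
      Complex.exp_zero, one_mul]
    have : Complex.exp (T * ρ) - Complex.exp ((-T : ℝ) * ρ) = 2 * Complex.sinh (T * ρ) := by
      rw [Complex.sinh]; push_cast; ring_nf
    have h0 : 2 * Complex.sinh (T * ρ) ≠ 0 := mul_ne_zero two_ne_zero hsinh0
    rw [← this] at h0 ⊢
    field_simp
    rw [mul_comm ρ, mul_div_cancel_right₀ _ h0]
  · intro p hp
    have h1 := hbound (-ρ) A r (by rwa [norm_neg]) (by rwa [Complex.neg_re, abs_neg])
      (hcoef T (abs_of_pos hT)) p hp
    have h2 := hbound ρ B r hρN hρre (hcoef (-T) (by rw [abs_neg, abs_of_pos hT])) p hp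
    have h3 := h1.sub hwA.1 hwB.1 h2
    convert h3 using 1
    rw [show s * (T + 2 * r) = s * T + 2 * s * r by ring, Real.exp_add]
    field_simp
    ring

end ExpWave

/-! ### Control of states supported in a cap -/

section Cap

open MeasureTheory

variable {n : ℕ}

theorem hasCompactSupport_of_cube {f : EuclideanSpace ℝ (Fin n) → ℝ} {l : ℝ}
    (h : ∀ x, (∃ j, l < |x j|) → f x = 0) : HasCompactSupport f := by
  refine HasCompactSupport.intro ((isCompact_univ_pi fun _ : Fin n =>
    isCompact_Icc (a := -l) (b := l)).image (PiLp.continuous_toLp 2 _)) fun x hx => h x ?_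
  by_contra! hle
  exact hx ⟨x.ofLp, fun j _ => abs_le.1 (hle j), rfl⟩

theorem laplaceTransform_shiftedFreq (f : EuclideanSpace ℝ (Fin n) → ℝ) (i : Fin n) (s : ℝ)
    (k : Fin n → ℤ) : laplaceTransform f (shiftedFreq i s k) =
      ∫ y, Complex.exp (-∑ j, 2 * Real.pi * Complex.I * k j * y j) *
        (Complex.exp (-((s + Real.pi * Complex.I) * y i)) * f y) := by
  refine integral_congr_ae (.of_forall fun y => ?_)
  simp only [spaceForm_apply, shiftedFreq, ← mul_assoc, ← Complex.exp_add]
  congr 2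
  simp [add_mul, Finset.sum_add_distrib, ite_mul]
  ring

/-- Uniform decay of the Laplace transform along shifted lattices. -/
theorem exists_laplaceTransform_shiftedFreq_bound {f : EuclideanSpace ℝ (Fin n) → ℝ}
    (hf : ContDiff ℝ (⊤ : ℕ∞) f) (hc : HasCompactSupport f) {i : Fin n} {a : ℝ}
    (ha : ∀ x, x i < a → f x = 0) :
    ∃ b : (Fin n → ℤ) → ℝ, Summable b ∧ (∀ k, 0 ≤ b k) ∧ ∀ q : ℕ, ∃ C, 0 ≤ C ∧
      ∀ (s : ℝ) (k : Fin n → ℤ), 0 ≤ s →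
      ‖laplaceTransform f (shiftedFreq i s k)‖ * (1 + ∑ j, ‖shiftedFreq i s k j‖) ^ q ≤
        C * Real.exp (-(s * a)) * b k := by
  refine ⟨fun k => ∏ j, ((1 + |(k j : ℝ)|) ^ 2)⁻¹,
    summable_prod_pi (n := n) (u := fun m : ℤ => ((1 + |(m : ℝ)|) ^ 2)⁻¹)
      summable_inv_one_add_abs_sq fun m => by positivity,
    fun k => Finset.prod_nonneg fun j _ => by positivity, fun q => ?_⟩
  -- The additional `2 n` powers pay for `∏ (1 + |k j|) ^ 2`, which makes the lattice sum converge
  -- uniformly in `s`.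
  obtain ⟨C, hC0, hC⟩ := exists_laplaceTransform_bound (q + 2 * n) hf hc
  refine ⟨C, hC0, fun s k hs => ?_⟩
  have hsupp : tsupport f ⊆ {x | a ≤ x i} := by
    refine closure_minimal (fun x hx => ?_) (isClosed_le continuous_const (by fun_prop))
    by_contra hlt
    exact hx (ha x (not_le.1 hlt))
  have h := hC (shiftedFreq i s k) (s * a) fun x hx => by
    rw [spaceForm_shiftedFreq_re]
    exact mul_le_mul_of_nonneg_left (hsupp hx) hs
  beta_reduce
  rw [Finset.prod_inv_distrib, ← div_eq_mul_inv,
    le_div_iff₀ (Finset.prod_pos fun j _ => by positivity)]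
  refine le_trans ?_ h
  have hprod : ∏ j, (1 + |(k j : ℝ)|) ^ 2 ≤ (1 + ∑ j, ‖shiftedFreq i s k j‖) ^ (2 * n) := by
    calc ∏ j, (1 + |(k j : ℝ)|) ^ 2 ≤ ∏ _j : Fin n, (1 + ∑ j, ‖shiftedFreq i s k j‖) ^ 2 := by
          refine Finset.prod_le_prod (fun j _ => by positivity) fun j _ => ?_
          refine pow_le_pow_left₀ (by positivity) (add_le_add le_rfl ?_) 2
          refine (abs_le_norm_shiftedFreq i s k j).trans ?_
          exact Finset.single_le_sum (f := fun j => ‖shiftedFreq i s k j‖)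
            (fun j _ => norm_nonneg _) (Finset.mem_univ j)
      _ = _ := by simp [pow_mul]
  refine (mul_le_mul_of_nonneg_left hprod (by positivity)).trans (le_of_eq ?_)
  ring

/-- Fourier series of `exp (-(s + π i) x i) f`, multiplied back by the inverse exponential. The sum
is periodic only up to that factor, so it represents `f` just inside the cube. -/
theorem hasSum_cexp_laplaceTransform {f : EuclideanSpace ℝ (Fin n) → ℝ} (hf : Continuous f)
    {δ : ℝ} (hδ : 0 < δ) (hsupp : ∀ x, (∃ j, 1 / 2 - δ < |x j|) → f x = 0) (i : Fin n) (s : ℝ)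
    (hsum : Summable fun k => laplaceTransform f (shiftedFreq i s k))
    {x : EuclideanSpace ℝ (Fin n)} (hx : ∀ j, |x j| < 1 / 2) :
    HasSum (fun k => Complex.exp (spaceForm (shiftedFreq i s k) x) •
      laplaceTransform f (shiftedFreq i s k)) (f x : ℂ) := by
  simp only [laplaceTransform_shiftedFreq] at hsum
  have h := hasSum_fourier_series_cube (n := n)
    (G := fun y => Complex.exp (-((s + Real.pi * Complex.I) * y i)) * f y)
    (by fun_prop) hδ (fun y hy => by simp [hsupp y hy]) hsum hx
  have h2 := h.mul_left (Complex.exp ((s + Real.pi * Complex.I) * x i))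
  rw [← mul_assoc, ← Complex.exp_add, add_neg_cancel, Complex.exp_zero, one_mul] at h2
  refine h2.congr_fun fun k => ?_
  rw [← laplaceTransform_shiftedFreq, smul_eq_mul, mul_left_comm, ← Complex.exp_add, mul_comm]
  congr 2
  simp only [spaceForm_apply, shiftedFreq, add_mul, Finset.sum_add_distrib, ite_mul, zero_mul,
    Finset.sum_ite_eq', Finset.mem_univ, if_true]
  ring

/-- A smooth state supported in the unit cube and in a half space `x i ≥ a` can be controlled
to zero by a wave that is small on balls well inside `x i < a`. -/
theorem exists_wave_of_unit_cap {i : Fin n} {f : EuclideanSpace ℝ (Fin n) → ℝ}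
    (hf : ContDiff ℝ (⊤ : ℕ∞) f) {δ : ℝ} (hδ : 0 < δ)
    (hsupp : ∀ x, (∃ j, 1 / 2 - δ < |x j|) → f x = 0) {a : ℝ} (ha : ∀ x, x i < a → f x = 0)
    {T r : ℝ} (hT : 0 < T) (har : T + 2 * r < a) {ε : ℝ} (hε : 0 < ε) :
    ∃ y : ℝ × EuclideanSpace ℝ (Fin n) → ℝ, IsWave y ∧ (∀ x, y (T, x) = 0) ∧
      ContDiff ℝ (⊤ : ℕ∞) (fun x => y (0, x)) ∧
      (∀ x, (∀ j, |x j| < 1 / 2) → y (0, x) = f x) ∧ C2NormLE y r ε := by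
  obtain ⟨b, hbs, hb0, hC⟩ :=
    exists_laplaceTransform_shiftedFreq_bound hf (hasCompactSupport_of_cube hsupp) ha
  choose C hC0 hC using hC
  -- The constants `C 3` and `b` do not depend on `s`, and `a > T + 2 * r`, so a large tilt `s`
  -- beats any `ε`. The index `3` is the power of the frequency lost in `exists_wave_cexp`.
  obtain ⟨s, hs1, hsε⟩ : ∃ s : ℝ, 1 ≤ s ∧
      C 3 * (4 / T) * (∑' k, b k) * Real.exp (-(s * (a - (T + 2 * r)))) ≤ ε := by
    have h1 : Filter.Tendsto (fun s : ℝ => s * (a - (T + 2 * r))) Filter.atTop Filter.atTop :=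
      Filter.tendsto_id.atTop_mul_const (by linarith)
    have h2 := (Real.tendsto_exp_neg_atTop_nhds_zero.comp h1).const_mul
      (C 3 * (4 / T) * (∑' k, b k))
    rw [mul_zero] at h2
    obtain ⟨s, hs, hs'⟩ := ((Filter.eventually_ge_atTop 1).and
      (h2.eventually_lt_const hε)).exists
    exact ⟨s, hs, hs'.le⟩
  have hs0 : 0 ≤ s := by linarith
  choose w hw hwT hw0 hwb using fun k =>
    exists_wave_cexp i hs1 hT k (laplaceTransform f (shiftedFreq i s k))
  have hwb' : ∀ (r : ℝ) k, C2NormLE (w k) r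
      (C 3 * Real.exp (-(s * a)) * (4 / T * Real.exp (s * (T + 2 * r))) * b k) := fun r k => by
    refine (hwb k r).mono le_rfl ?_
    rw [mul_right_comm (C 3 * _)]
    exact mul_le_mul_of_nonneg_right (hC 3 s k hs0) (by positivity)
  have hloc : ∀ r : ℝ, ∃ b : (Fin n → ℤ) → ℝ, Summable b ∧ ∀ k, C2NormLE (w k) r (b k) :=
    fun r => ⟨_, hbs.mul_left _, hwb' r⟩
  have hcb : ∀ (m : ℕ) (r : ℝ), ∃ b : (Fin n → ℤ) → ℝ, Summable b ∧ ∀ k p, ‖p‖ ≤ r →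
      ‖Complex.exp (spaceForm (shiftedFreq i s k) p)‖ *
        ‖laplaceTransform f (shiftedFreq i s k)‖ *
        (1 + ‖spaceForm (shiftedFreq i s k)‖) ^ m ≤ b k := fun m r => by
    refine ⟨_, hbs.mul_left (Real.exp (s * r) * (C m * Real.exp (-(s * a)))), fun k p hp => ?_⟩
    rw [mul_assoc, mul_assoc (Real.exp (s * r))]
    refine mul_le_mul ?_ (le_trans ?_ (hC m s k hs0)) (by positivity) (Real.exp_nonneg _)
    · rw [Complex.norm_exp, spaceForm_shiftedFreq_re]
      exact Real.exp_le_exp.2 (mul_le_mul_of_nonneg_left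
        ((le_abs_self _).trans ((PiLp.norm_apply_le p i).trans hp)) hs0)
    · exact mul_le_mul_of_nonneg_left (pow_le_pow_left₀ (by positivity)
        (add_le_add le_rfl (norm_spaceForm_le _)) m) (norm_nonneg _)
  have hcsum : ∀ x, Summable fun k => Complex.exp (spaceForm (shiftedFreq i s k) x) •
      laplaceTransform f (shiftedFreq i s k) := fun x => by
    obtain ⟨b', hb', h⟩ := hcb 0 ‖x‖
    refine Summable.of_norm_bounded hb' fun k => ?_
    simpa [norm_smul] using h k x le_rfl
  have hy0 : ∀ x, ∑' k, w k (0, x) =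
      (∑' k, Complex.exp (spaceForm (shiftedFreq i s k) x) •
        laplaceTransform f (shiftedFreq i s k)).re := fun x => by
    rw [← Complex.reCLM_apply, Complex.reCLM.map_tsum (hcsum x)]
    simp only [hw0, smul_eq_mul, mul_comm, Complex.reCLM_apply]
  refine ⟨fun p => ∑' k, w k p, SolvesWave.tsum hw hloc, fun x => by simp [hwT], ?_,
    fun x hx => ?_, ?_⟩
  · simp only [hy0]
    exact Complex.reCLM.contDiff.comp (contDiff_tsum_cexp_smul hcb)
  · have h := hasSum_cexp_laplaceTransform hf.continuous hδ hsupp i s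
      (by simpa using hcsum 0) hx
    refine (hy0 x).trans ?_
    rw [h.tsum_eq, Complex.ofReal_re]
  · refine (C2NormLE.tsum (fun k => (hw k).1) hloc (hbs.mul_left _) (hwb' r)).mono le_rfl ?_
    rw [tsum_mul_left]
    refine le_trans (le_of_eq ?_) hsε
    rw [show -(s * (a - (T + 2 * r))) = -(s * a) + s * (T + 2 * r) by ring, Real.exp_add]
    ring

end Cap

/-! ### Control of smooth states -/

section SmoothControl

variable {n : ℕ}

theorem isWave_zero : IsWave (fun _ : ℝ × EuclideanSpace ℝ (Fin n) => (0 : ℝ)) := by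
  refine ⟨contDiff_const, fun p => ?_⟩
  have h : fderiv ℝ (fun _ : ℝ × EuclideanSpace ℝ (Fin n) => (0 : ℝ)) = fun _ => 0 := by
    funext q; exact fderiv_const_apply _
  rw [h, fderiv_const_apply]
  simp [waveForm]

/-- Reduction to `exists_wave_of_unit_cap` by a dilation of space-time, combined for `σ = -1` with
`x ↦ -x`. The condition `T + 2 * r < a` is invariant under dilation, and stretching a wave by a
factor at least one does not increase its `C²` bounds. -/
theorem exists_wave_of_cap {i : Fin n} {σ : ℝ} (hσ : σ ^ 2 = 1) {f : EuclideanSpace ℝ (Fin n) → ℝ}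
    (hf : ContDiff ℝ (⊤ : ℕ∞) f) {ρ : ℝ} (hρ : 0 ≤ ρ) (hsupp : ∀ x, ρ < ‖x‖ → f x = 0) {a : ℝ}
    (ha : ∀ x, σ * x i < a → f x = 0) {T r : ℝ} (hT : 0 < T) (har : T + 2 * r < a) {ε : ℝ}
    (hε : 0 < ε) :
    ∃ y : ℝ × EuclideanSpace ℝ (Fin n) → ℝ, IsWave y ∧ (∀ x, y (T, x) = 0) ∧
      ContDiff ℝ (⊤ : ℕ∞) (fun x => y (0, x)) ∧ (∀ x, ‖x‖ ≤ ρ → y (0, x) = f x) ∧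
      C2NormLE y r ε := by
  -- After division by `l` the support lies within `|x j| ≤ 1 / 4`, leaving the margin `δ = 1 / 4`
  -- to the faces of the unit cube.
  obtain ⟨l, hl⟩ : ∃ l : ℝ, l = 4 * ρ + 4 := ⟨_, rfl⟩
  have hl0 : 0 < l := by linarith
  have hσ1 : |σ| = 1 := 
    (pow_eq_one_iff_of_nonneg (abs_nonneg σ) two_ne_zero).1 (by rw [sq_abs, hσ])
  have hscale : ∀ x : EuclideanSpace ℝ (Fin n), ∀ j, |x j| * l = |((σ * l) • x) j| := fun x j => by
    rw [PiLp.smul_apply, smul_eq_mul, abs_mul, abs_mul, hσ1, abs_of_pos hl0]; ring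
  obtain ⟨y, hy, hyT, hys, hy0, hyb⟩ := exists_wave_of_unit_cap (i := i)
    (f := fun x => f ((σ * l) • x)) (hf.comp (contDiff_const_smul _)) (δ := 1 / 4) (by norm_num)
    (fun x ⟨j, hj⟩ => hsupp _ (by
      refine lt_of_lt_of_le ?_ (PiLp.norm_apply_le _ j)
      rw [Real.norm_eq_abs, ← hscale]
      nlinarith)) (a := a / l)
    (fun x hx => ha _ (by
      rw [lt_div_iff₀ hl0] at hx
      rw [PiLp.smul_apply, smul_eq_mul]
      calc σ * (σ * l * x i) = σ ^ 2 * (x i * l) := by ring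
        _ < a := by rwa [hσ, one_mul]))
    (T := T / l) (r := r / l) (by positivity)
    (by rw [← mul_div_assoc, ← add_div]; gcongr) hε
  have hinv : (l⁻¹) ^ 2 = (σ * l⁻¹) ^ 2 := by rw [mul_pow, hσ, one_mul]
  have hback : ∀ x : EuclideanSpace ℝ (Fin n), (σ * l) • (σ * l⁻¹) • x = x := fun x => by
    rw [smul_smul, show σ * l * (σ * l⁻¹) = σ ^ 2 * (l * l⁻¹) by ring, hσ,
      mul_inv_cancel₀ hl0.ne', one_mul, one_smul]
  refine ⟨fun p => y (0 + l⁻¹ * p.1, (σ * l⁻¹) • p.2), hy.comp_dilation 0 _ _ hinv, fun x => ?_,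
    ?_, fun x hx => ?_, fun p hp => ?_⟩
  · beta_reduce
    rw [zero_add, inv_mul_eq_div]
    exact hyT _
  · simp only [mul_zero, add_zero]
    exact hys.comp (contDiff_const_smul _)
  · simp only [mul_zero, add_zero]
    rw [hy0, hback]
    intro j
    have h1 := hscale ((σ * l⁻¹) • x) j
    rw [hback] at h1
    have h2 : |x j| ≤ ρ := (PiLp.norm_apply_le x j).trans hx
    nlinarith
  · set A : ℝ × EuclideanSpace ℝ (Fin n) →L[ℝ] ℝ × EuclideanSpace ℝ (Fin n) :=
      (l⁻¹ • ContinuousLinearMap.fst ℝ _ _).prod ((σ * l⁻¹) • ContinuousLinearMap.snd ℝ _ _)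
    have hA : ∀ q, ‖A q‖ ≤ l⁻¹ * ‖q‖ := fun q => by
      refine norm_prod_le_iff.2 ⟨?_, ?_⟩
      · change ‖l⁻¹ • q.1‖ ≤ _
        rw [norm_smul, Real.norm_of_nonneg (by positivity)]
        gcongr
        exact norm_fst_le q
      · change ‖(σ * l⁻¹) • q.2‖ ≤ _
        rw [norm_smul, norm_mul, Real.norm_eq_abs σ, hσ1, one_mul,
          Real.norm_of_nonneg (by positivity)]
        gcongr
        exact norm_snd_le q
    have h1 : l⁻¹ ≤ 1 := inv_le_one_of_one_le₀ (by linarith)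
    have hb : C2BoundAt y (A p + 0) ε := hyb _ (by
      rw [add_zero, div_eq_inv_mul]
      exact (hA p).trans (by gcongr))
    have := hb.comp_affine hy.1 ((A.opNorm_le_bound (by positivity) hA).trans h1) le_rfl
    simpa [A] using this

/-- A state supported in a union of half spaces is split by cutoffs into states each supported in
one of them. A cutoff rises from `0` to `1` between the levels `a` and `a + 1`, so `θ f` lies in the
slightly larger half space while `(1 - θ) f` no longer needs the half space `c`. -/
theorem exists_wave_of_caps {a T r : ℝ} (hT : 0 < T) (har : T + 2 * r < a)
    (S : Finset (Fin n × ℤˣ)) :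
    ∀ {f : EuclideanSpace ℝ (Fin n) → ℝ}, ContDiff ℝ (⊤ : ℕ∞) f → ∀ {ρ : ℝ}, 0 ≤ ρ →
      (∀ x, ρ < ‖x‖ → f x = 0) →
      (∀ x, (∀ c ∈ S, ((c.2 : ℤ) : ℝ) * x c.1 < a + 1) → f x = 0) → ∀ {ε : ℝ}, 0 < ε →
    ∃ y : ℝ × EuclideanSpace ℝ (Fin n) → ℝ, IsWave y ∧ (∀ x, y (T, x) = 0) ∧
      ContDiff ℝ (⊤ : ℕ∞) (fun x => y (0, x)) ∧ (∀ x, ‖x‖ ≤ ρ → y (0, x) = f x) ∧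
      C2NormLE y r ε := by
  induction S using Finset.induction_on with
  | empty =>
    intro f _ ρ _ _ h0 ε hε
    refine ⟨fun _ => 0, isWave_zero, fun _ => rfl, contDiff_const,
      fun x _ => (h0 x (by simp)).symm, fun p _ => ?_⟩
    have h : fderiv ℝ (fun _ : ℝ × EuclideanSpace ℝ (Fin n) => (0 : ℝ)) = fun _ => 0 := by
      funext q; exact fderiv_const_apply _
    refine ⟨by simpa using hε.le, by simpa [h] using hε.le, ?_⟩
    rw [h, fderiv_const_apply]
    exact (ContinuousLinearMap.opNorm_zero).trans_le hε.le
  | insert c S _ ih =>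
    intro f hf ρ hρ hsupp h0 ε hε
    set θ : EuclideanSpace ℝ (Fin n) → ℝ :=
      fun x => Real.smoothTransition (((c.2 : ℤ) : ℝ) * x c.1 - a) with hθ
    have hθs : ContDiff ℝ (⊤ : ℕ∞) θ := Real.smoothTransition.contDiff.comp (by fun_prop)
    have hσ : ((c.2 : ℤ) : ℝ) ^ 2 = 1 := by
      rcases Int.units_eq_one_or c.2 with h | h <;> simp [h]
    obtain ⟨y, hy, hyT, hys, hy0, hyb⟩ := exists_wave_of_cap hσ (i := c.1)
      (f := fun x => θ x * f x) (hθs.mul hf) hρ (fun x hx => by simp [hsupp x hx]) (a := a)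
      (fun x hx => by
        rw [hθ, mul_eq_zero]
        exact Or.inl (Real.smoothTransition.zero_of_nonpos (by linarith))) hT har (half_pos hε)
    obtain ⟨z, hz, hzT, hzs, hz0, hzb⟩ := ih (f := fun x => (1 - θ x) * f x)
      ((contDiff_const.sub hθs).mul hf) hρ (fun x hx => by simp [hsupp x hx])
      (fun x hx => by
        by_cases hc : ((c.2 : ℤ) : ℝ) * x c.1 < a + 1
        · rw [h0 x, mul_zero]
          intro c' hc'
          rcases Finset.mem_insert.1 hc' with rfl | hc'
          exacts [hc, hx c' hc']
        · have : θ x = 1 := Real.smoothTransition.one_of_one_le (by linarith)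
          simp [this]) (half_pos hε)
    refine ⟨_, hy.add hz, fun x => by simp [hyT, hzT], hys.add hzs, fun x hx => ?_, fun p hp => ?_⟩
    · rw [hy0 x hx, hz0 x hx]; ring
    · have := (hyb p hp).add hy.1 hz.1 (hzb p hp)
      rwa [add_halves] at this

/-- Smooth states that vanish on a large ball can be controlled by waves that are small on a given
ball; the control is exact on any prescribed ball. -/
theorem exists_radius_wave {T : ℝ} (hT : 0 < T) (r : ℝ) : ∃ R : ℝ,
    ∀ {f : EuclideanSpace ℝ (Fin n) → ℝ}, ContDiff ℝ (⊤ : ℕ∞) f → (∀ x, ‖x‖ ≤ R → f x = 0) →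
      ∀ (ρ : ℝ) {ε : ℝ}, 0 < ε →
    ∃ y : ℝ × EuclideanSpace ℝ (Fin n) → ℝ, IsWave y ∧ (∀ x, y (T, x) = 0) ∧
      ContDiff ℝ (⊤ : ℕ∞) (fun x => y (0, x)) ∧ (∀ x, ‖x‖ ≤ ρ → y (0, x) = f x) ∧
      C2NormLE y r ε := by
  obtain ⟨a, ha⟩ : ∃ a, a = T + 2 * |r| + 1 := ⟨_, rfl⟩
  have hr := le_abs_self r
  -- Outside this ball some coordinate exceeds `a + 1` in modulus, so the `2 n` half spaces cover
  -- the support. The cutoff `χ` makes the state compactly supported without changing it on the ball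
  -- of radius `ρ`.
  refine ⟨n * (a + 1), fun {f} hf hf0 ρ ε hε => ?_⟩
  obtain ⟨χ, hχ, hχ1, hχ0⟩ := exists_smooth_cutoff (n := n) (abs_nonneg ρ)
  obtain ⟨y, hy, hyT, hys, hy0, hyb⟩ := exists_wave_of_caps (n := n) (a := a) (r := r) hT
    (by linarith) Finset.univ (f := fun x => χ x * f x) (hχ.mul hf) (ρ := |ρ| + 1) (by positivity)
    (fun x hx => by simp [hχ0 x hx]) (fun x hx => by
      rw [hf0, mul_zero]
      have h : ∀ j, |x j| ≤ a + 1 := fun j => abs_le.2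
        ⟨by have := hx (j, -1) (Finset.mem_univ _); simp at this; linarith,
          by have := hx (j, 1) (Finset.mem_univ _); simp at this; linarith⟩
      calc ‖x‖ = ‖∑ j, x j • EuclideanSpace.single j (1 : ℝ)‖ := by
            congr 1
            ext j
            simp [Pi.single_apply]
        _ ≤ ∑ j, ‖x j • EuclideanSpace.single j (1 : ℝ)‖ := norm_sum_le _ _
        _ ≤ ∑ _j : Fin n, (a + 1) := Finset.sum_le_sum fun j _ => by
            rw [norm_smul, PiLp.norm_single, norm_one, mul_one]; exact h j
        _ = n * (a + 1) := by simp [mul_add]) hε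
  refine ⟨y, hy, hyT, hys, fun x hx => ?_, hyb⟩
  have hx' : ‖x‖ ≤ |ρ| := hx.trans (le_abs_self ρ)
  rw [hy0 x (by linarith), hχ1 x hx', one_mul]

/-- Smooth initial states can be controlled to zero. -/
theorem exists_wave_of_smooth (hn : 1 ≤ n) {f : EuclideanSpace ℝ (Fin n) → ℝ}
    (hf : ContDiff ℝ (⊤ : ℕ∞) f) {T : ℝ} (hT : 0 < T) :
    ∃ y : ℝ × EuclideanSpace ℝ (Fin n) → ℝ, IsWave y ∧ (∀ x, y (0, x) = f x) ∧
      ∀ x, y (T, x) = 0 := by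
  choose R hR using fun j : ℕ => exists_radius_wave (n := n) hT (j : ℝ)
  -- Stated as an implication for arbitrary `g`, so that `Y` is a total function and the remainders
  -- can be defined by recursion before their properties are known. The radius contains `R (j + 1)`
  -- to make the next step applicable and `j + 1` to exhaust space.
  have hstep : ∀ (j : ℕ) (g : EuclideanSpace ℝ (Fin n) → ℝ),
      ∃ y : ℝ × EuclideanSpace ℝ (Fin n) → ℝ, ContDiff ℝ (⊤ : ℕ∞) g →
        (∀ x, ‖x‖ ≤ R j → g x = 0) → IsWave y ∧ (∀ x, y (T, x) = 0) ∧
        ContDiff ℝ (⊤ : ℕ∞) (fun x => y (0, x)) ∧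
        (∀ x, ‖x‖ ≤ max (R (j + 1)) (j + 1) → y (0, x) = g x) ∧ C2NormLE y j ((1 / 2) ^ j) :=
    fun j g => by
      by_cases h : ContDiff ℝ (⊤ : ℕ∞) g ∧ ∀ x, ‖x‖ ≤ R j → g x = 0
      · obtain ⟨y, hy⟩ := hR j h.1 h.2 (max (R (j + 1)) (j + 1)) (ε := (1 / 2) ^ j)
          (by positivity)
        exact ⟨y, fun _ _ => hy⟩
      · exact ⟨fun _ => 0, fun h1 h2 => absurd ⟨h1, h2⟩ h⟩
  choose Y hY using hstep
  obtain ⟨χ, hχ, hχ1, hχ0⟩ := exists_smooth_cutoff (n := n) (abs_nonneg (R 0))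
  obtain ⟨y₀, hy₀, hy₀0, hy₀T⟩ := exists_wave_of_compact_support hn (f := fun x => χ x * f x)
    (contDiff_infty.1 (hχ.mul hf) _) (ρ := |R 0| + 1) (fun x hx => by simp [hχ0 x hx]) hT
  -- The part of `f` not yet controlled after `j` corrections. It vanishes on the ball of radius `R
  -- j`; the part of `f` near the origin is left to `y₀`.
  set g : ℕ → EuclideanSpace ℝ (Fin n) → ℝ := fun j =>
    Nat.rec (fun x => f x - χ x * f x) (fun j g x => g x - Y j g (0, x)) j with hg
  have hg1 : ∀ j x, g (j + 1) x = g j x - Y j (g j) (0, x) := fun j x => rfl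
  have hgP : ∀ j, ContDiff ℝ (⊤ : ℕ∞) (g j) ∧ ∀ x, ‖x‖ ≤ R j → g j x = 0 := fun j => by
    induction j with
    | zero =>
      refine ⟨hf.sub (hχ.mul hf), fun x hx => ?_⟩
      simp [hg, hχ1 x (hx.trans (le_abs_self _))]
    | succ j ih =>
      obtain ⟨-, -, h1, h2, -⟩ := hY j (g j) ih.1 ih.2
      refine ⟨ih.1.sub h1, fun x hx => ?_⟩
      rw [hg1, h2 x (hx.trans (le_max_left _ _)), sub_self]
  have hYP := fun j => hY j (g j) (hgP j).1 (hgP j).2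
  have hgv : ∀ (j : ℕ) x, ‖x‖ ≤ j + 1 → g (j + 1) x = 0 := fun j x hx => by
    rw [hg1, (hYP j).2.2.2.1 x (hx.trans (le_max_right _ _)), sub_self]
  have hloc : ∀ r : ℝ, ∃ b : ℕ → ℝ, Summable b ∧ ∀ j, C2NormLE (Y j (g j)) r (b j) := fun r => by
    obtain ⟨N, hN⟩ := exists_nat_ge r
    exact exists_summable_c2NormLE (fun j => (hYP j).1.1) (N := N) summable_geometric_two
      fun j hj => (hYP j).2.2.2.2.mono (hN.trans (by exact_mod_cast hj)) le_rfl
  refine ⟨_, hy₀.add (SolvesWave.tsum (fun j => (hYP j).1) hloc), fun x => ?_, fun x => ?_⟩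
  · have hpart : ∀ N, ∑ j ∈ Finset.range N, Y j (g j) (0, x) = g 0 x - g N x := fun N => by
      induction N with
      | zero => simp
      | succ N ih => rw [Finset.sum_range_succ, ih, hg1]; ring
    have hs : Summable fun j => Y j (g j) (0, x) := by
      obtain ⟨b, hb, hb'⟩ := hloc ‖((0, x) : ℝ × EuclideanSpace ℝ (Fin n))‖
      exact Summable.of_norm_bounded hb fun j => (hb' j _ le_rfl).1
    have hlim : Filter.Tendsto (fun N => ∑ j ∈ Finset.range N, Y j (g j) (0, x)) Filter.atTop
        (nhds (g 0 x)) := by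
      obtain ⟨N, hN⟩ := exists_nat_ge ‖x‖
      refine tendsto_const_nhds.congr' ?_
      filter_upwards [Filter.eventually_ge_atTop (N + 1)] with M hM
      obtain ⟨M, rfl⟩ : ∃ k, M = k + 1 := ⟨M - 1, by omega⟩
      have : (N : ℝ) ≤ M := by exact_mod_cast (by omega : N ≤ M)
      rw [hpart, hgv M x (by linarith), sub_zero]
    rw [tendsto_nhds_unique hs.hasSum.tendsto_sum_nat hlim, hy₀0]
    simp [hg]
  · simp [hy₀T, (hYP _).2.1]

/-- Every initial state of class `C^{⌊n/2⌋+2}` can be controlled to zero. -/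
theorem exists_wave_null_control (hn : 1 ≤ n) {f : EuclideanSpace ℝ (Fin n) → ℝ}
    (hf : ContDiff ℝ (n / 2 + 2 : ℕ) f) {T : ℝ} (hT : 0 < T) :
    ∃ y : ℝ × EuclideanSpace ℝ (Fin n) → ℝ, IsWave y ∧ (∀ x, y (0, x) = f x) ∧
      ∀ x, y (T, x) = 0 := by
  obtain ⟨y, hy, hyT, hys⟩ := exists_wave_smooth_remainder hn hf hT
  obtain ⟨z, hz, hz0, hzT⟩ := exists_wave_of_smooth hn hys hT
  exact ⟨_, hy.add hz, fun x => by rw [hz0]; ring, fun x => by rw [hyT, hzT, add_zero]⟩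

end SmoothControl

/-! ### The two-point boundary value problem -/

section TwoPoint

variable {n : ℕ}

/-- The solutions are defined for all times, so the one-sided derivatives at the end times are
ordinary ones. -/
theorem iteratedDerivWithin_two_Icc {T t : ℝ} (hT : 0 < T) (ht : t ∈ Icc (0 : ℝ) T) {h : ℝ → ℝ}
    (hh : ContDiff ℝ 2 h) :
    iteratedDerivWithin 2 h (Icc (0 : ℝ) T) t = fderiv ℝ (fderiv ℝ h) t 1 1 := by
  rw [iteratedDerivWithin_eq_iteratedDeriv (uniqueDiffOn_Icc hT) hh.contDiffAt ht,
    iteratedDeriv_eq_iteratedFDeriv, iteratedFDeriv_two_apply]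

theorem laplacian_eq_sum_fderiv_fderiv (f : EuclideanSpace ℝ (Fin n) → ℝ)
    (x : EuclideanSpace ℝ (Fin n)) : (Δ f) x =
      ∑ i, fderiv ℝ (fderiv ℝ f) x (EuclideanSpace.single i 1) (EuclideanSpace.single i 1) := by
  rw [InnerProductSpace.laplacian_eq_iteratedFDeriv_orthonormalBasis f
    (EuclideanSpace.basisFun (Fin n) ℝ)]
  simp [iteratedFDeriv_two_apply]

theorem IsWave.isC2WaveSolution {z : ℝ × EuclideanSpace ℝ (Fin n) → ℝ} (hz : IsWave z) {b c T : ℝ}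
    (hT : 0 < T) (hb : b ^ 2 = c ^ 2) : IsC2WaveSolution n c T fun t x => z (b * t, x) := by
  refine ⟨(hz.1.comp (by fun_prop)).contDiffOn, fun t ht x => ?_⟩
  have h1 : (fun s => z (b * s, x)) = fun s =>
      z (ContinuousLinearMap.toSpanSingleton ℝ (b, 0) s + (0, x)) := by
    funext s
    simp [mul_comm]
  have h2 : (fun x' => z (b * t, x')) = fun x' =>
      z (ContinuousLinearMap.inr ℝ ℝ (EuclideanSpace ℝ (Fin n)) x' + (b * t, 0)) := by
    funext x'
    simp
  have h0 : ContDiff ℝ 2 fun s => z (b * s, x) := hz.1.comp (by fun_prop)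
  rw [iteratedDerivWithin_two_Icc hT ht h0, laplacian_eq_sum_fderiv_fderiv,
    h1, h2, fderiv_fderiv_comp_affine hz.1, fderiv_fderiv_comp_affine hz.1]
  have hw := hz.2 (b * t, x)
  have h3 : ((b, 0) : ℝ × EuclideanSpace ℝ (Fin n)) = b • (1, 0) := by simp
  have h4 : t • b • ((1, 0) : ℝ × EuclideanSpace ℝ (Fin n)) + (0, x) = (b * t, x) := by
    simp [mul_comm]
  rw [waveForm] at hw
  simp only [ContinuousLinearMap.comp_apply, ContinuousLinearMap.flip_apply,
    ContinuousLinearMap.compL_apply, ContinuousLinearMap.inr_apply, h4,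
    ContinuousLinearMap.toSpanSingleton_apply, one_smul, h3, map_smul, smul_apply, smul_eq_mul,
    Prod.mk_add_mk, zero_add, add_zero]
  linear_combination b ^ 2 * hw + hb * ∑ i, fderiv ℝ (fderiv ℝ z) (b * t, x)
    (0, EuclideanSpace.single i 1) (0, EuclideanSpace.single i 1)

/-- Linear interpolation in time solves the boundary value problem when the spatial part of the
wave operator vanishes. -/
theorem isTwoPointSolution_interpolation {c T : ℝ} (hT : 0 < T)
    {f g : EuclideanSpace ℝ (Fin n) → ℝ} (hf : ContDiff ℝ 2 f) (hg : ContDiff ℝ 2 g)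
    (h : ∀ (φ : EuclideanSpace ℝ (Fin n) → ℝ) x, c ^ 2 * (Δ φ) x = 0) :
    IsTwoPointSolution n c T f g fun t x => f x + t * (T⁻¹ * (g x - f x)) := by
  refine ⟨⟨ContDiff.contDiffOn ?_, fun t ht x => ?_⟩, fun x => by simp, fun x => ?_⟩
  · exact (hf.comp contDiff_snd).add (contDiff_fst.mul (contDiff_const.mul
      ((hg.comp contDiff_snd).sub (hf.comp contDiff_snd))))
  · rw [h, sub_zero, iteratedDerivWithin_two_Icc hT ht (by fun_prop)]
    have : fderiv ℝ (fun s : ℝ => f x + s * (T⁻¹ * (g x - f x))) = fun _ =>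
        ContinuousLinearMap.toSpanSingleton ℝ (T⁻¹ * (g x - f x)) := by
      funext s
      refine (((hasDerivAt_id s).mul_const _).const_add _).hasFDerivAt.fderiv.trans ?_
      simp
    rw [this, fderiv_const_apply]
    rfl
  · rw [mul_inv_cancel_left₀ hT.ne']
    ring

/-- Add the null control of `f` and the time reversal of the null control of `g`, both over the
rescaled horizon `|c| * T`. For `c = 0` that horizon degenerates, and null control needs `n ≥ 1`; in
both cases interpolation suffices. -/
theorem exists_isTwoPointSolution (n : ℕ) (c : ℝ) {T : ℝ} (hT : 0 < T)
    {f g : EuclideanSpace ℝ (Fin n) → ℝ} (hf : ContDiff ℝ (n / 2 + 2 : ℕ) f)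
    (hg : ContDiff ℝ (n / 2 + 2 : ℕ) g) :
    ∃ y : ℝ → EuclideanSpace ℝ (Fin n) → ℝ, IsTwoPointSolution n c T f g y := by
  have h2 : (2 : WithTop ℕ∞) ≤ (n / 2 + 2 : ℕ) := by exact_mod_cast Nat.le_add_left 2 _
  by_cases hc : c = 0
  · exact ⟨_, isTwoPointSolution_interpolation hT (hf.of_le h2) (hg.of_le h2) (by simp [hc])⟩
  rcases Nat.eq_zero_or_pos n with rfl | hn
  · exact ⟨_, isTwoPointSolution_interpolation hT (hf.of_le h2) (hg.of_le h2) fun φ x => by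
      simp [laplacian_eq_sum_fderiv_fderiv]⟩
  have hcT : 0 < |c| * T := mul_pos (abs_pos.2 hc) hT
  obtain ⟨y, hy, hy0, hyT⟩ := exists_wave_null_control hn hf hcT
  obtain ⟨z, hz, hz0, hzT⟩ := exists_wave_null_control hn hg hcT
  refine ⟨_, IsWave.isC2WaveSolution (hy.add (hz.comp_dilation (|c| * T) (-1) 1 (by norm_num))) hT
    (sq_abs c), fun x => ?_, fun x => ?_⟩
  · simp [hy0, hzT]
  · simp [hyT, hz0]

end TwoPoint

theorem theorem1p1 (n : ℕ) (c : ℝ) :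
    (∀ f g : EuclideanSpace ℝ (Fin n) → ℝ,
      ContDiff ℝ ((n / 2 + 2 : ℕ) : WithTop ℕ∞) f →
      ContDiff ℝ ((n / 2 + 2 : ℕ) : WithTop ℕ∞) g →
      ∀ T : ℝ, 0 < T →
        ∃ y : ℝ → EuclideanSpace ℝ (Fin n) → ℝ, IsTwoPointSolution n c T f g y) ∧
    GloballyExactlyControllable n c :=
  ⟨fun _ _ hf hg _ hT => exists_isTwoPointSolution n c hT hf hg,
    fun _ hT _ _ hf hg => exists_isTwoPointSolution n c hT hf hg⟩
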